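/- Let $\mathcal{P}=\{p_1<p_2<\dots\}$ be a set of real numbers with $p_1\ge 1$ and $p_n\to\infty$, and suppose that for some real number $\alpha$ its counting function satisfies $$\pi(x):=|\{p\in\mathcal{P}:p\le x\}|=(1+o(1))\,x(\log x)^{\alpha},\qquad x\to\infty .$$ Let $(X_p)_{p\in\mathcal{P}}$ be independent standard Gaussian random variables, let $$F(\sigma)=\sum_{p\in\mathcal{P}}\frac{X_p}{p^{\sigma}}$$ (the sum being taken in increasing order of $p$; almost surely it converges for all $\sigma>1/2$), and for $T>1/2$ let $N_\alpha(T,\infty)$ be the number of zeros of $F$ in $[T,\infty)$, counted without multiplicity. Then $\mathbb{E}N_\alpha(T,\infty)<\infty$ for every $T>1/2$ and, as $T\to 1/2^+$, $$\mathbb{E}N_\alpha(T,\infty)=(1+o(1))\times\begin{cases}\dfrac{\sqrt{1+\alpha}}{2\pi}\log\left(\dfrac{1}{T-1/2}\right), & \text{if }\alpha>-1,\\[2mm] \dfrac{1}{\pi}\sqrt{\log\left(\dfrac{1}{T-1/2}\right)}, & \text{if }\alpha=-1,\\[2mm] c, & \text{if }\alpha<-1,\end{cases}$$ where $c>0$ is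 a real number that depends only on the set $\mathcal{P}$. -/

import Mathlib

open Filter Topology MeasureTheory ProbabilityTheory Asymptotics
open scoped ENNReal

namespace RandomDirichlet

/-- The counting function `π(x) = |{p ∈ P : p ≤ x}|` of the set `P = {p 0 < p 1 < ...}`,
enumerated by the strictly increasing sequence `p`. -/
noncomputable def countingFunction (p : ℕ → ℝ) (x : ℝ) : ℝ :=
  ({n : ℕ | p n ≤ x}.ncard : ℝ)

/-- The partial sum `∑_{k < n} x_k / p_k ^ σ` of a general Dirichlet series with coefficients
`x` and frequencies given by `p`. -/
noncomputable def partialSum (p : ℕ → ℝ) (x : ℕ → ℝ) (σ : ℝ) (n : ℕ) : ℝ :=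
  ∑ k ∈ Finset.range n, x k / p k ^ σ

/-- The set of real zeros in `[T, ∞)` of `F(σ) = ∑_k x_k / p_k ^ σ`: the points `σ ≥ T` at which
the series, summed in the order of increasing `p_k`, converges to `0`. -/
def zeroSet (p : ℕ → ℝ) (x : ℕ → ℝ) (T : ℝ) : Set ℝ :=
  {σ : ℝ | T ≤ σ ∧ Tendsto (partialSum p x σ) atTop (𝓝 0)}

/-- The number `N(T, ∞)` of real zeros in `[T, ∞)`, counted without multiplicity,
as an extended nonnegative real number. -/
noncomputable def numZeros (p : ℕ → ℝ) (x : ℕ → ℝ) (T : ℝ) : ℝ≥0∞ :=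
  ((zeroSet p x T).encard : ℝ≥0∞)

/-- The expected number `𝔼 N(T, ∞)` of real zeros in `[T, ∞)` of the random Dirichlet series
`F(σ) = ∑_k X_k / p_k ^ σ`. -/
noncomputable def expectedNumZeros {Ω : Type*} [MeasurableSpace Ω] (μ : Measure Ω)
    (p : ℕ → ℝ) (X : ℕ → Ω → ℝ) (T : ℝ) : ℝ≥0∞ :=
  ∫⁻ ω, numZeros p (fun n => X n ω) T ∂μ

end RandomDirichlet

/-! F is a centred Gaussian process on (1/2, ∞) with covariance K(s + t), where K(u) = ∑ p_n^(-u).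
Two centred Gaussians with correlation cos θ have opposite signs with probability θ/π
(`measure_limSeries_mul_neg`), so the expected number of sign changes of F along a grid on [T, ∞) is
1/π times the sum of the angles between consecutive grid points. With g = (log K)'', the correlation
of F(s) and F(t) is exactly exp(-(t - s)² g(ξ)/2) for some ξ between 2s and 2t. Each angle is
therefore (t - s)√g(ξ) up to a lower-order error, and as the mesh shrinks the sums converge to ∫_T^∞
√g(2s) ds (`tendsto_tsum_angle`).

Sign changes along a grid never outnumber the zeros. Conversely, every zero is detected by all
sufficiently fine grids unless it is a grid point, which has probability 0, or F fails to take both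
signs near it. To exclude the latter, write p_0^σ F(σ) = X_0 + R(σ) with R independent of X_0: at
such a zero, -X_0 equals the supremum or infimum of R over an interval with rational endpoints,
which has probability 0 because X_0 has no atoms (`ae_sign_change_near_zero`). Fatou's lemma then
gives E N(T, ∞) = (1/π) ∫_T^∞ √g(2s) ds (`lintegral_numZeros`), without differentiating F.

For the asymptotics, K(u) = u ∫_0^∞ π(e^t) e^(-t) e^(-(u-1)t) dt with π(e^t) e^(-t) ~ t^α, and an
Abelian argument describes g at 1: g(1 + δ) ~ (1 + α)/δ² if α > -1 (`tendsto_sq_mul_curv`), g(1 + δ)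
~ 1/(δ² log(1/δ)) if α = -1 (`tendsto_sq_mul_log_mul_curv`), and g(1 + δ) = O(δ^(-β)) with β < 2 if
α < -1 (`exists_curv_le_rpow`). Integrating √g(2s) with δ = 2s - 1 gives the three cases. In the
last one √g(2s) is integrable down to 1/2, and c is 1/π times its full integral. -/

namespace RandomDirichlet

/-! ### Two-sided bounds for arccos of exp(-z²/2). -/

section Arccos

/-- The product cos x · exp(x²/2) equals 1 at 0 and decreases, since its derivative has the sign of
x cos x - sin x and x < tan x. -/
theorem cos_le_exp_neg_sq_div_two {y : ℝ} (h0 : 0 ≤ y) (h1 : y ≤ Real.pi / 2) :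
    Real.cos y ≤ Real.exp (-(y ^ 2 / 2)) := by
  have hd : ∀ x : ℝ, HasDerivAt (fun x => Real.cos x * Real.exp (x ^ 2 / 2))
      (-Real.sin x * Real.exp (x ^ 2 / 2) + Real.cos x * (Real.exp (x ^ 2 / 2) * x)) x := by
    intro x
    refine (Real.hasDerivAt_cos x).mul (HasDerivAt.exp ?_)
    have := (hasDerivAt_pow 2 x).div_const 2
    simpa using this
  have hanti : AntitoneOn (fun x => Real.cos x * Real.exp (x ^ 2 / 2)) (Set.Icc 0 (Real.pi / 2)) := by
    refine antitoneOn_of_deriv_nonpos (convex_Icc _ _) (by fun_prop) (by fun_prop) ?_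
    intro x hx
    rw [interior_Icc] at hx
    rw [(hd x).deriv]
    have hc : 0 < Real.cos x := Real.cos_pos_of_mem_Ioo ⟨by linarith [hx.1, Real.pi_pos], hx.2⟩
    have ht := Real.lt_tan hx.1 hx.2
    rw [Real.tan_eq_sin_div_cos, lt_div_iff₀ hc] at ht
    have := Real.exp_pos (x ^ 2 / 2)
    nlinarith
  have := hanti (Set.left_mem_Icc.2 (by positivity)) ⟨h0, h1⟩ h0
  simp only [Real.cos_zero, one_mul] at this
  norm_num at this
  rw [Real.exp_neg, ← one_div, le_div_iff₀ (Real.exp_pos _)]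
  exact this

theorem arccos_exp_neg_le {z : ℝ} (hz : 0 ≤ z) : Real.arccos (Real.exp (-(z ^ 2 / 2))) ≤ z := by
  rcases le_total z (Real.pi / 2) with h | h
  · calc Real.arccos (Real.exp (-(z ^ 2 / 2))) ≤ Real.arccos (Real.cos z) :=
          Real.arccos_le_arccos (cos_le_exp_neg_sq_div_two hz h)
      _ = z := Real.arccos_cos hz (by linarith [Real.pi_pos])
  · exact (Real.arccos_le_pi_div_two.2 (Real.exp_pos _).le).trans h

/-- With y the arccosine, 1 - y²/2 ≤ cos y = exp(-z²/2) ≤ 1 - z²/2 + z⁴/8, hence y² ≥ z² - z⁴/4. For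
|z| > 2 the square root is 0 and the bound is empty. -/
theorem le_arccos_exp_neg (z : ℝ) :
    Real.sqrt (z ^ 2 * (1 - z ^ 2 / 4)) ≤ Real.arccos (Real.exp (-(z ^ 2 / 2))) := by
  set x := Real.exp (-(z ^ 2 / 2)) with hx
  have h1 : x ≤ 1 := Real.exp_le_one_iff.2 (by nlinarith [sq_nonneg z])
  have h0 : 0 < x := Real.exp_pos _
  have hc := Real.one_sub_sq_div_two_le_cos (x := Real.arccos x)
  rw [Real.cos_arccos (by linarith) h1] at hc
  -- With w = z²/2, this follows from exp w ≥ 1 + w + w²/2 and (1 - w + w²/2)(1 + w + w²/2) = 1 +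
  -- w⁴/4 ≥ 1.
  have hy : x ≤ 1 - z ^ 2 / 2 + (z ^ 2 / 2) ^ 2 / 2 := by
    have hq := Real.quadratic_le_exp_of_nonneg (x := z ^ 2 / 2) (by positivity)
    rw [hx, Real.exp_neg, ← one_div, div_le_iff₀ (Real.exp_pos _)]
    have hp : 0 ≤ 1 - z ^ 2 / 2 + (z ^ 2 / 2) ^ 2 / 2 := by nlinarith [sq_nonneg (z ^ 2 / 2 - 1)]
    nlinarith [mul_le_mul_of_nonneg_left hq hp, sq_nonneg ((z ^ 2 / 2) ^ 2)]
  apply Real.sqrt_le_iff.2 ⟨Real.arccos_nonneg _, ?_⟩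
  nlinarith

end Arccos

/-! ### The covariance kernel: curvature of log K and the angle between two values of F. -/

section Kernel

/-- The second derivative of the logarithm of the Dirichlet series `∑ₙ exp (u * Z n)`. -/
noncomputable def curv (Z : ℕ → ℝ) (u : ℝ) : ℝ := iteratedDeriv 2 (cgf Z Measure.count) u

/-- The angle between the vectors `(exp (s * Z n))ₙ` and `(exp (t * Z n))ₙ` of `ℓ²`. -/
noncomputable def angle (Z : ℕ → ℝ) (s t : ℝ) : ℝ :=
  Real.arccos (mgf Z Measure.count (s + t) /
    Real.sqrt (mgf Z Measure.count (2 * s) * mgf Z Measure.count (2 * t)))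

variable {Z : ℕ → ℝ}

theorem mem_interior_integrableExpSet
    (hI : ∀ u, 1 < u → Integrable (fun n => Real.exp (u * Z n)) Measure.count) {u : ℝ} (hu : 1 < u) :
    u ∈ interior (integrableExpSet Z Measure.count) :=
  mem_interior.2 ⟨Set.Ioi 1, fun v hv => hI v hv, isOpen_Ioi, hu⟩

theorem mgf_count_pos (hI : ∀ u, 1 < u → Integrable (fun n => Real.exp (u * Z n)) Measure.count)
    {u : ℝ} (hu : 1 < u) : 0 < mgf Z Measure.count u := by
  refine mgf_pos' ?_ (hI u hu)
  intro h
  have := congrArg (fun m : Measure ℕ => m {0}) h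
  simp at this

theorem analyticAt_cgf_count
    (hI : ∀ u, 1 < u → Integrable (fun n => Real.exp (u * Z n)) Measure.count) {u : ℝ} (hu : 1 < u) :
    AnalyticAt ℝ (cgf Z Measure.count) u := analyticAt_cgf (mem_interior_integrableExpSet hI hu)

theorem continuousOn_curv
    (hI : ∀ u, 1 < u → Integrable (fun n => Real.exp (u * Z n)) Measure.count) :
    ContinuousOn (curv Z) (Set.Ioi 1) := by
  have h : AnalyticOnNhd ℝ (cgf Z Measure.count) (Set.Ioi 1) := fun u hu => analyticAt_cgf_count hI hu
  have := h.iterated_deriv 2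
  unfold curv
  rw [iteratedDeriv_eq_iterate]
  exact this.continuousOn

theorem curv_eq (hI : ∀ u, 1 < u → Integrable (fun n => Real.exp (u * Z n)) Measure.count)
    {u : ℝ} (hu : 1 < u) :
    curv Z u = (∫ n, Z n ^ 2 * Real.exp (u * Z n) ∂Measure.count) / mgf Z Measure.count u -
      ((∫ n, Z n * Real.exp (u * Z n) ∂Measure.count) / mgf Z Measure.count u) ^ 2 := by
  have h := mem_interior_integrableExpSet hI hu
  rw [curv, iteratedDeriv_two_cgf h, deriv_cgf h]

theorem integrable_sub_sq_mul_exp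
    (hI : ∀ u, 1 < u → Integrable (fun n => Real.exp (u * Z n)) Measure.count)
    {u : ℝ} (hu : 1 < u) (a : ℝ) :
    Integrable (fun n => (Z n - a) ^ 2 * Real.exp (u * Z n)) Measure.count := by
  have h := mem_interior_integrableExpSet hI hu
  have h2 := integrable_pow_mul_exp_of_mem_interior_integrableExpSet h 2
  have h1 := (integrable_pow_mul_exp_of_mem_interior_integrableExpSet h 1).const_mul (2 * a)
  have h0 := (hI u hu).const_mul (a ^ 2)
  refine ((h2.sub h1).add h0).congr (ae_of_all _ fun n => ?_)
  simp only [Pi.add_apply, Pi.sub_apply]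
  ring

/-- Bias–variance decomposition: `curv Z u` is the variance of `Z` under the probability weights
exp(u Z n)/K(u), so centring elsewhere adds the squared bias. -/
theorem integral_sub_sq_mul_exp
    (hI : ∀ u, 1 < u → Integrable (fun n => Real.exp (u * Z n)) Measure.count)
    {u : ℝ} (hu : 1 < u) (a : ℝ) :
    (∫ n, (Z n - a) ^ 2 * Real.exp (u * Z n) ∂Measure.count) / mgf Z Measure.count u =
      curv Z u + ((∫ n, Z n * Real.exp (u * Z n) ∂Measure.count) / mgf Z Measure.count u - a) ^ 2 := by
  have h := mem_interior_integrableExpSet hI hu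
  have h2 := integrable_pow_mul_exp_of_mem_interior_integrableExpSet h 2
  have h1 := (integrable_pow_mul_exp_of_mem_interior_integrableExpSet h 1).const_mul (2 * a)
  have h0 := (hI u hu).const_mul (a ^ 2)
  have hE : ∫ n, (Z n - a) ^ 2 * Real.exp (u * Z n) ∂Measure.count =
      (∫ n, Z n ^ 2 * Real.exp (u * Z n) ∂Measure.count) -
      2 * a * (∫ n, Z n * Real.exp (u * Z n) ∂Measure.count) + a ^ 2 * mgf Z Measure.count u := by
    have : ∀ n, (Z n - a) ^ 2 * Real.exp (u * Z n) = Z n ^ 2 * Real.exp (u * Z n) -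
      2 * a * (Z n ^ 1 * Real.exp (u * Z n)) + a ^ 2 * Real.exp (u * Z n) := fun n => by ring
    simp_rw [this]
    refine (integral_add (h2.sub h1) h0).trans ?_
    have h3 := integral_sub h2 h1
    simp only [Pi.sub_apply] at h3 ⊢
    rw [h3, integral_const_mul, integral_const_mul]
    simp [mgf]
  have hK := mgf_count_pos hI hu
  rw [hE, curv_eq hI hu]
  generalize ∫ n, Z n * Real.exp (u * Z n) ∂Measure.count = A
  generalize ∫ n, Z n ^ 2 * Real.exp (u * Z n) ∂Measure.count = B
  field_simp
  ring

/-- A variance vanishes only for a constant variable, and `Z` takes at least two values, each with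
positive weight. -/
theorem curv_pos (hZ : StrictAnti Z)
    (hI : ∀ u, 1 < u → Integrable (fun n => Real.exp (u * Z n)) Measure.count)
    {u : ℝ} (hu : 1 < u) : 0 < curv Z u := by
  have hK := mgf_count_pos hI hu
  set a := (∫ n, Z n * Real.exp (u * Z n) ∂Measure.count) / mgf Z Measure.count u with ha
  have h := integral_sub_sq_mul_exp hI hu a
  rw [← ha, sub_self] at h
  simp only [ne_eq, OfNat.ofNat_ne_zero, not_false_eq_true, zero_pow, add_zero] at h
  rw [← h]
  refine div_pos ?_ hK
  rw [integral_pos_iff_support_of_nonneg (fun n => by positivity)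
    (integrable_sub_sq_mul_exp hI hu a)]
  obtain ⟨n, hn⟩ : ∃ n, Z n ≠ a := by
    by_contra! hcon
    exact absurd (hZ (show 0 < 1 by norm_num)) (by rw [hcon 0, hcon 1]; exact lt_irrefl _)
  have hmem : {n} ⊆ Function.support fun n => (Z n - a) ^ 2 * Real.exp (u * Z n) := by
    intro m hm
    rw [Set.mem_singleton_iff.1 hm, Function.mem_support]
    have := sub_ne_zero.2 hn
    positivity
  refine lt_of_lt_of_le ?_ (measure_mono hmem)
  simp

theorem curv_le_of_center
    (hI : ∀ u, 1 < u → Integrable (fun n => Real.exp (u * Z n)) Measure.count)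
    {u : ℝ} (hu : 1 < u) (a : ℝ) :
    curv Z u ≤ (∫ n, (Z n - a) ^ 2 * Real.exp (u * Z n) ∂Measure.count) / mgf Z Measure.count u := by
  rw [integral_sub_sq_mul_exp hI hu a]
  nlinarith [sq_nonneg ((∫ n, Z n * Real.exp (u * Z n) ∂Measure.count) / mgf Z Measure.count u - a)]

theorem exp_le_mgf_count (hI : ∀ u, 1 < u → Integrable (fun n => Real.exp (u * Z n)) Measure.count)
    {u : ℝ} (hu : 1 < u) (k : ℕ) : Real.exp (u * Z k) ≤ mgf Z Measure.count u := by
  rw [mgf, integral_countable (hI u hu)]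
  have hs : Summable fun n => Real.exp (u * Z n) := by
    simpa using integrable_count_iff.1 (hI u hu)
  simp only [Measure.real, Measure.count_singleton, ENNReal.toReal_one, one_smul]
  exact hs.le_tsum k fun n _ => (Real.exp_pos _).le

/-- Centring the variance at `Z 0` removes the term n = 0. The others satisfy `Z n ≤ Z 1` while K(u)
≥ exp(u Z 0), so the decay rate is the gap `Z 0 - Z 1`. This controls the integral of √g at
infinity. -/
theorem exists_curv_le_exp (hZ : StrictAnti Z)
    (hI : ∀ u, 1 < u → Integrable (fun n => Real.exp (u * Z n)) Measure.count)
    {u₀ : ℝ} (hu₀ : 1 < u₀) :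
    ∃ C c, 0 < C ∧ 0 < c ∧ ∀ u, u₀ ≤ u → curv Z u ≤ C * Real.exp (-(c * u)) := by
  set D := ∫ n, (Z n - Z 0) ^ 2 * Real.exp (u₀ * Z n) ∂Measure.count with hD
  have hD0 : 0 ≤ D := integral_nonneg fun n => by positivity
  refine ⟨D * Real.exp (-(u₀ * Z 1)) + 1, Z 0 - Z 1, by positivity,
    sub_pos.2 (hZ (by norm_num)), fun u hu => ?_⟩
  have hu1 : 1 < u := hu₀.trans_le hu
  have hK := mgf_count_pos hI hu1
  refine (curv_le_of_center hI hu1 (Z 0)).trans ?_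
  have hb : ∫ n, (Z n - Z 0) ^ 2 * Real.exp (u * Z n) ∂Measure.count ≤
      D * Real.exp ((u - u₀) * Z 1) := by
    rw [hD, ← integral_mul_const]
    refine integral_mono (integrable_sub_sq_mul_exp hI hu1 _)
      ((integrable_sub_sq_mul_exp hI hu₀ _).mul_const _) fun n => ?_
    simp only
    rcases Nat.eq_zero_or_pos n with rfl | hn
    · simp
    · rw [mul_assoc, ← Real.exp_add]
      gcongr
      have : Z n ≤ Z 1 := hZ.antitone hn
      nlinarith
  rw [div_le_iff₀ hK]
  have h1 : D * Real.exp ((u - u₀) * Z 1) = D * Real.exp (-(u₀ * Z 1)) *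
      Real.exp (-((Z 0 - Z 1) * u)) * Real.exp (u * Z 0) := by
    rw [mul_assoc, mul_assoc, ← Real.exp_add, ← Real.exp_add]
    congr 2
    ring
  refine hb.trans ?_
  rw [h1]
  have h2 := exp_le_mgf_count hI hu1 0
  gcongr
  linarith

/-- Cauchy's mean value theorem comparing the symmetric second difference with x², followed by the
mean value theorem for the first derivative. An exact identity at one point ξ leaves no remainder to
control. -/
theorem exists_second_difference_cgf
    (hI : ∀ u, 1 < u → Integrable (fun n => Real.exp (u * Z n)) Measure.count)
    {m h : ℝ} (hh : 0 < h) (hm : 1 < m - h) :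
    ∃ ξ ∈ Set.Ioo (m - h) (m + h),
      cgf Z Measure.count (m + h) + cgf Z Measure.count (m - h) - 2 * cgf Z Measure.count m =
        h ^ 2 * curv Z ξ := by
  set Lg := cgf Z Measure.count
  have hL : ∀ u, 1 < u → HasDerivAt Lg (deriv Lg u) u := fun u hu =>
    (analyticAt_cgf_count hI hu).differentiableAt.hasDerivAt
  have hL' : ∀ u, 1 < u → HasDerivAt (deriv Lg) (curv Z u) u := fun u hu => by
    have := (analyticAt_cgf_count hI hu).deriv.differentiableAt.hasDerivAt
    rwa [curv, iteratedDeriv_succ, iteratedDeriv_one]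
  have hψ : ∀ x, |x| ≤ h → HasDerivAt (fun x => Lg (m + x) + Lg (m - x) - 2 * Lg m)
      (deriv Lg (m + x) - deriv Lg (m - x)) x := by
    intro x hx
    have hx' := abs_le.1 hx
    have h1 : HasDerivAt (fun x => Lg (m + x)) (deriv Lg (m + x)) x := by
      simpa using (hL (m + x) (by linarith)).comp_const_add m x
    have h2 : HasDerivAt (fun x => Lg (m - x)) (-deriv Lg (m - x)) x := by
      simpa using (hL (m - x) (by linarith)).comp_const_sub m x
    simpa [sub_eq_add_neg] using (h1.add h2).sub_const (2 * Lg m)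
  obtain ⟨c, hc, hce⟩ := exists_ratio_hasDerivAt_eq_ratio_slope
    (fun x => Lg (m + x) + Lg (m - x) - 2 * Lg m)
    (fun x => deriv Lg (m + x) - deriv Lg (m - x)) hh
    (fun x hx => (hψ x (abs_le.2 ⟨by linarith [hx.1], hx.2⟩)).continuousAt.continuousWithinAt)
    (fun x hx => hψ x (abs_le.2 ⟨by linarith [hx.1], hx.2.le⟩))
    (fun x => x ^ 2) (fun x => 2 * x) (by fun_prop)
    (fun x _ => by simpa using hasDerivAt_pow 2 x)
  obtain ⟨ξ, hξ, hξe⟩ := exists_hasDerivAt_eq_slope (deriv Lg) (curv Z)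
    (a := m - c) (b := m + c) (by linarith [hc.1])
    (fun x hx => (hL' x (by linarith [hc.2, hx.1])).continuousAt.continuousWithinAt)
    (fun x hx => hL' x (by linarith [hc.2, hx.1]))
  refine ⟨ξ, ⟨by linarith [hξ.1, hc.2], by linarith [hξ.2, hc.2]⟩, ?_⟩
  have hc0 : c ≠ 0 := hc.1.ne'
  have h3 : m + c - (m - c) ≠ 0 := by
    have : m + c - (m - c) = 2 * c := by ring
    rw [this]; positivity
  rw [eq_div_iff h3] at hξe
  simp only [add_zero, sub_zero] at hce
  have h4 : (2 * c) * (Lg (m + h) + Lg (m - h) - 2 * Lg m) = (2 * c) * (h ^ 2 * curv Z ξ) := by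
    linear_combination -hce - h ^ 2 * hξe
  exact mul_left_cancel₀ (by positivity) h4

/-- The logarithm of the correlation is minus half the second difference of log K at s + t with step
t - s. -/
theorem exists_mgf_ratio_eq (hI : ∀ u, 1 < u → Integrable (fun n => Real.exp (u * Z n)) Measure.count)
    {s t : ℝ} (hs : 1 / 2 < s) (hst : s < t) :
    ∃ ξ ∈ Set.Ioo (2 * s) (2 * t),
      mgf Z Measure.count (s + t) /
        Real.sqrt (mgf Z Measure.count (2 * s) * mgf Z Measure.count (2 * t)) =
        Real.exp (-((t - s) ^ 2 * curv Z ξ / 2)) := by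
  obtain ⟨ξ, hξ, h⟩ := exists_second_difference_cgf hI (m := s + t) (h := t - s) (by linarith)
    (by linarith)
  have e1 : s + t + (t - s) = 2 * t := by ring
  have e2 : s + t - (t - s) = 2 * s := by ring
  rw [e1, e2] at h hξ
  refine ⟨ξ, hξ, ?_⟩
  rw [← h]
  have k1 := mgf_count_pos hI (u := s + t) (by linarith)
  have k2 := mgf_count_pos hI (u := 2 * s) (by linarith)
  have k3 := mgf_count_pos hI (u := 2 * t) (by linarith)
  rw [← Real.exp_log k1, Real.sqrt_eq_rpow, Real.rpow_def_of_pos (by positivity), ← Real.exp_sub,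
    Real.log_mul k2.ne' k3.ne']
  simp only [cgf]
  congr 1
  ring

/-- The correlation lies in (0, 1] because log K is convex, so `arccos` is not truncated. -/
theorem cos_angle (hZ : StrictAnti Z)
    (hI : ∀ u, 1 < u → Integrable (fun n => Real.exp (u * Z n)) Measure.count)
    {s t : ℝ} (hs : 1 / 2 < s) (hst : s < t) :
    Real.cos (angle Z s t) = mgf Z Measure.count (s + t) /
      Real.sqrt (mgf Z Measure.count (2 * s) * mgf Z Measure.count (2 * t)) := by
  obtain ⟨ξ, hξ, h⟩ := exists_mgf_ratio_eq hI hs hst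
  have hg : 0 ≤ curv Z ξ := (curv_pos hZ hI (by linarith [hξ.1])).le
  have h1 := Real.exp_pos (-((t - s) ^ 2 * curv Z ξ / 2))
  refine Real.cos_arccos ?_ ?_
  · rw [h]; linarith
  · rw [h]; exact Real.exp_le_one_iff.2 (neg_nonpos.2 (by positivity))

theorem angle_bounds (hZ : StrictAnti Z)
    (hI : ∀ u, 1 < u → Integrable (fun n => Real.exp (u * Z n)) Measure.count)
    {s t : ℝ} (hs : 1 / 2 < s) (hst : s < t) :
    ∃ ξ ∈ Set.Ioo (2 * s) (2 * t),
      angle Z s t ≤ (t - s) * Real.sqrt (curv Z ξ) ∧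
      (t - s) * Real.sqrt (curv Z ξ * (1 - (t - s) ^ 2 * curv Z ξ / 4)) ≤ angle Z s t := by
  obtain ⟨ξ, hξ, h'⟩ := exists_mgf_ratio_eq hI hs hst
  have h : angle Z s t = Real.arccos (Real.exp (-((t - s) ^ 2 * curv Z ξ / 2))) := by
    rw [angle, h']
  refine ⟨ξ, hξ, ?_⟩
  have hg : 0 ≤ curv Z ξ := (curv_pos hZ hI (by linarith [hξ.1])).le
  have hsq : (t - s) ^ 2 * curv Z ξ = ((t - s) * Real.sqrt (curv Z ξ)) ^ 2 := by
    rw [mul_pow, Real.sq_sqrt hg]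
  constructor
  · rw [h, hsq]
    exact arccos_exp_neg_le (mul_nonneg (by linarith) (Real.sqrt_nonneg _))
  · have := le_arccos_exp_neg ((t - s) * Real.sqrt (curv Z ξ))
    rw [h, hsq]
    refine le_trans (le_of_eq ?_) this
    rw [← hsq, mul_assoc, Real.sqrt_mul (sq_nonneg _), Real.sqrt_sq (by linarith)]

end Kernel

end RandomDirichlet

/-! ### Riemann sums of the angle along a grid. -/

namespace RandomDirichlet

/-- The points of the uniform grid of mesh `1 / (m + 1)` on `[T, ∞)`. -/
noncomputable def grid (T : ℝ) (m i : ℕ) : ℝ := T + i / (m + 1)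

theorem grid_zero (T : ℝ) (m : ℕ) : grid T m 0 = T := by simp [grid]

theorem grid_succ (T : ℝ) (m i : ℕ) : grid T m (i + 1) = grid T m i + 1 / (m + 1) := by
  simp only [grid]; push_cast; ring

theorem grid_strictMono (T : ℝ) (m : ℕ) : StrictMono (grid T m) := by
  refine strictMono_nat_of_lt_succ fun i => ?_
  rw [grid_succ]
  have : (0 : ℝ) < 1 / (m + 1) := by positivity
  linarith

theorem le_grid (T : ℝ) (m i : ℕ) : T ≤ grid T m i := by
  have := (grid_strictMono T m).monotone (Nat.zero_le i)
  rwa [grid_zero] at this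

theorem grid_floor_le {T s : ℝ} (m : ℕ) (hs : T ≤ s) : grid T m ⌊(s - T) * (m + 1)⌋₊ ≤ s := by
  have h := Nat.floor_le (a := (s - T) * (m + 1)) (mul_nonneg (by linarith) (by positivity))
  have : (⌊(s - T) * (m + 1)⌋₊ : ℝ) / (m + 1) ≤ s - T := by
    rw [div_le_iff₀ (by positivity)]; exact h
  simp only [grid]
  linarith

theorem lt_grid_floor_succ (T s : ℝ) (m : ℕ) : s < grid T m (⌊(s - T) * (m + 1)⌋₊ + 1) := by
  have h := Nat.lt_floor_add_one ((s - T) * (m + 1))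
  have : s - T < ((⌊(s - T) * (m + 1)⌋₊ : ℝ) + 1) / (m + 1) := by
    rw [lt_div_iff₀ (by positivity)]; exact h
  simp only [grid]
  push_cast
  linarith

theorem floor_eq_of_mem_Ico_grid {T s : ℝ} {m i : ℕ}
    (hs : s ∈ Set.Ico (grid T m i) (grid T m (i + 1))) : ⌊(s - T) * (m + 1)⌋₊ = i := by
  have hT : T ≤ s := (le_grid T m i).trans hs.1
  have h1 := grid_floor_le m hT
  have h2 := lt_grid_floor_succ T s m
  have h3 := (grid_strictMono T m).lt_iff_lt.1 (h1.trans_lt hs.2)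
  have h4 := (grid_strictMono T m).lt_iff_lt.1 (hs.1.trans_lt h2)
  omega

/-- The sum is the integral of a step function, constant on the cells of length 1/(m + 1). This
makes dominated convergence available for sums over an infinite grid. -/
theorem tsum_grid_eq_lintegral (T : ℝ) (m : ℕ) (a : ℕ → ℝ) (ha : ∀ i, 0 ≤ a i) :
    ∑' i, ENNReal.ofReal (a i) =
      ∫⁻ s in Set.Ioi T, ENNReal.ofReal ((m + 1) * a ⌊(s - T) * (m + 1)⌋₊) := by
  have hU : Set.Ici T = ⋃ i, Set.Ico (grid T m i) (grid T m (i + 1)) := by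
    ext s
    simp only [Set.mem_Ici, Set.mem_iUnion]
    constructor
    · intro hs
      exact ⟨_, grid_floor_le m hs, lt_grid_floor_succ T s m⟩
    · rintro ⟨i, hi⟩
      exact (le_grid T m i).trans hi.1
  have hD : Pairwise (Function.onFun Disjoint fun i => Set.Ico (grid T m i) (grid T m (i + 1))) :=
    (grid_strictMono T m).monotone.pairwise_disjoint_on_Ico_succ
  rw [setLIntegral_congr Ioi_ae_eq_Ici, hU, lintegral_iUnion (fun i => measurableSet_Ico) hD]
  congr 1
  ext i
  have : ∀ s ∈ Set.Ico (grid T m i) (grid T m (i + 1)),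
      ENNReal.ofReal ((m + 1) * a ⌊(s - T) * (m + 1)⌋₊) = ENNReal.ofReal ((m + 1) * a i) :=
    fun s hs => by rw [floor_eq_of_mem_Ico_grid hs]
  rw [setLIntegral_congr_fun measurableSet_Ico this, setLIntegral_const, Real.volume_Ico,
    grid_succ, ← ENNReal.ofReal_mul (mul_nonneg (by positivity) (ha i))]
  congr 1
  field_simp
  ring

variable {Z : ℕ → ℝ}

theorem exists_sqrt_curv_le_exp (hZ : StrictAnti Z)
    (hI : ∀ u, 1 < u → Integrable (fun n => Real.exp (u * Z n)) Measure.count)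
    {u₀ : ℝ} (hu₀ : 1 < u₀) :
    ∃ C c, 0 < C ∧ 0 < c ∧ ∀ u, u₀ ≤ u → Real.sqrt (curv Z u) ≤ C * Real.exp (-(c * u)) := by
  obtain ⟨C, c, hC, hc, h⟩ := exists_curv_le_exp hZ hI hu₀
  refine ⟨Real.sqrt C, c / 2, by positivity, by positivity, fun u hu => ?_⟩
  refine (Real.sqrt_le_sqrt (h u hu)).trans (le_of_eq ?_)
  rw [Real.sqrt_mul hC.le, ← Real.exp_half]
  congr 2
  ring

theorem integrableOn_const_mul_exp_neg (C T : ℝ) {c : ℝ} (hc : 0 < c) :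
    IntegrableOn (fun s => C * Real.exp (-(c * s))) (Set.Ioi T) := by
  have := (exp_neg_integrableOn_Ioi T hc).const_mul C
  simpa [IntegrableOn, neg_mul] using this

theorem continuousOn_sqrt_curv
    (hI : ∀ u, 1 < u → Integrable (fun n => Real.exp (u * Z n)) Measure.count) :
    ContinuousOn (fun s => Real.sqrt (curv Z (2 * s))) (Set.Ioi (1 / 2)) := by
  refine Real.continuous_sqrt.comp_continuousOn ((continuousOn_curv hI).comp (by fun_prop) ?_)
  intro s hs
  simp only [Set.mem_Ioi] at hs ⊢
  linarith

theorem integrableOn_sqrt_curv (hZ : StrictAnti Z)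
    (hI : ∀ u, 1 < u → Integrable (fun n => Real.exp (u * Z n)) Measure.count)
    {T : ℝ} (hT : 1 / 2 < T) :
    IntegrableOn (fun s => Real.sqrt (curv Z (2 * s))) (Set.Ioi T) := by
  obtain ⟨C, c, hC, hc, h⟩ := exists_sqrt_curv_le_exp hZ hI (u₀ := 2 * T) (by linarith)
  refine Integrable.mono' (integrableOn_const_mul_exp_neg C T (c := c * 2) (by positivity))
    (((continuousOn_sqrt_curv hI).mono fun s hs =>
      hT.trans hs).aestronglyMeasurable measurableSet_Ioi) ?_
  refine (ae_restrict_iff' measurableSet_Ioi).2 (ae_of_all _ fun s hs => ?_)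
  rw [Real.norm_of_nonneg (Real.sqrt_nonneg _)]
  have := h (2 * s) (by linarith [Set.mem_Ioi.1 hs])
  rwa [← mul_assoc] at this

theorem tendsto_tsum_angle (hZ : StrictAnti Z)
    (hI : ∀ u, 1 < u → Integrable (fun n => Real.exp (u * Z n)) Measure.count)
    {T : ℝ} (hT : 1 / 2 < T) :
    Tendsto (fun m : ℕ => ∑' i, ENNReal.ofReal (angle Z (grid T m i) (grid T m (i + 1)))) atTop
      (𝓝 (∫⁻ s in Set.Ioi T, ENNReal.ofReal (Real.sqrt (curv Z (2 * s))))) := by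
  have hgr : ∀ m i, 1 / 2 < grid T m i := fun m i => hT.trans_le (le_grid T m i)
  have hstep : ∀ m i, grid T m (i + 1) - grid T m i = 1 / ((m : ℝ) + 1) := fun m i => by
    rw [grid_succ]; ring
  choose ξ hξ hup hlow using fun m i =>
    angle_bounds hZ hI (hgr m i) (grid_strictMono T m (Nat.lt_succ_self i))
  have hup' : ∀ m i : ℕ, ((m : ℝ) + 1) * angle Z (grid T m i) (grid T m (i + 1)) ≤
      Real.sqrt (curv Z (ξ m i)) := by
    intro m i
    have := hup m i
    rw [hstep] at this
    have hm : (0 : ℝ) < m + 1 := by positivity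
    calc ((m : ℝ) + 1) * angle Z (grid T m i) (grid T m (i + 1))
        ≤ (m + 1) * (1 / (m + 1) * Real.sqrt (curv Z (ξ m i))) := by gcongr
      _ = _ := by field_simp
  have hlow' : ∀ m i : ℕ, Real.sqrt (curv Z (ξ m i) *
      (1 - (1 / ((m : ℝ) + 1)) ^ 2 * curv Z (ξ m i) / 4)) ≤
      ((m : ℝ) + 1) * angle Z (grid T m i) (grid T m (i + 1)) := by
    intro m i
    have := hlow m i
    rw [hstep] at this
    have hm : (0 : ℝ) < m + 1 := by positivity
    calc _ = (m + 1) * (1 / (m + 1) * Real.sqrt (curv Z (ξ m i) *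
      (1 - (1 / ((m : ℝ) + 1)) ^ 2 * curv Z (ξ m i) / 4))) := by field_simp
      _ ≤ _ := by gcongr
  obtain ⟨C, c, hC, hc, hexp⟩ := exists_sqrt_curv_le_exp hZ hI (u₀ := 2 * T) (by linarith)
  clear hup hlow
  simp_rw [fun m : ℕ => tsum_grid_eq_lintegral T m
    (fun i => angle Z (grid T m i) (grid T m (i + 1))) fun i => Real.arccos_nonneg _]
  have hξs : ∀ m : ℕ, ∀ s, T < s → |ξ m ⌊(s - T) * (m + 1)⌋₊ - 2 * s| ≤ 2 * (1 / ((m : ℝ) + 1)) := by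
    intro m s hs
    have h1 := grid_floor_le m hs.le
    have h2 := lt_grid_floor_succ T s m
    have h3 := hξ m ⌊(s - T) * (m + 1)⌋₊
    have h4 := hstep m ⌊(s - T) * (m + 1)⌋₊
    rw [abs_le]
    constructor <;> linarith [h3.1, h3.2]
  -- The intermediate point ξ is within 2/(m + 1) ≤ 2 of 2s, which costs the factor exp(2c) in the
  -- dominating function.
  refine tendsto_lintegral_of_dominated_convergence
    (fun s => ENNReal.ofReal (C * Real.exp (c * 2) * Real.exp (-(c * 2 * s)))) ?_ ?_ ?_ ?_
  · intro m
    have h1 : Measurable fun s : ℝ => ⌊(s - T) * ((m : ℝ) + 1)⌋₊ :=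
      Nat.measurable_floor.comp (by fun_prop)
    exact (measurable_from_nat (f := fun i => ENNReal.ofReal (((m : ℝ) + 1) *
      angle Z (grid T m i) (grid T m (i + 1))))).comp h1
  · intro m
    refine (ae_restrict_iff' measurableSet_Ioi).2 (ae_of_all _ fun s hs => ?_)
    refine ENNReal.ofReal_le_ofReal ((hup' m _).trans ?_)
    have h1 : 2 * T ≤ ξ m ⌊(s - T) * (m + 1)⌋₊ := by
      linarith [(hξ m ⌊(s - T) * (m + 1)⌋₊).1, le_grid T m ⌊(s - T) * (m + 1)⌋₊]
    refine (hexp _ h1).trans ?_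
    rw [mul_assoc, ← Real.exp_add]
    gcongr
    have h2 := (abs_le.1 (hξs m s hs)).1
    have h3 : 1 / ((m : ℝ) + 1) ≤ 1 := by
      rw [div_le_one (by positivity)]
      have : (0 : ℝ) ≤ m := by positivity
      linarith
    nlinarith
  · have := (integrableOn_const_mul_exp_neg (C * Real.exp (c * 2)) T
      (c := c * 2) (by positivity)).lintegral_lt_top
    exact this.ne
  · refine (ae_restrict_iff' measurableSet_Ioi).2 (ae_of_all _ fun s hs => ?_)
    refine ENNReal.tendsto_ofReal ?_
    have hinv : Tendsto (fun m : ℕ => 1 / ((m : ℝ) + 1)) atTop (𝓝 0) :=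
      tendsto_one_div_add_atTop_nhds_zero_nat
    have hξt : Tendsto (fun m : ℕ => ξ m ⌊(s - T) * (m + 1)⌋₊) atTop (𝓝 (2 * s)) := by
      rw [tendsto_iff_dist_tendsto_zero]
      refine squeeze_zero (fun _ => dist_nonneg) (fun m => hξs m s hs) ?_
      simpa using hinv.const_mul 2
    have hs1 : (1 : ℝ) < 2 * s := by linarith [Set.mem_Ioi.1 hs]
    have hg : Tendsto (fun m : ℕ => curv Z (ξ m ⌊(s - T) * (m + 1)⌋₊)) atTop (𝓝 (curv Z (2 * s))) :=
      ((continuousOn_curv hI).continuousAt (Ioi_mem_nhds hs1)).tendsto.comp hξt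
    refine tendsto_of_tendsto_of_tendsto_of_le_of_le ?_ ((Real.continuous_sqrt.tendsto _).comp hg)
      (fun m => hlow' m _) (fun m => hup' m _)
    refine (Real.continuous_sqrt.tendsto' _ _ ?_).comp
      (hg.mul ((((hinv.pow 2).mul hg).div_const 4).const_sub 1))
    norm_num

end RandomDirichlet

/-! ### The kernel K as a Laplace transform of the counting function. -/

namespace RandomDirichlet

/-- The exponents `-log (p n)`, for which `p n ^ (-u) = exp (u * negLog p n)`. -/
noncomputable def negLog (p : ℕ → ℝ) (n : ℕ) : ℝ := -Real.log (p n)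

/-- The normalized counting function `π(eᵗ) e⁻ᵗ`. -/
noncomputable def density (p : ℕ → ℝ) (t : ℝ) : ℝ := countingFunction p (Real.exp t) * Real.exp (-t)

/-- The moments `∫₀^∞ π(eᵗ) e⁻ᵗ tʲ exp (-δ t) dt` of the normalized counting function. -/
noncomputable def laplace (p : ℕ → ℝ) (j : ℕ) (δ : ℝ) : ℝ :=
  ∫ t in Set.Ioi 0, density p t * t ^ j * Real.exp (-(δ * t))

variable {p : ℕ → ℝ}

theorem one_le_of_strictMono (hp_mono : StrictMono p) (hp_one : 1 ≤ p 0) (n : ℕ) : 1 ≤ p n :=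
  hp_one.trans (hp_mono.monotone (Nat.zero_le n))

theorem strictAnti_negLog (hp_mono : StrictMono p) (hp_one : 1 ≤ p 0) : StrictAnti (negLog p) := by
  intro m n hmn
  have := one_le_of_strictMono hp_mono hp_one m
  exact neg_lt_neg (Real.log_lt_log (by linarith) (hp_mono hmn))

theorem finite_setOf_le (hp_top : Tendsto p atTop atTop) (x : ℝ) : {n | p n ≤ x}.Finite := by
  have := hp_top.eventually_gt_atTop x
  rw [← Nat.cofinite_eq_atTop, eventually_cofinite] at this
  simpa using this

theorem countingFunction_nonneg (x : ℝ) : 0 ≤ countingFunction p x := Nat.cast_nonneg _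

theorem monotone_countingFunction (hp_top : Tendsto p atTop atTop) :
    Monotone (countingFunction p) := fun _ y hxy =>
  Nat.cast_le.2 (Set.ncard_le_ncard (fun _ hn => le_trans hn hxy) (finite_setOf_le hp_top y))

theorem density_nonneg (t : ℝ) : 0 ≤ density p t :=
  mul_nonneg (countingFunction_nonneg _) (Real.exp_pos _).le

theorem measurable_density (hp_top : Tendsto p atTop atTop) : Measurable (density p) :=
  ((monotone_countingFunction hp_top).measurable.comp Real.measurable_exp).mul (by fun_prop)

theorem density_le_of_le (hp_top : Tendsto p atTop atTop) {t M : ℝ} (ht : 0 ≤ t) (htM : t ≤ M) :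
    density p t ≤ countingFunction p (Real.exp M) := by
  have h1 := monotone_countingFunction hp_top (Real.exp_le_exp.2 htM)
  have h2 : Real.exp (-t) ≤ 1 := Real.exp_le_one_iff.2 (by linarith)
  have h3 := countingFunction_nonneg (p := p) (Real.exp t)
  calc density p t ≤ countingFunction p (Real.exp t) * 1 :=
        mul_le_mul_of_nonneg_left h2 h3
    _ ≤ _ := by linarith

theorem density_isEquivalent {α : ℝ}
    (hπ : countingFunction p ~[atTop] fun x : ℝ => x * Real.log x ^ α) :
    density p ~[atTop] fun t : ℝ => t ^ α := by
  have h := (hπ.comp_tendsto Real.tendsto_exp_atTop).mul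
    (IsEquivalent.refl (u := fun t : ℝ => Real.exp (-t)))
  refine h.congr_right (Eventually.of_forall fun t => ?_)
  simp only [Function.comp, Pi.mul_apply, Real.log_exp]
  rw [mul_right_comm, ← Real.exp_add]
  simp

/-- The term 1 absorbs the bounded range of t, where the asymptotics say nothing; a larger exponent
`b` is allowed so that t^b can be made integrable at 0. -/
theorem exists_density_le (hp_top : Tendsto p atTop atTop) {α : ℝ}
    (hπ : countingFunction p ~[atTop] fun x : ℝ => x * Real.log x ^ α) {b : ℝ} (hb : α ≤ b) : ∃ C, 0 < C ∧ ∀ t, 0 < t → density p t ≤ C * (1 + t ^ b) := by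
  obtain ⟨c, hc, h⟩ := (density_isEquivalent hπ).isBigO.exists_pos
  obtain ⟨M, hM⟩ := eventually_atTop.1 ((isBigOWith_iff.1 h).and (eventually_ge_atTop 1))
  refine ⟨c + countingFunction p (Real.exp M),
    add_pos_of_pos_of_nonneg hc (countingFunction_nonneg _), fun t ht => ?_⟩
  have hN := countingFunction_nonneg (p := p) (Real.exp M)
  have htb : 0 ≤ t ^ b := Real.rpow_nonneg ht.le _
  rcases le_total t M with htM | htM
  · have := density_le_of_le hp_top ht.le htM
    nlinarith [mul_nonneg hN htb, mul_nonneg hc.le htb]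
  · obtain ⟨h1, h2⟩ := hM t htM
    rw [Real.norm_of_nonneg (density_nonneg t), Real.norm_of_nonneg (by positivity)] at h1
    have h3 : t ^ α ≤ t ^ b := Real.rpow_le_rpow_of_exponent_le h2 hb
    nlinarith [mul_nonneg hN htb, mul_le_mul_of_nonneg_left h3 hc.le]

theorem integrableOn_rpow_mul_exp {b δ : ℝ} (hb : -1 < b) (hδ : 0 < δ) :
    IntegrableOn (fun t : ℝ => t ^ b * Real.exp (-(δ * t))) (Set.Ioi 0) := by
  simpa using integrableOn_rpow_mul_exp_neg_mul_rpow hb (p := 1) one_pos hδ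

theorem integrableOn_density_mul_exp (hp_top : Tendsto p atTop atTop) {α : ℝ}
    (hπ : countingFunction p ~[atTop] fun x : ℝ => x * Real.log x ^ α) (j : ℕ) {δ : ℝ}
    (hδ : 0 < δ) :
    IntegrableOn (fun t => density p t * t ^ j * Real.exp (-(δ * t))) (Set.Ioi 0) := by
  obtain ⟨C, hC, hle⟩ := exists_density_le hp_top hπ (le_max_left α 0)
  have hb : 0 ≤ max α 0 := le_max_right _ _
  have hj : (0 : ℝ) ≤ j := by positivity
  have h1 := (integrableOn_rpow_mul_exp (b := j) (by linarith) hδ).const_mul C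
  have h2 := (integrableOn_rpow_mul_exp (b := max α 0 + j) (by linarith) hδ).const_mul C
  refine Integrable.mono' (h1.add h2) ?_ ?_
  · exact (((measurable_density hp_top).mul (by fun_prop)).mul (by fun_prop)).aestronglyMeasurable
  · refine (ae_restrict_iff' measurableSet_Ioi).2 (ae_of_all _ fun t ht => ?_)
    have ht : 0 < t := ht
    have hd := density_nonneg (p := p) t
    rw [Real.norm_of_nonneg (by positivity)]
    calc density p t * t ^ j * Real.exp (-(δ * t))
        ≤ C * (1 + t ^ max α 0) * t ^ j * Real.exp (-(δ * t)) := by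
          gcongr
          exact hle t ht
      _ = _ := by
          simp only [Pi.add_apply]
          rw [Real.rpow_add ht, Real.rpow_natCast]
          ring

/-- Write p_n^(-u) as the integral of u exp(-ut) over t ≥ log p_n and exchange sum and integral: the
number of n with log p_n ≤ t is π(e^t). Working in `ℝ≥0∞` needs no prior summability, which is
deduced from this identity. -/
theorem lintegral_count_exp (hp_mono : StrictMono p) (hp_one : 1 ≤ p 0)
    (hp_top : Tendsto p atTop atTop) {u : ℝ} (hu : 0 < u) :
    ∫⁻ n, ENNReal.ofReal (Real.exp (u * negLog p n)) ∂Measure.count =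
      ∫⁻ t in Set.Ioi 0, ENNReal.ofReal (u * (density p t * t ^ 0 * Real.exp (-((u - 1) * t)))) := by
  have hterm : ∀ n, ENNReal.ofReal (Real.exp (u * negLog p n)) =
      ∫⁻ t in Set.Ioi 0, (Set.Ici (Real.log (p n))).indicator
        (fun t => ENNReal.ofReal (u * Real.exp (-u * t))) t := by
    intro n
    have hl : 0 ≤ Real.log (p n) := Real.log_nonneg (one_le_of_strictMono hp_mono hp_one n)
    -- The endpoint log p_n may be 0 when n = 0, and in general only null sets are lost by opening
    -- the interval.
    have hae : (Set.Ici (Real.log (p n)) ∩ Set.Ioi 0 : Set ℝ) =ᵐ[volume] Set.Ioi (Real.log (p n)) := by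
      have h1 : (Set.Ici (Real.log (p n)) ∩ Set.Ioi 0 : Set ℝ) =ᵐ[volume]
          (Set.Ioi (Real.log (p n)) ∩ Set.Ioi 0 : Set ℝ) :=
        Ioi_ae_eq_Ici.symm.inter (ae_eq_refl _)
      rwa [Set.Ioi_inter_Ioi, max_eq_left hl] at h1
    rw [lintegral_indicator measurableSet_Ici, Measure.restrict_restrict measurableSet_Ici,
      setLIntegral_congr hae,
      ← ofReal_integral_eq_lintegral_ofReal ((integrableOn_exp_mul_Ioi (neg_lt_zero.2 hu) _).const_mul u)
        (ae_of_all _ fun t => by positivity), integral_const_mul,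
      integral_exp_mul_Ioi (neg_lt_zero.2 hu)]
    congr 1
    simp only [negLog]
    rw [mul_neg, neg_mul]
    field_simp
  rw [lintegral_count]
  simp_rw [hterm]
  rw [← lintegral_tsum fun n => (Measurable.indicator (by fun_prop) measurableSet_Ici).aemeasurable]
  refine lintegral_congr fun t => ?_
  have hset : ∀ n, (Set.Ici (Real.log (p n))).indicator
      (fun t => ENNReal.ofReal (u * Real.exp (-u * t))) t =
      {n | p n ≤ Real.exp t}.indicator (fun _ => ENNReal.ofReal (u * Real.exp (-u * t))) n := by
    intro n
    have h1 := one_le_of_strictMono hp_mono hp_one n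
    have : (t ∈ Set.Ici (Real.log (p n))) ↔ n ∈ {n | p n ≤ Real.exp t} := by
      simp only [Set.mem_Ici, Set.mem_ofPred_eq]
      exact Real.log_le_iff_le_exp (by linarith)
    simp only [Set.indicator_apply, this]
  simp_rw [hset]
  have hfin := finite_setOf_le hp_top (Real.exp t)
  rw [← tsum_subtype, ENNReal.tsum_set_const, ← hfin.cast_ncard_eq]
  have hc : (({n | p n ≤ Real.exp t}.ncard : ℕ∞) : ℝ≥0∞) =
      ENNReal.ofReal (countingFunction p (Real.exp t)) := by
    simp [countingFunction]
  rw [hc, ← ENNReal.ofReal_mul (countingFunction_nonneg _)]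
  congr 1
  simp only [density]
  rw [show -u * t = -t + -((u - 1) * t) by ring, Real.exp_add]
  ring

theorem integrable_exp_negLog (hp_mono : StrictMono p) (hp_one : 1 ≤ p 0)
    (hp_top : Tendsto p atTop atTop) {α : ℝ}
    (hπ : countingFunction p ~[atTop] fun x : ℝ => x * Real.log x ^ α) {u : ℝ} (hu : 1 < u) :
    Integrable (fun n => Real.exp (u * negLog p n)) Measure.count := by
  refine ⟨measurable_from_nat.aestronglyMeasurable, ?_⟩
  rw [hasFiniteIntegral_iff_ofReal (ae_of_all _ fun n => (Real.exp_pos _).le),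
    lintegral_count_exp hp_mono hp_one hp_top (by linarith)]
  exact ((integrableOn_density_mul_exp hp_top hπ 0 (δ := u - 1) (by linarith)).const_mul
    u).lintegral_lt_top

theorem mgf_negLog_eq (hp_mono : StrictMono p) (hp_one : 1 ≤ p 0)
    (hp_top : Tendsto p atTop atTop) {α : ℝ}
    (hπ : countingFunction p ~[atTop] fun x : ℝ => x * Real.log x ^ α) {u : ℝ} (hu : 1 < u) :
    mgf (negLog p) Measure.count u = u * laplace p 0 (u - 1) := by
  have h1 := integrable_exp_negLog hp_mono hp_one hp_top hπ hu
  have h2 := (integrableOn_density_mul_exp hp_top hπ 0 (δ := u - 1) (by linarith)).const_mul u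
  have h0 : ∀ t ∈ Set.Ioi (0 : ℝ), 0 ≤ u * (density p t * t ^ 0 * Real.exp (-((u - 1) * t))) :=
    fun t ht => by
      have := density_nonneg (p := p) t
      positivity
  have h := lintegral_count_exp hp_mono hp_one hp_top (u := u) (by linarith)
  rw [← ofReal_integral_eq_lintegral_ofReal h1 (ae_of_all _ fun n => (Real.exp_pos _).le),
    ← ofReal_integral_eq_lintegral_ofReal h2
      ((ae_restrict_iff' measurableSet_Ioi).2 (ae_of_all _ h0)),
    ENNReal.ofReal_eq_ofReal_iff (integral_nonneg fun n => (Real.exp_pos _).le)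
      (setIntegral_nonneg measurableSet_Ioi h0), integral_const_mul] at h
  exact h

/-- The measure on `(0, ∞)` whose density is the normalized counting function. -/
noncomputable def densityMeasure (p : ℕ → ℝ) : Measure ℝ :=
  (volume.restrict (Set.Ioi 0)).withDensity fun t => ENNReal.ofReal (density p t)

theorem integral_densityMeasure (hp_top : Tendsto p atTop atTop) (f : ℝ → ℝ) :
    ∫ t, f t ∂densityMeasure p = ∫ t in Set.Ioi 0, density p t * f t := by
  rw [densityMeasure, integral_withDensity_eq_integral_toReal_smul
    (measurable_density hp_top).ennreal_ofReal (ae_of_all _ fun t => ENNReal.ofReal_lt_top)]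
  simp [ENNReal.toReal_ofReal (density_nonneg _)]

theorem mem_interior_integrableExpSet_densityMeasure (hp_top : Tendsto p atTop atTop) {α : ℝ}
    (hπ : countingFunction p ~[atTop] fun x : ℝ => x * Real.log x ^ α) {δ : ℝ} (hδ : 0 < δ) :
    δ ∈ interior (integrableExpSet (fun t : ℝ => -t) (densityMeasure p)) := by
  refine mem_interior.2 ⟨Set.Ioi 0, fun v hv => ?_, isOpen_Ioi, hδ⟩
  simp only [integrableExpSet, Set.mem_ofPred_eq]
  rw [densityMeasure, integrable_withDensity_iff_integrable_smul'
    (measurable_density hp_top).ennreal_ofReal (ae_of_all _ fun t => ENNReal.ofReal_lt_top)]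
  have := integrableOn_density_mul_exp hp_top hπ 0 (δ := v) hv
  simpa [IntegrableOn, ENNReal.toReal_ofReal (density_nonneg _)] using this

/-- Up to the sign (-1)^j, `laplace p j` is the j-th derivative of the moment generating function of
-t under `densityMeasure p`, so differentiation under the integral is inherited from there. -/
theorem hasDerivAt_laplace (hp_top : Tendsto p atTop atTop) {α : ℝ}
    (hπ : countingFunction p ~[atTop] fun x : ℝ => x * Real.log x ^ α) (j : ℕ) {δ : ℝ} (hδ : 0 < δ) :
    HasDerivAt (laplace p j) (-laplace p (j + 1) δ) δ := by
  have h := hasDerivAt_integral_pow_mul_exp_real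
    (mem_interior_integrableExpSet_densityMeasure hp_top hπ hδ) j
  have key : ∀ i : ℕ, ∀ δ : ℝ, ∫ t : ℝ, (-t) ^ i * Real.exp (δ * -t) ∂densityMeasure p =
      (-1) ^ i * laplace p i δ := by
    intro i δ
    rw [integral_densityMeasure hp_top, laplace, ← integral_const_mul]
    refine integral_congr_ae (ae_of_all _ fun t => ?_)
    simp only
    rw [neg_pow, mul_neg]
    ring
  simp only [key] at h
  have h2 := h.const_mul ((-1 : ℝ) ^ j)
  have e : (-1 : ℝ) ^ j * (-1) ^ j = 1 := by rw [← mul_pow]; simp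
  have e1 : (fun y => (-1 : ℝ) ^ j * ((-1) ^ j * laplace p j y)) = laplace p j := by
    ext δ; rw [← mul_assoc, e, one_mul]
  have e2 : (-1 : ℝ) ^ j * ((-1) ^ (j + 1) * laplace p (j + 1) δ) = -laplace p (j + 1) δ := by
    rw [pow_succ, ← mul_assoc, ← mul_assoc, e]; ring
  rwa [e1, e2] at h2

/-- Both sides are the derivative of K(u) = u · `laplace p 0 (u - 1)`, computed in two ways. The
second moment is treated likewise. -/
theorem integral_negLog_mul_exp (hp_mono : StrictMono p) (hp_one : 1 ≤ p 0)
    (hp_top : Tendsto p atTop atTop) {α : ℝ}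
    (hπ : countingFunction p ~[atTop] fun x : ℝ => x * Real.log x ^ α) {u : ℝ} (hu : 1 < u) :
    ∫ n, negLog p n * Real.exp (u * negLog p n) ∂Measure.count =
      laplace p 0 (u - 1) - u * laplace p 1 (u - 1) := by
  have hI := fun u (hu : 1 < u) => integrable_exp_negLog hp_mono hp_one hp_top hπ hu
  have h1 := hasDerivAt_mgf (mem_interior_integrableExpSet hI hu)
  have h2 : HasDerivAt (fun u => u * laplace p 0 (u - 1))
      (1 * laplace p 0 (u - 1) + u * -laplace p 1 (u - 1)) u :=
    (hasDerivAt_id u).mul ((hasDerivAt_laplace hp_top hπ 0 (δ := u - 1)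
      (by linarith)).comp_sub_const u 1)
  have h3 : mgf (negLog p) Measure.count =ᶠ[𝓝 u] fun u => u * laplace p 0 (u - 1) := by
    filter_upwards [Ioi_mem_nhds hu] with v hv
    exact mgf_negLog_eq hp_mono hp_one hp_top hπ hv
  have := h1.unique (h2.congr_of_eventuallyEq h3)
  simp only at this
  rw [this]; ring

theorem integral_negLog_sq_mul_exp (hp_mono : StrictMono p) (hp_one : 1 ≤ p 0)
    (hp_top : Tendsto p atTop atTop) {α : ℝ}
    (hπ : countingFunction p ~[atTop] fun x : ℝ => x * Real.log x ^ α) {u : ℝ} (hu : 1 < u) :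
    ∫ n, negLog p n ^ 2 * Real.exp (u * negLog p n) ∂Measure.count =
      u * laplace p 2 (u - 1) - 2 * laplace p 1 (u - 1) := by
  have hI := fun u (hu : 1 < u) => integrable_exp_negLog hp_mono hp_one hp_top hπ hu
  have h1 := hasDerivAt_integral_pow_mul_exp_real (mem_interior_integrableExpSet hI hu) 1
  have hd : ∀ j, HasDerivAt (fun u => laplace p j (u - 1)) (-laplace p (j + 1) (u - 1)) u :=
    fun j => (hasDerivAt_laplace hp_top hπ j (δ := u - 1) (by linarith)).comp_sub_const u 1
  have h2 : HasDerivAt (fun u => laplace p 0 (u - 1) - u * laplace p 1 (u - 1))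
      (-laplace p 1 (u - 1) - (1 * laplace p 1 (u - 1) + u * -laplace p 2 (u - 1))) u :=
    (hd 0).sub ((hasDerivAt_id u).mul (hd 1))
  have h3 : (fun u => ∫ n, negLog p n ^ 1 * Real.exp (u * negLog p n) ∂Measure.count)
      =ᶠ[𝓝 u] fun u => laplace p 0 (u - 1) - u * laplace p 1 (u - 1) := by
    filter_upwards [Ioi_mem_nhds hu] with v hv
    rw [← integral_negLog_mul_exp hp_mono hp_one hp_top hπ hv]
    simp
  have := h1.unique (h2.congr_of_eventuallyEq h3)
  simp only [Nat.reduceAdd] at this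
  rw [this]; ring

end RandomDirichlet

/-! ### Abelian asymptotics of the Laplace transforms as δ → 0⁺. -/

namespace RandomDirichlet

/-- Integrals of `r` and `r₀` against kernels with values in `[0, 1]` are equivalent when the
integrals of `r₀` diverge and `r - r₀` is small relative to `r₀` off sets of finite mass. -/
theorem isEquivalent_integral_kernel {β : Type*} {l : Filter β} {ν : Measure ℝ} {r r₀ : ℝ → ℝ}
    {k : β → ℝ → ℝ} (hr₀ : ∀ᵐ t ∂ν, 0 ≤ r₀ t)
    (hk : ∀ᶠ b in l, ∀ᵐ t ∂ν, 0 ≤ k b t ∧ k b t ≤ 1)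
    (hsmall : ∀ ε : ℝ, 0 < ε → ∃ A : Set ℝ, MeasurableSet A ∧ IntegrableOn r A ν ∧
      IntegrableOn r₀ A ν ∧ ∀ᵐ t ∂ν, t ∉ A → |r t - r₀ t| ≤ ε * r₀ t)
    (hint : ∀ᶠ b in l, Integrable (fun t => r t * k b t) ν)
    (hint₀ : ∀ᶠ b in l, Integrable (fun t => r₀ t * k b t) ν)
    (hdiv : Tendsto (fun b => ∫ t, r₀ t * k b t ∂ν) l atTop) :
    (fun b => ∫ t, r t * k b t ∂ν) ~[l] fun b => ∫ t, r₀ t * k b t ∂ν := by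
  rw [IsEquivalent, isLittleO_iff]
  intro c hc
  obtain ⟨A, hA, hrA, hr₀A, hAc⟩ := hsmall (c / 2) (by positivity)
  set D := ∫ t in A, |r t - r₀ t| ∂ν with hD
  filter_upwards [hk, hint, hint₀, hdiv.eventually_ge_atTop (D / (c / 2)),
    hdiv.eventually_ge_atTop 0] with b hb hib hib₀ hge h0
  rw [Real.norm_of_nonneg h0, Pi.sub_apply, ← integral_sub hib hib₀]
  -- On A the error is at most the fixed number D, as k ≤ 1; off A it is at most c/2 times the main
  -- term. Since the main term diverges, D is eventually at most c/2 times it as well.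
  have hI : Integrable (fun t => A.indicator (fun t => |r t - r₀ t|) t + c / 2 * (r₀ t * k b t)) ν :=
    ((integrable_indicator_iff hA).2 (hrA.sub hr₀A).abs).add (hib₀.const_mul _)
  have hle : ‖∫ t, (r t * k b t - r₀ t * k b t) ∂ν‖ ≤
      ∫ t, (A.indicator (fun t => |r t - r₀ t|) t + c / 2 * (r₀ t * k b t)) ∂ν := by
    refine norm_integral_le_of_norm_le hI ?_
    filter_upwards [hr₀, hb, hAc] with t ht0 htk htA
    rw [← sub_mul, norm_mul, Real.norm_of_nonneg htk.1, Real.norm_eq_abs]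
    by_cases h : t ∈ A
    · rw [Set.indicator_of_mem h]
      have h1 := mul_le_mul_of_nonneg_left htk.2 (abs_nonneg (r t - r₀ t))
      have h2 : 0 ≤ c / 2 * (r₀ t * k b t) := mul_nonneg (by positivity) (mul_nonneg ht0 htk.1)
      linarith
    · rw [Set.indicator_of_notMem h, zero_add, ← mul_assoc]
      exact mul_le_mul_of_nonneg_right (htA h) htk.1
  refine hle.trans ?_
  have hJ : Integrable (A.indicator fun t => |r t - r₀ t|) ν :=
    (integrable_indicator_iff hA).2 (hrA.sub hr₀A).abs
  rw [integral_add hJ (hib₀.const_mul _),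
    integral_indicator hA, integral_const_mul]
  change D + _ ≤ _
  rw [div_le_iff₀ (by positivity)] at hge
  linarith

variable {p : ℕ → ℝ}

theorem integrableOn_density_mul_pow_Ioc (hp_top : Tendsto p atTop atTop) (j : ℕ) (M : ℝ) :
    IntegrableOn (fun t => density p t * t ^ j) (Set.Ioc 0 M) := by
  have hm : Measurable fun t => density p t * t ^ j := (measurable_density hp_top).mul (by fun_prop)
  refine Measure.integrableOn_of_bounded (M := countingFunction p (Real.exp M) * M ^ j) (by simp)
    hm.aestronglyMeasurable ?_
  refine (ae_restrict_iff' measurableSet_Ioc).2 (ae_of_all _ fun t ht => ?_)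
  have hd := density_nonneg (p := p) t
  have ht0 := ht.1
  rw [Real.norm_of_nonneg (by positivity)]
  have := density_le_of_le hp_top ht.1.le ht.2
  gcongr
  · exact countingFunction_nonneg _
  · exact ht.2

/-- The comparison function is prescribed only for large t. This freedom is needed for α = -1, j =
0, where 1/t must be cut off near 0. -/
theorem laplace_isEquivalent_aux (hp_top : Tendsto p atTop atTop) {α : ℝ}
    (hπ : countingFunction p ~[atTop] fun x : ℝ => x * Real.log x ^ α) (j : ℕ) {r₀ : ℝ → ℝ}
    (hr₀ : ∀ t, 0 < t → 0 ≤ r₀ t) (heq : ∀ᶠ t in atTop, r₀ t = t ^ α * t ^ j)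
    (hloc : ∀ M, IntegrableOn r₀ (Set.Ioc 0 M))
    (hint : ∀ δ, 0 < δ → IntegrableOn (fun t => r₀ t * Real.exp (-(δ * t))) (Set.Ioi 0))
    (hdiv : Tendsto (fun δ => ∫ t in Set.Ioi 0, r₀ t * Real.exp (-(δ * t))) (𝓝[>] 0) atTop) :
    laplace p j ~[𝓝[>] 0] fun δ => ∫ t in Set.Ioi 0, r₀ t * Real.exp (-(δ * t)) := by
  refine isEquivalent_integral_kernel ?_ ?_ ?_ ?_ ?_ hdiv
  · exact (ae_restrict_iff' measurableSet_Ioi).2 (ae_of_all _ hr₀)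
  · filter_upwards [self_mem_nhdsWithin] with δ hδ
    refine (ae_restrict_iff' measurableSet_Ioi).2 (ae_of_all _ fun t ht => ?_)
    exact ⟨(Real.exp_pos _).le, Real.exp_le_one_iff.2 (neg_nonpos.2 (mul_pos hδ ht).le)⟩
  · intro ε hε
    have h1 := isLittleO_iff.1 (density_isEquivalent hπ).isLittleO hε
    obtain ⟨M, hM⟩ := eventually_atTop.1 ((h1.and heq).and (eventually_ge_atTop 0))
    refine ⟨Set.Ioc 0 M, measurableSet_Ioc, ?_, ?_, ?_⟩
    · exact (integrableOn_density_mul_pow_Ioc hp_top j M).mono_measure Measure.restrict_le_self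
    · exact (hloc M).mono_measure Measure.restrict_le_self
    · refine (ae_restrict_iff' measurableSet_Ioi).2 (ae_of_all _ fun t ht htA => ?_)
      have ht : 0 < t := ht
      have htM : M ≤ t := by
        by_contra! hcon
        exact htA ⟨ht, hcon.le⟩
      obtain ⟨⟨h2, h3⟩, -⟩ := hM t htM
      rw [h3, ← sub_mul, abs_mul, abs_of_nonneg (pow_nonneg ht.le j), ← mul_assoc]
      refine mul_le_mul_of_nonneg_right ?_ (pow_nonneg ht.le j)
      rwa [Real.norm_eq_abs, Real.norm_of_nonneg (Real.rpow_nonneg ht.le _), Pi.sub_apply] at h2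
  · filter_upwards [self_mem_nhdsWithin] with δ hδ
    exact integrableOn_density_mul_exp hp_top hπ j hδ
  · filter_upwards [self_mem_nhdsWithin] with δ hδ
    exact hint δ hδ

theorem integral_rpow_mul_exp {b δ : ℝ} (hb : -1 < b) (hδ : 0 < δ) :
    ∫ t in Set.Ioi 0, t ^ b * Real.exp (-(δ * t)) = (1 / δ) ^ (b + 1) * Real.Gamma (b + 1) := by
  have := Real.integral_rpow_mul_exp_neg_mul_Ioi (a := b + 1) (by linarith) hδ
  rwa [add_sub_cancel_right] at this

theorem tendsto_rpow_mul_laplace (hp_top : Tendsto p atTop atTop) {α : ℝ}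
    (hπ : countingFunction p ~[atTop] fun x : ℝ => x * Real.log x ^ α) (j : ℕ)
    (hj : -1 < α + j) :
    Tendsto (fun δ => δ ^ (α + j + 1) * laplace p j δ) (𝓝[>] 0) (𝓝 (Real.Gamma (α + j + 1))) := by
  have hΓ : 0 < Real.Gamma (α + j + 1) := Real.Gamma_pos_of_pos (by linarith)
  have heqI : ∀ᶠ δ in 𝓝[>] (0 : ℝ), ∫ t in Set.Ioi 0, t ^ (α + j) * Real.exp (-(δ * t)) =
      (1 / δ) ^ (α + j + 1) * Real.Gamma (α + j + 1) := by
    filter_upwards [self_mem_nhdsWithin] with δ hδ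
    exact integral_rpow_mul_exp hj hδ
  have hdiv : Tendsto (fun δ : ℝ => (1 / δ) ^ (α + j + 1) * Real.Gamma (α + j + 1)) (𝓝[>] 0) atTop := by
    refine Tendsto.atTop_mul_const hΓ ((tendsto_rpow_atTop (by linarith)).comp ?_)
    exact (tendsto_inv_nhdsGT_zero (𝕜 := ℝ)).congr fun x => (one_div x).symm
  have h := laplace_isEquivalent_aux hp_top hπ j (r₀ := fun t => t ^ (α + j))
    (fun t ht => Real.rpow_nonneg ht.le _) ?_ ?_ (fun δ hδ => integrableOn_rpow_mul_exp hj hδ)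
    (hdiv.congr' (heqI.mono fun _ h => h.symm))
  · have h2 := h.congr_right heqI
    have h3 := (isEquivalent_iff_tendsto_one (hdiv.eventually_ne_atTop 0)).1 h2
    have h4 := h3.mul_const (Real.Gamma (α + j + 1))
    rw [one_mul] at h4
    refine h4.congr' ?_
    filter_upwards [self_mem_nhdsWithin] with δ hδ
    have hδ : 0 < δ := hδ
    have : 0 < δ ^ (α + j + 1) := by positivity
    simp only [Pi.div_apply]
    rw [Real.div_rpow one_pos.le hδ.le, Real.one_rpow]
    field_simp
  · filter_upwards [eventually_gt_atTop 0] with t ht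
    rw [Real.rpow_add ht, Real.rpow_natCast]
  · intro M
    rcases le_total 0 M with hM | hM
    · exact (intervalIntegrable_iff_integrableOn_Ioc_of_le hM).1
        (intervalIntegral.intervalIntegrable_rpow' hj)
    · rw [Set.Ioc_eq_empty (not_lt.2 hM)]
      exact integrableOn_empty

theorem integrableOn_inv_mul_exp {δ : ℝ} (hδ : 0 < δ) :
    IntegrableOn (fun t : ℝ => t⁻¹ * Real.exp (-(δ * t))) (Set.Ioi 1) := by
  refine Integrable.mono' (integrableOn_const_mul_exp_neg 1 1 hδ) ?_ ?_
  · exact Measurable.aestronglyMeasurable (by fun_prop)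
  · refine (ae_restrict_iff' measurableSet_Ioi).2 (ae_of_all _ fun t ht => ?_)
    have ht : 1 < t := ht
    rw [Real.norm_of_nonneg (by positivity)]
    gcongr
    exact inv_le_one_of_one_le₀ ht.le

/-- Split at 1/δ. Below it, 1 - δt ≤ exp(-δt) ≤ 1 gives log(1/δ) up to an error of at most 1; beyond
it, 1/t ≤ δ bounds the tail by exp(-1). -/
theorem integral_inv_mul_exp_bounds {δ : ℝ} (hδ : 0 < δ) (hδ1 : δ < 1) :
    Real.log (1 / δ) - 1 ≤ ∫ t in Set.Ioi 1, t⁻¹ * Real.exp (-(δ * t)) ∧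
      ∫ t in Set.Ioi 1, t⁻¹ * Real.exp (-(δ * t)) ≤ Real.log (1 / δ) + 1 := by
  have h1δ : 1 ≤ 1 / δ := by rw [le_div_iff₀ hδ]; linarith
  have hI := integrableOn_inv_mul_exp hδ
  have hIa : IntegrableOn (fun t : ℝ => t⁻¹ * Real.exp (-(δ * t))) (Set.Ioc 1 (1 / δ)) :=
    hI.mono_set Set.Ioc_subset_Ioi_self
  have hIb : IntegrableOn (fun t : ℝ => t⁻¹ * Real.exp (-(δ * t))) (Set.Ioi (1 / δ)) :=
    hI.mono_set (Set.Ioi_subset_Ioi h1δ)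
  have hsplit : ∫ t in Set.Ioi 1, t⁻¹ * Real.exp (-(δ * t)) =
      (∫ t in Set.Ioc 1 (1 / δ), t⁻¹ * Real.exp (-(δ * t))) +
        ∫ t in Set.Ioi (1 / δ), t⁻¹ * Real.exp (-(δ * t)) := by
    rw [← setIntegral_union (Set.Ioc_disjoint_Ioi le_rfl) measurableSet_Ioi hIa hIb,
      Set.Ioc_union_Ioi_eq_Ioi h1δ]
  have hinv : IntegrableOn (fun t : ℝ => t⁻¹) (Set.Ioc 1 (1 / δ)) := by
    refine IntegrableOn.mono_set (t := Set.Icc 1 (1 / δ)) ?_ Set.Ioc_subset_Icc_self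
    refine (ContinuousOn.inv₀ continuousOn_id fun t ht => ?_).integrableOn_Icc
    have : (1 : ℝ) ≤ t := ht.1
    simp only [id]
    linarith
  have hlog : ∫ t in Set.Ioc 1 (1 / δ), t⁻¹ = Real.log (1 / δ) := by
    rw [← intervalIntegral.integral_of_le h1δ, integral_inv_of_pos one_pos (by positivity), div_one]
  have hb0 : 0 ≤ ∫ t in Set.Ioi (1 / δ), t⁻¹ * Real.exp (-(δ * t)) :=
    setIntegral_nonneg measurableSet_Ioi fun t ht => by
      have : 0 < t := (by positivity : (0 : ℝ) < 1 / δ).trans ht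
      positivity
  constructor
  · have hc : IntegrableOn (fun _ : ℝ => δ) (Set.Ioc 1 (1 / δ)) := integrableOn_const (by simp)
    have : ∫ t in Set.Ioc 1 (1 / δ), (t⁻¹ - δ) ≤
        ∫ t in Set.Ioc 1 (1 / δ), t⁻¹ * Real.exp (-(δ * t)) := by
      refine setIntegral_mono_on (hinv.sub hc) hIa measurableSet_Ioc fun t ht => ?_
      have ht0 : 0 < t := by linarith [ht.1]
      have h2 := Real.add_one_le_exp (-(δ * t))
      calc t⁻¹ - δ = t⁻¹ * (-(δ * t) + 1) := by field_simp; ring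
        _ ≤ _ := by gcongr
    rw [integral_sub hinv hc, hlog, setIntegral_const, measureReal_def, Real.volume_Ioc,
      ENNReal.toReal_ofReal (by linarith), smul_eq_mul, sub_mul, one_div, inv_mul_cancel₀ hδ.ne',
      ← one_div] at this
    rw [hsplit]
    linarith
  · have ha : ∫ t in Set.Ioc 1 (1 / δ), t⁻¹ * Real.exp (-(δ * t)) ≤ Real.log (1 / δ) := by
      rw [← hlog]
      refine setIntegral_mono_on hIa hinv measurableSet_Ioc fun t ht => ?_
      have ht0 : 0 < t := by linarith [ht.1]
      refine mul_le_of_le_one_right (by positivity) (Real.exp_le_one_iff.2 ?_)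
      nlinarith
    have hb : ∫ t in Set.Ioi (1 / δ), t⁻¹ * Real.exp (-(δ * t)) ≤
        ∫ t in Set.Ioi (1 / δ), δ * Real.exp (-δ * t) := by
      refine setIntegral_mono_on hIb ((integrableOn_exp_mul_Ioi (neg_lt_zero.2 hδ) _).const_mul δ)
        measurableSet_Ioi fun t ht => ?_
      have hb : (0 : ℝ) < 1 / δ := by positivity
      have ht : 1 / δ < t := ht
      rw [neg_mul]
      gcongr
      rw [inv_le_comm₀ (hb.trans ht) hδ, ← one_div]
      exact ht.le
    rw [integral_const_mul, integral_exp_mul_Ioi (neg_lt_zero.2 hδ)] at hb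
    have he : δ * (-Real.exp (-δ * (1 / δ)) / -δ) = Real.exp (-1) := by
      rw [neg_mul, mul_one_div_cancel hδ.ne']
      field_simp
    have he1 : Real.exp (-1) ≤ 1 := Real.exp_le_one_iff.2 (by norm_num)
    rw [hsplit]
    linarith

theorem tendsto_log_one_div_nhdsGT_zero :
    Tendsto (fun δ : ℝ => Real.log (1 / δ)) (𝓝[>] 0) atTop := by
  refine Real.tendsto_log_atTop.comp ?_
  exact (tendsto_inv_nhdsGT_zero (𝕜 := ℝ)).congr fun x => (one_div x).symm

theorem tendsto_laplace_div_log (hp_top : Tendsto p atTop atTop)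
    (hπ : countingFunction p ~[atTop] fun x : ℝ => x * Real.log x ^ (-1 : ℝ)) :
    Tendsto (fun δ => laplace p 0 δ / Real.log (1 / δ)) (𝓝[>] 0) (𝓝 1) := by
  set r₀ : ℝ → ℝ := (Set.Ioi (1 : ℝ)).indicator fun t => t⁻¹ with hr₀
  have hprod : ∀ δ : ℝ, (fun t => r₀ t * Real.exp (-(δ * t))) =
      (Set.Ioi (1 : ℝ)).indicator fun t => t⁻¹ * Real.exp (-(δ * t)) := fun δ => by
    ext t
    rw [hr₀, Set.indicator_mul_left]
  have hsub : Set.Ioi (0 : ℝ) ∩ Set.Ioi 1 = Set.Ioi 1 := by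
    rw [Set.Ioi_inter_Ioi]; simp
  have hint : ∀ δ, ∫ t in Set.Ioi 0, r₀ t * Real.exp (-(δ * t)) =
      ∫ t in Set.Ioi 1, t⁻¹ * Real.exp (-(δ * t)) := fun δ => by
    rw [hprod, setIntegral_indicator measurableSet_Ioi, hsub]
  have hlt : ∀ᶠ δ : ℝ in 𝓝[>] 0, δ < 1 := mem_nhdsWithin_of_mem_nhds (Iio_mem_nhds one_pos)
  have hdiv : Tendsto (fun δ => ∫ t in Set.Ioi 0, r₀ t * Real.exp (-(δ * t))) (𝓝[>] 0) atTop := by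
    refine tendsto_atTop_mono' _ ?_ (tendsto_atTop_add_const_right _ (-1 : ℝ)
      tendsto_log_one_div_nhdsGT_zero)
    filter_upwards [self_mem_nhdsWithin, hlt] with δ hδ hδ1
    rw [hint]
    exact (integral_inv_mul_exp_bounds hδ hδ1).1
  have h := laplace_isEquivalent_aux hp_top hπ 0 (r₀ := r₀) ?_ ?_ ?_ ?_ hdiv
  · refine (isEquivalent_iff_tendsto_one (tendsto_log_one_div_nhdsGT_zero.eventually_ne_atTop 0)).1
      (h.trans ?_)
    rw [IsEquivalent, isLittleO_iff]
    intro c hc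
    filter_upwards [self_mem_nhdsWithin, hlt,
      tendsto_log_one_div_nhdsGT_zero.eventually_ge_atTop (1 / c)] with δ hδ hδ1 hge
    have hb := integral_inv_mul_exp_bounds hδ hδ1
    rw [Pi.sub_apply, hint, Real.norm_eq_abs, Real.norm_of_nonneg (le_trans (by positivity) hge)]
    rw [div_le_iff₀ hc] at hge
    rw [abs_le]
    constructor <;> linarith [hb.1, hb.2]
  · intro t ht
    exact Set.indicator_apply_nonneg fun _ => by positivity
  · filter_upwards [eventually_gt_atTop 1] with t ht
    rw [hr₀, Set.indicator_of_mem (Set.mem_Ioi.2 ht), Real.rpow_neg_one, pow_zero, mul_one]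
  · intro M
    rw [hr₀, integrableOn_indicator_iff measurableSet_Ioi]
    refine IntegrableOn.mono_set (t := Set.Icc 1 (max M 1)) ?_ fun t ht => ⟨ht.1.le, ?_⟩
    · refine (ContinuousOn.inv₀ continuousOn_id fun t ht => ?_).integrableOn_Icc
      have : (1 : ℝ) ≤ t := ht.1
      simp only [id]
      linarith
    · exact ht.2.2.trans (le_max_left _ _)
  · intro δ hδ
    rw [hprod, integrableOn_indicator_iff measurableSet_Ioi]
    exact (integrableOn_inv_mul_exp hδ).mono_set Set.inter_subset_left

end RandomDirichlet

/-! ### The curvature near its singularity at u = 1. -/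

namespace RandomDirichlet

variable {p : ℕ → ℝ}

theorem curv_negLog_eq (hp_mono : StrictMono p) (hp_one : 1 ≤ p 0)
    (hp_top : Tendsto p atTop atTop) {α : ℝ}
    (hπ : countingFunction p ~[atTop] fun x : ℝ => x * Real.log x ^ α) {δ : ℝ} (hδ : 0 < δ) :
    curv (negLog p) (1 + δ) =
      ((1 + δ) * laplace p 2 δ - 2 * laplace p 1 δ) / ((1 + δ) * laplace p 0 δ) -
        ((laplace p 0 δ - (1 + δ) * laplace p 1 δ) / ((1 + δ) * laplace p 0 δ)) ^ 2 := by
  have hI := fun u (hu : 1 < u) => integrable_exp_negLog hp_mono hp_one hp_top hπ hu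
  have hu : 1 < 1 + δ := by linarith
  rw [curv_eq hI hu, mgf_negLog_eq hp_mono hp_one hp_top hπ hu,
    integral_negLog_mul_exp hp_mono hp_one hp_top hπ hu,
    integral_negLog_sq_mul_exp hp_mono hp_one hp_top hπ hu]
  simp only [add_sub_cancel_left]

theorem laplace_zero_pos (hp_mono : StrictMono p) (hp_one : 1 ≤ p 0)
    (hp_top : Tendsto p atTop atTop) {α : ℝ}
    (hπ : countingFunction p ~[atTop] fun x : ℝ => x * Real.log x ^ α) {δ : ℝ} (hδ : 0 < δ) :
    0 < laplace p 0 δ := by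
  have hI := fun u (hu : 1 < u) => integrable_exp_negLog hp_mono hp_one hp_top hπ hu
  have h := mgf_count_pos hI (u := 1 + δ) (by linarith)
  rw [mgf_negLog_eq hp_mono hp_one hp_top hπ (by linarith), add_sub_cancel_left] at h
  exact (mul_pos_iff_of_pos_left (by linarith)).1 h

theorem tendsto_id_nhdsGT_zero : Tendsto (fun δ : ℝ => δ) (𝓝[>] 0) (𝓝 0) :=
  tendsto_id.mono_left nhdsWithin_le_nhds

/-- After scaling by δ, the limiting moments are those of a Gamma law of shape α + 1, with mean α +
1 and second moment (α + 1)(α + 2), so the variance is α + 1. The remaining terms of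
`curv_negLog_eq` carry an extra factor δ. -/
theorem tendsto_sq_mul_curv (hp_mono : StrictMono p) (hp_one : 1 ≤ p 0)
    (hp_top : Tendsto p atTop atTop) {α : ℝ} (hα : -1 < α)
    (hπ : countingFunction p ~[atTop] fun x : ℝ => x * Real.log x ^ α) :
    Tendsto (fun δ => δ ^ 2 * curv (negLog p) (1 + δ)) (𝓝[>] 0) (𝓝 (1 + α)) := by
  have ha : 0 < α + 1 := by linarith
  have h0 := tendsto_rpow_mul_laplace hp_top hπ 0 (by simpa using hα)
  have h1 := tendsto_rpow_mul_laplace hp_top hπ 1 (by push_cast; linarith)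
  have h2 := tendsto_rpow_mul_laplace hp_top hπ 2 (by push_cast; linarith)
  have e1 : Real.Gamma (α + 1 + 1) = (α + 1) * Real.Gamma (α + 1) := Real.Gamma_add_one ha.ne'
  have e2 : Real.Gamma (α + 2 + 1) = (α + 2) * ((α + 1) * Real.Gamma (α + 1)) := by
    rw [Real.Gamma_add_one (by linarith), show α + 2 = α + 1 + 1 by ring, e1]
  push_cast at h0 h1 h2
  rw [add_zero] at h0
  rw [e1] at h1
  rw [e2] at h2
  have hΓ : 0 < Real.Gamma (α + 1) := Real.Gamma_pos_of_pos ha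
  set G := Real.Gamma (α + 1)
  have hid := tendsto_id_nhdsGT_zero
  have hu : Tendsto (fun δ : ℝ => 1 + δ) (𝓝[>] 0) (𝓝 (1 + 0)) := hid.const_add 1
  have hden := hu.mul h0
  have hden0 : (1 + 0) * G ≠ 0 := by simpa using hΓ.ne'
  have hA := ((hu.mul h2).sub ((hid.const_mul 2).mul h1)).div hden hden0
  have hB := (((hid.mul h0).sub (hu.mul h1)).div hden hden0).pow 2
  have hlim : ((1 + 0) * ((α + 2) * ((α + 1) * G)) - 2 * 0 * ((α + 1) * G)) / ((1 + 0) * G) -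
      ((0 * G - (1 + 0) * ((α + 1) * G)) / ((1 + 0) * G)) ^ 2 = 1 + α := by
    field_simp
    ring
  rw [← hlim]
  refine (hA.sub hB).congr' ?_
  filter_upwards [self_mem_nhdsWithin] with δ hδ
  have hδ : 0 < δ := hδ
  rw [curv_negLog_eq hp_mono hp_one hp_top hπ hδ]
  have hJ := laplace_zero_pos hp_mono hp_one hp_top hπ hδ
  have r1 : δ ^ (α + 1 + 1) = δ ^ (α + 1) * δ := by rw [Real.rpow_add hδ (α + 1) 1, Real.rpow_one]
  have r2 : δ ^ (α + 2 + 1) = δ ^ (α + 1) * δ ^ 2 := by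
    rw [show α + 2 + 1 = α + 1 + 2 by ring, Real.rpow_add hδ (α + 1) 2, Real.rpow_two]
  simp only [Pi.div_apply]
  rw [r1, r2]
  have hD : 0 < δ ^ (α + 1) := by positivity
  generalize δ ^ (α + 1) = D at hD
  generalize laplace p 0 δ = A at hJ
  generalize laplace p 1 δ = B
  generalize laplace p 2 δ = C
  field_simp

/-- Now K ~ log(1/δ) while the higher Laplace moments keep pure powers of 1/δ. The second moment is
of order 1/(δ² log(1/δ)) and the squared mean is smaller by one more logarithm, so only the former
survives. -/
theorem tendsto_sq_mul_log_mul_curv (hp_mono : StrictMono p) (hp_one : 1 ≤ p 0)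
    (hp_top : Tendsto p atTop atTop)
    (hπ : countingFunction p ~[atTop] fun x : ℝ => x * Real.log x ^ (-1 : ℝ)) :
    Tendsto (fun δ => δ ^ 2 * Real.log (1 / δ) * curv (negLog p) (1 + δ)) (𝓝[>] 0) (𝓝 1) := by
  have h0 := tendsto_laplace_div_log hp_top hπ
  have h1 := tendsto_rpow_mul_laplace hp_top hπ 1 (by norm_num)
  have h2 := tendsto_rpow_mul_laplace hp_top hπ 2 (by norm_num)
  norm_num at h1 h2
  have hid := tendsto_id_nhdsGT_zero
  have hu : Tendsto (fun δ : ℝ => 1 + δ) (𝓝[>] 0) (𝓝 (1 + 0)) := hid.const_add 1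
  have hlog : Tendsto (fun δ : ℝ => δ * Real.log (1 / δ)) (𝓝[>] 0) (𝓝 0) := by
    have := (Real.continuous_mul_log.tendsto' 0 0 (by simp)).mono_left
      (nhdsWithin_le_nhds (s := Set.Ioi 0))
    refine (this.neg.congr fun δ => ?_).trans (by simp)
    rw [one_div, Real.log_inv]
    ring
  have hinv : Tendsto (fun δ : ℝ => (Real.log (1 / δ))⁻¹) (𝓝[>] 0) (𝓝 0) :=
    tendsto_inv_atTop_zero.comp tendsto_log_one_div_nhdsGT_zero
  have hden := hu.mul h0
  have hden0 : ((1 : ℝ) + 0) * 1 ≠ 0 := by norm_num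
  have hA := ((hu.mul h2).sub ((hid.const_mul 2).mul h1)).div hden hden0
  have hB := ((((hlog.mul h0)).sub (hu.mul h1)).div hden hden0).pow 2
  have hAB := hA.sub (hB.mul hinv)
  have hlim : ((1 + 0) * 1 - 2 * 0 * 1) / ((1 + 0) * 1) -
      ((0 * 1 - (1 + 0) * 1) / ((1 + 0) * 1)) ^ 2 * 0 = (1 : ℝ) := by norm_num
  rw [hlim] at hAB
  refine hAB.congr' ?_
  filter_upwards [self_mem_nhdsWithin,
    tendsto_log_one_div_nhdsGT_zero.eventually_gt_atTop 0] with δ hδ hl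
  have hδ : 0 < δ := hδ
  rw [curv_negLog_eq hp_mono hp_one hp_top hπ hδ]
  have hJ := laplace_zero_pos hp_mono hp_one hp_top hπ hδ
  simp only [Pi.div_apply]
  generalize Real.log (1 / δ) = l at hl
  generalize laplace p 0 δ = A at hJ
  generalize laplace p 1 δ = B
  generalize laplace p 2 δ = C
  field_simp

/-- Discard the squared mean and bound K below by its first term: only the second Laplace moment
remains, and its integrand is dominated by 1 + t^b. The point of b < 1 is that δ^(-(b+1)/2) is
integrable at 0. -/
theorem exists_curv_le_rpow (hp_mono : StrictMono p) (hp_one : 1 ≤ p 0)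
    (hp_top : Tendsto p atTop atTop) {α : ℝ} (hα : α < -1)
    (hπ : countingFunction p ~[atTop] fun x : ℝ => x * Real.log x ^ α) :
    ∃ C b : ℝ, 0 < C ∧ 0 ≤ b ∧ b < 1 ∧
      ∀ δ, 0 < δ → δ ≤ 1 → curv (negLog p) (1 + δ) ≤ C * δ ^ (-(b + 1)) := by
  set b := max (α + 2) 0 with hb
  have hb0 : 0 ≤ b := le_max_right _ _
  have hb1 : b < 1 := max_lt (by linarith) one_pos
  obtain ⟨c, hc⟩ := (density_isEquivalent hπ).isBigO.bound
  obtain ⟨M, hM⟩ := eventually_atTop.1 (hc.and (eventually_ge_atTop 1))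
  have hM1 : 1 ≤ max M 1 := le_max_right _ _
  set N := countingFunction p (Real.exp (max M 1)) with hN
  have hN0 : 0 ≤ N := countingFunction_nonneg _
  set D := |c| + N * (max M 1) ^ 2 + 1 with hD
  have hD0 : 0 < D := by positivity
  have hdom : ∀ t, 0 < t → density p t * t ^ 2 ≤ D + D * t ^ b := by
    intro t ht
    have htb : 0 ≤ t ^ b := Real.rpow_nonneg ht.le _
    rcases le_total t (max M 1) with h | h
    · have h1 := density_le_of_le hp_top ht.le h
      have h2 : density p t * t ^ 2 ≤ N * (max M 1) ^ 2 := by gcongr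
      nlinarith [mul_nonneg hD0.le htb, abs_nonneg c]
    · obtain ⟨h1, h2⟩ := hM t ((le_max_left _ _).trans h)
      rw [Real.norm_of_nonneg (density_nonneg t), Real.norm_of_nonneg (by positivity)] at h1
      have h3 : t ^ α * t ^ 2 ≤ t ^ b := by
        rw [← Real.rpow_two, ← Real.rpow_add ht]
        exact Real.rpow_le_rpow_of_exponent_le h2 (le_max_left _ _)
      have h4 : density p t * t ^ 2 ≤ |c| * (t ^ α * t ^ 2) := by
        rw [← mul_assoc]
        gcongr
        exact h1.trans (mul_le_mul_of_nonneg_right (le_abs_self c) (by positivity))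
      have h5 := mul_le_mul_of_nonneg_left h3 (abs_nonneg c)
      have h6 : |c| * t ^ b ≤ D * t ^ b := by
        gcongr
        have : 0 ≤ N * (max M 1) ^ 2 := by positivity
        linarith
      linarith
  have hΓ : 0 < Real.Gamma (b + 1) := Real.Gamma_pos_of_pos (by linarith)
  have hI := fun u (hu : 1 < u) => integrable_exp_negLog hp_mono hp_one hp_top hπ hu
  have hZ0 : negLog p 0 ≤ 0 := neg_nonpos.2 (Real.log_nonneg hp_one)
  refine ⟨2 * (D + D * Real.Gamma (b + 1)) * Real.exp (-(2 * negLog p 0)), b, by positivity, hb0, hb1,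
    fun δ hδ hδ1 => ?_⟩
  have hu : 1 < 1 + δ := by linarith
  have hJ2 : laplace p 2 δ ≤ D * (1 / δ) + D * ((1 / δ) ^ (b + 1) * Real.Gamma (b + 1)) := by
    have i0 := (integrableOn_rpow_mul_exp (b := 0) (by norm_num) hδ).const_mul D
    have i1 := (integrableOn_rpow_mul_exp (b := b) (by linarith) hδ).const_mul D
    have e0 := integral_rpow_mul_exp (b := 0) (by norm_num) hδ
    have e1 := integral_rpow_mul_exp (b := b) (by linarith) hδ
    rw [zero_add, Real.rpow_one, Real.Gamma_one, mul_one] at e0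
    rw [← e1, ← e0, ← integral_const_mul, ← integral_const_mul, ← integral_add i0 i1]
    refine setIntegral_mono_on (integrableOn_density_mul_exp hp_top hπ 2 hδ) (i0.add i1)
      measurableSet_Ioi fun t ht => ?_
    have h := mul_le_mul_of_nonneg_right (hdom t ht) (Real.exp_pos (-(δ * t))).le
    refine h.trans (le_of_eq ?_)
    rw [Real.rpow_zero]
    ring
  have hJ1 : 0 ≤ laplace p 1 δ := setIntegral_nonneg measurableSet_Ioi fun t ht => by
    have := density_nonneg (p := p) t
    have ht : 0 < t := ht
    positivity
  have hJ20 : 0 ≤ laplace p 2 δ := setIntegral_nonneg measurableSet_Ioi fun t ht => by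
    have := density_nonneg (p := p) t
    positivity
  have hK := mgf_count_pos hI hu
  -- Here 1 + δ ≤ 2 and `negLog p 0 ≤ 0`, so this lower bound is uniform in δ.
  have hKlow : Real.exp (2 * negLog p 0) ≤ mgf (negLog p) Measure.count (1 + δ) := by
    refine le_trans (Real.exp_le_exp.2 ?_) (exp_le_mgf_count hI hu 0)
    nlinarith
  have h1 : (1 / δ) ≤ δ ^ (-(b + 1)) := by
    rw [one_div, ← Real.rpow_neg_one]
    exact Real.rpow_le_rpow_of_exponent_ge hδ hδ1 (by linarith)
  have h2 : (1 / δ) ^ (b + 1) = δ ^ (-(b + 1)) := by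
    rw [one_div, Real.inv_rpow hδ.le, Real.rpow_neg hδ.le]
  have h3 : laplace p 2 δ ≤ (D + D * Real.Gamma (b + 1)) * δ ^ (-(b + 1)) := by
    rw [h2] at hJ2
    nlinarith [mul_le_mul_of_nonneg_left h1 hD0.le]
  rw [curv_eq hI hu, integral_negLog_sq_mul_exp hp_mono hp_one hp_top hπ hu, add_sub_cancel_left]
  refine (sub_le_self _ (sq_nonneg _)).trans ?_
  rw [div_le_iff₀ hK]
  have h4 : 0 ≤ 2 * (D + D * Real.Gamma (b + 1)) * Real.exp (-(2 * negLog p 0)) * δ ^ (-(b + 1)) := by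
    positivity
  calc (1 + δ) * laplace p 2 δ - 2 * laplace p 1 δ ≤ 2 * laplace p 2 δ := by nlinarith
    _ ≤ 2 * ((D + D * Real.Gamma (b + 1)) * δ ^ (-(b + 1))) := by linarith
    _ = 2 * (D + D * Real.Gamma (b + 1)) * Real.exp (-(2 * negLog p 0)) * δ ^ (-(b + 1)) *
        Real.exp (2 * negLog p 0) := by
          rw [Real.exp_neg]
          field_simp
    _ ≤ _ := mul_le_mul_of_nonneg_left hKlow h4

/-- Apply `isEquivalent_integral_kernel` with the indicators of (T, ∞) as kernels and φ restricted
to (a, b] as comparison function. Its integral is Φ(T) - Φ(b), and the constant is negligible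
because Φ diverges. -/
theorem isEquivalent_integral_Ioi {h φ Φ : ℝ → ℝ} {a b : ℝ} (hab : a < b)
    (hφ : ∀ s ∈ Set.Ioc a b, 0 ≤ φ s) (hφc : ContinuousOn φ (Set.Ioc a b))
    (hΦ : ∀ s ∈ Set.Ioc a b, HasDerivAt Φ (-φ s) s)
    (hh : ∀ T, a < T → IntegrableOn h (Set.Ioi T)) (heq : h ~[𝓝[>] a] φ)
    (hdiv : Tendsto Φ (𝓝[>] a) atTop) :
    (fun T => ∫ s in Set.Ioi T, h s) ~[𝓝[>] a] Φ := by
  set r₀ : ℝ → ℝ := (Set.Ioc a b).indicator φ with hr₀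
  set k : ℝ → ℝ → ℝ := fun T => (Set.Ioi T).indicator fun _ => 1 with hk
  have hmul : ∀ (f : ℝ → ℝ) T, (fun s => f s * k T s) = (Set.Ioi T).indicator f := fun f T => by
    ext s
    simp only [hk, Set.indicator_apply]
    split_ifs <;> simp
  have hIoc : ∀ T, a < T → IntegrableOn φ (Set.Ioc T b) := fun T hT =>
    ((hφc.mono fun s hs => ⟨hT.trans_le hs.1, hs.2⟩).integrableOn_Icc).mono_set
      Set.Ioc_subset_Icc_self
  have hr₀T : ∀ T, a < T → IntegrableOn r₀ (Set.Ioi T) := fun T hT => by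
    rw [hr₀, integrableOn_indicator_iff measurableSet_Ioc]
    exact (hIoc T hT).mono_set fun s hs => ⟨hs.2, hs.1.2⟩
  have hset : ∀ (f : ℝ → ℝ) T, a < T →
      ∫ s in Set.Ioi a, f s * k T s = ∫ s in Set.Ioi T, f s := fun f T hT => by
    rw [hmul, setIntegral_indicator measurableSet_Ioi, Set.Ioi_inter_Ioi, max_eq_right hT.le]
  have hr₀int : ∀ T, a < T → T ≤ b → ∫ s in Set.Ioi T, r₀ s = Φ T - Φ b := fun T hT hTb => by
    have hs : Set.Ioi T ∩ Set.Ioc a b = Set.Ioc T b := by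
      ext s
      constructor
      · exact fun hs => ⟨hs.1, hs.2.2⟩
      · exact fun hs => ⟨hs.1, hT.trans hs.1, hs.2⟩
    rw [hr₀, setIntegral_indicator measurableSet_Ioc, hs, ← intervalIntegral.integral_of_le hTb]
    have := intervalIntegral.integral_eq_sub_of_hasDerivAt (f := Φ) (f' := fun s => -φ s)
      (a := T) (b := b) (fun s hs => hΦ s (by
        rw [Set.uIcc_of_le hTb] at hs
        exact ⟨hT.trans_le hs.1, hs.2⟩))
      ((intervalIntegrable_iff_integrableOn_Ioc_of_le hTb).2 (hIoc T hT).neg)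
    rw [intervalIntegral.integral_neg] at this
    linarith
  have hev : ∀ᶠ T in 𝓝[>] a, a < T ∧ T ≤ b := by
    filter_upwards [self_mem_nhdsWithin, mem_nhdsWithin_of_mem_nhds (Iio_mem_nhds hab)] with T h1 h2
    exact ⟨h1, le_of_lt h2⟩
  have hdiv' : Tendsto (fun T => ∫ s in Set.Ioi a, r₀ s * k T s) (𝓝[>] a) atTop := by
    refine (tendsto_atTop_add_const_right _ (-Φ b) hdiv).congr' ?_
    filter_upwards [hev] with T hT
    rw [hset r₀ T hT.1, hr₀int T hT.1 hT.2, sub_eq_add_neg]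
  have main := isEquivalent_integral_kernel (l := 𝓝[>] a) (ν := volume.restrict (Set.Ioi a))
    (r := h) (r₀ := r₀) (k := k) ?_ ?_ ?_ ?_ ?_ hdiv'
  · have e1 : (fun T => ∫ s in Set.Ioi a, h s * k T s) =ᶠ[𝓝[>] a] fun T => ∫ s in Set.Ioi T, h s := by
      filter_upwards [hev] with T hT
      exact hset h T hT.1
    have e2 : (fun T => ∫ s in Set.Ioi a, r₀ s * k T s) =ᶠ[𝓝[>] a] fun T => Φ T - Φ b := by
      filter_upwards [hev] with T hT
      rw [hset r₀ T hT.1, hr₀int T hT.1 hT.2]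
    refine ((main.congr_left e1).congr_right e2).trans ?_
    refine IsEquivalent.sub_isLittleO IsEquivalent.refl ?_
    exact isLittleO_const_left.2 (Or.inr (tendsto_norm_atTop_atTop.comp hdiv))
  · exact ae_of_all _ fun s => Set.indicator_nonneg hφ s
  · refine Eventually.of_forall fun T => ae_of_all _ fun s => ?_
    simp only [hk, Set.indicator_apply]
    split_ifs <;> simp
  · intro ε hε
    have h1 := isLittleO_iff.1 heq.isLittleO hε
    obtain ⟨c, hac, hc⟩ := mem_nhdsGT_iff_exists_Ioc_subset.1 (h1.and hev)
    have hac : a < c := hac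
    refine ⟨Set.Ioi c, measurableSet_Ioi, (hh c hac).mono_measure Measure.restrict_le_self,
      (hr₀T c hac).mono_measure Measure.restrict_le_self, ?_⟩
    refine (ae_restrict_iff' measurableSet_Ioi).2 (ae_of_all _ fun s hs hsA => ?_)
    have hsc : s ≤ c := not_lt.1 hsA
    obtain ⟨h2, -, h3⟩ := hc ⟨hs, hsc⟩
    have hm : s ∈ Set.Ioc a b := ⟨hs, h3⟩
    rw [hr₀, Set.indicator_of_mem hm]
    rwa [Real.norm_eq_abs, Real.norm_of_nonneg (hφ s hm), Pi.sub_apply] at h2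
  · filter_upwards [hev] with T hT
    rw [hmul, integrable_indicator_iff measurableSet_Ioi]
    exact (hh T hT.1).mono_measure Measure.restrict_le_self
  · filter_upwards [hev] with T hT
    rw [hmul, integrable_indicator_iff measurableSet_Ioi]
    exact (hr₀T T hT.1).mono_measure Measure.restrict_le_self

end RandomDirichlet

/-! ### The integral of √g(2s) as T → 1/2⁺, in the three ranges of α. -/

namespace RandomDirichlet

variable {p : ℕ → ℝ}

theorem tendsto_two_mul_sub_nhdsGT :
    Tendsto (fun s : ℝ => 2 * (s - 1 / 2)) (𝓝[>] (1 / 2)) (𝓝[>] 0) := by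
  refine tendsto_nhdsWithin_iff.2 ⟨?_, ?_⟩
  · exact (Continuous.tendsto' (by fun_prop) _ _ (by norm_num)).mono_left nhdsWithin_le_nhds
  · filter_upwards [self_mem_nhdsWithin] with s hs
    have : 1 / 2 < s := hs
    simp only [Set.mem_Ioi]
    linarith

theorem tendsto_sub_nhdsGT : Tendsto (fun s : ℝ => s - 1 / 2) (𝓝[>] (1 / 2)) (𝓝[>] 0) := by
  refine tendsto_nhdsWithin_iff.2 ⟨?_, ?_⟩
  · exact (Continuous.tendsto' (by fun_prop) _ _ (by norm_num)).mono_left nhdsWithin_le_nhds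
  · filter_upwards [self_mem_nhdsWithin] with s hs
    exact sub_pos.2 (Set.mem_Ioi.1 hs)

theorem tendsto_log_one_div_sub :
    Tendsto (fun s : ℝ => Real.log (1 / (s - 1 / 2))) (𝓝[>] (1 / 2)) atTop :=
  tendsto_log_one_div_nhdsGT_zero.comp tendsto_sub_nhdsGT

theorem hasDerivAt_log_one_div_sub {s : ℝ} (hs : 1 / 2 < s) :
    HasDerivAt (fun s : ℝ => Real.log (1 / (s - 1 / 2))) (-(s - 1 / 2)⁻¹) s := by
  have h0 : s - 1 / 2 ≠ 0 := (sub_pos.2 hs).ne'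
  have h := (((hasDerivAt_id s).sub_const (1 / 2)).log h0).neg
  simp only [id, one_div (s - 1 / 2)] at h
  refine (h.congr_of_eventuallyEq (Eventually.of_forall fun x => ?_))
  simp [Real.log_inv]

theorem integral_sqrt_curv_isEquivalent_log (hp_mono : StrictMono p) (hp_one : 1 ≤ p 0)
    (hp_top : Tendsto p atTop atTop) {α : ℝ} (hα : -1 < α)
    (hπ : countingFunction p ~[atTop] fun x : ℝ => x * Real.log x ^ α) :
    (fun T => ∫ s in Set.Ioi T, Real.sqrt (curv (negLog p) (2 * s))) ~[𝓝[>] (1 / 2)]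
      fun T => Real.sqrt (1 + α) / 2 * Real.log (1 / (T - 1 / 2)) := by
  have hI := fun u (hu : 1 < u) => integrable_exp_negLog hp_mono hp_one hp_top hπ hu
  have hs : 0 < Real.sqrt (1 + α) := Real.sqrt_pos.2 (by linarith)
  refine isEquivalent_integral_Ioi (b := 1) (φ := fun s => Real.sqrt (1 + α) / 2 * (s - 1 / 2)⁻¹)
    (by norm_num) ?_ ?_ ?_ ?_ ?_ ?_
  · intro s hs
    have := sub_pos.2 hs.1
    positivity
  · refine continuousOn_const.mul (ContinuousOn.inv₀ (by fun_prop) fun s hs => ?_)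
    exact (sub_pos.2 hs.1).ne'
  · intro s hs
    rw [← mul_neg]
    exact (hasDerivAt_log_one_div_sub hs.1).const_mul _
  · exact fun T hT => integrableOn_sqrt_curv (strictAnti_negLog hp_mono hp_one) hI hT
  · refine (isEquivalent_iff_tendsto_one ?_).2 ?_
    · filter_upwards [self_mem_nhdsWithin] with s hs'
      have : 0 < s - 1 / 2 := sub_pos.2 hs'
      positivity
    · have h := ((Real.continuous_sqrt.tendsto _).comp
        ((tendsto_sq_mul_curv hp_mono hp_one hp_top hα hπ).comp
          tendsto_two_mul_sub_nhdsGT)).div_const (Real.sqrt (1 + α))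
      rw [div_self hs.ne'] at h
      refine h.congr' ?_
      filter_upwards [self_mem_nhdsWithin] with s hs'
      have hx : 0 < s - 1 / 2 := sub_pos.2 hs'
      simp only [Function.comp, Pi.div_apply]
      rw [Real.sqrt_mul (sq_nonneg _), Real.sqrt_sq (by linarith),
        show 1 + 2 * (s - 1 / 2) = 2 * s by ring]
      field_simp
  · exact tendsto_log_one_div_sub.const_mul_atTop (by positivity)

theorem integral_sqrt_curv_isEquivalent_sqrt_log (hp_mono : StrictMono p) (hp_one : 1 ≤ p 0)
    (hp_top : Tendsto p atTop atTop)
    (hπ : countingFunction p ~[atTop] fun x : ℝ => x * Real.log x ^ (-1 : ℝ)) :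
    (fun T => ∫ s in Set.Ioi T, Real.sqrt (curv (negLog p) (2 * s))) ~[𝓝[>] (1 / 2)]
      fun T => Real.sqrt (Real.log (1 / (T - 1 / 2))) := by
  have hI := fun u (hu : 1 < u) => integrable_exp_negLog hp_mono hp_one hp_top hπ hu
  have hlogpos : ∀ s ∈ Set.Ioc (1 / 2 : ℝ) (3 / 4), 0 < Real.log (1 / (s - 1 / 2)) := fun s hs => by
    have : 0 < s - 1 / 2 := sub_pos.2 hs.1
    refine Real.log_pos ?_
    rw [lt_div_iff₀ this]
    linarith [hs.2]
  refine isEquivalent_integral_Ioi (b := 3 / 4)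
    (φ := fun s => (s - 1 / 2)⁻¹ / (2 * Real.sqrt (Real.log (1 / (s - 1 / 2)))))
    (by norm_num) ?_ ?_ ?_ ?_ ?_ ?_
  · intro s hs
    have := sub_pos.2 hs.1
    positivity
  · refine ContinuousOn.div (ContinuousOn.inv₀ (by fun_prop) fun s hs => (sub_pos.2 hs.1).ne') ?_ ?_
    · refine continuousOn_const.mul (Real.continuous_sqrt.comp_continuousOn fun s hs => ?_)
      exact (hasDerivAt_log_one_div_sub hs.1).continuousAt.continuousWithinAt
    · intro s hs
      have := Real.sqrt_pos.2 (hlogpos s hs)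
      positivity
  · intro s hs
    have := (hasDerivAt_log_one_div_sub hs.1).sqrt (hlogpos s hs).ne'
    rwa [neg_div] at this
  · exact fun T hT => integrableOn_sqrt_curv (strictAnti_negLog hp_mono hp_one) hI hT
  · have hev : ∀ᶠ s : ℝ in 𝓝[>] (1 / 2), s ∈ Set.Ioo (1 / 2) (5 / 8) :=
      Ioo_mem_nhdsGT (by norm_num)
    refine (isEquivalent_iff_tendsto_one ?_).2 ?_
    · filter_upwards [hev] with s hs
      have h1 : 0 < s - 1 / 2 := sub_pos.2 hs.1
      have h2 := Real.sqrt_pos.2 (hlogpos s ⟨hs.1, by linarith [hs.2]⟩)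
      positivity
    -- The curvature asymptotics are in δ = 2(s - 1/2); the factor 2 shifts the logarithm by log 2,
    -- which disappears in the ratio.
    · have hratio : Tendsto (fun s : ℝ => Real.log (1 / (s - 1 / 2)) /
          Real.log (1 / (2 * (s - 1 / 2)))) (𝓝[>] (1 / 2)) (𝓝 1) := by
        have hb := tendsto_log_one_div_nhdsGT_zero.comp tendsto_two_mul_sub_nhdsGT
        have h := (tendsto_inv_atTop_zero.comp hb).const_mul (Real.log 2)
        have h' := h.const_add 1
        rw [mul_zero, add_zero] at h'
        refine h'.congr' ?_
        filter_upwards [hev, hb.eventually_gt_atTop 0] with s hs hpos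
        have h1 : 0 < s - 1 / 2 := sub_pos.2 hs.1
        simp only [Function.comp] at hpos ⊢
        have e : Real.log (1 / (s - 1 / 2)) = Real.log 2 + Real.log (1 / (2 * (s - 1 / 2))) := by
          rw [← Real.log_mul (by norm_num) (by positivity)]
          congr 1
          field_simp
        rw [e]
        generalize Real.log (1 / (2 * (s - 1 / 2))) = l at hpos
        field_simp
        ring
      have h := (Real.continuous_sqrt.tendsto _).comp
        (((tendsto_sq_mul_log_mul_curv hp_mono hp_one hp_top hπ).comp
          tendsto_two_mul_sub_nhdsGT).mul hratio)
      rw [mul_one, Real.sqrt_one] at h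
      refine h.congr' ?_
      filter_upwards [hev] with s hs
      have hx : 0 < s - 1 / 2 := sub_pos.2 hs.1
      have hl1 := hlogpos s ⟨hs.1, by linarith [hs.2]⟩
      have hl2 : 0 < Real.log (1 / (2 * (s - 1 / 2))) := by
        refine Real.log_pos ?_
        rw [lt_div_iff₀ (by positivity)]
        linarith [hs.2]
      simp only [Function.comp, Pi.div_apply]
      rw [show 1 + 2 * (s - 1 / 2) = 2 * s by ring]
      generalize curv (negLog p) (2 * s) = g
      have e : (2 * (s - 1 / 2)) ^ 2 * Real.log (1 / (2 * (s - 1 / 2))) * g *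
          (Real.log (1 / (s - 1 / 2)) / Real.log (1 / (2 * (s - 1 / 2)))) =
          (2 * (s - 1 / 2)) ^ 2 * (Real.log (1 / (s - 1 / 2)) * g) := by
        generalize Real.log (1 / (2 * (s - 1 / 2))) = l at hl2
        generalize Real.log (1 / (s - 1 / 2)) = l'
        generalize 2 * (s - 1 / 2) = x
        field_simp
      rw [e, Real.sqrt_mul (sq_nonneg _), Real.sqrt_sq (by linarith), Real.sqrt_mul hl1.le]
      have := Real.sqrt_pos.2 hl1
      field_simp
  · exact Real.tendsto_sqrt_atTop.comp tendsto_log_one_div_sub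

/-- On (1/2, 1] the bound `exists_curv_le_rpow` gives an integrable power with exponent -(b + 1)/2 >
-1; beyond 1 the exponential decay applies. -/
theorem integrableOn_sqrt_curv_of_lt (hp_mono : StrictMono p) (hp_one : 1 ≤ p 0)
    (hp_top : Tendsto p atTop atTop) {α : ℝ} (hα : α < -1)
    (hπ : countingFunction p ~[atTop] fun x : ℝ => x * Real.log x ^ α) :
    IntegrableOn (fun s => Real.sqrt (curv (negLog p) (2 * s))) (Set.Ioi (1 / 2)) := by
  have hI := fun u (hu : 1 < u) => integrable_exp_negLog hp_mono hp_one hp_top hπ hu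
  obtain ⟨C, b, hC, hb0, hb1, hle⟩ := exists_curv_le_rpow hp_mono hp_one hp_top hα hπ
  rw [← Set.Ioc_union_Ioi_eq_Ioi (show (1 / 2 : ℝ) ≤ 1 by norm_num)]
  refine IntegrableOn.union ?_
    (integrableOn_sqrt_curv (strictAnti_negLog hp_mono hp_one) hI (by norm_num))
  have hint : IntegrableOn (fun s : ℝ => Real.sqrt C * (2 * (s - 1 / 2)) ^ (-((b + 1) / 2)))
      (Set.Ioc (1 / 2) 1) := by
    refine (intervalIntegrable_iff_integrableOn_Ioc_of_le (by norm_num)).1 ?_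
    have h := intervalIntegral.intervalIntegrable_rpow' (a := 0) (b := 1) (r := -((b + 1) / 2))
      (by linarith)
    have h2 := (h.comp_mul_left (c := 2)).comp_sub_right (1 / 2)
    norm_num at h2
    refine IntervalIntegrable.const_mul ?_ _
    convert h2 using 2
  refine Integrable.mono' hint (((continuousOn_sqrt_curv hI).mono
    Set.Ioc_subset_Ioi_self).aestronglyMeasurable measurableSet_Ioc) ?_
  refine (ae_restrict_iff' measurableSet_Ioc).2 (ae_of_all _ fun s hs => ?_)
  have hx : 0 < 2 * (s - 1 / 2) := by linarith [hs.1]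
  rw [Real.norm_of_nonneg (Real.sqrt_nonneg _)]
  have h1 := hle _ hx (by linarith [hs.2])
  rw [show 1 + 2 * (s - 1 / 2) = 2 * s by ring] at h1
  refine (Real.sqrt_le_sqrt h1).trans (le_of_eq ?_)
  rw [Real.sqrt_mul hC.le, Real.sqrt_eq_rpow (_ ^ _), ← Real.rpow_mul hx.le]
  congr 2
  ring

theorem tendsto_integral_sqrt_curv_of_lt (hp_mono : StrictMono p) (hp_one : 1 ≤ p 0)
    (hp_top : Tendsto p atTop atTop) {α : ℝ} (hα : α < -1)
    (hπ : countingFunction p ~[atTop] fun x : ℝ => x * Real.log x ^ α) :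
    Tendsto (fun T => ∫ s in Set.Ioi T, Real.sqrt (curv (negLog p) (2 * s))) (𝓝[>] (1 / 2))
      (𝓝 (∫ s in Set.Ioi (1 / 2), Real.sqrt (curv (negLog p) (2 * s)))) := by
  have hI := integrableOn_sqrt_curv_of_lt hp_mono hp_one hp_top hα hπ
  set h := fun s => Real.sqrt (curv (negLog p) (2 * s)) with hh
  have hlim : Tendsto (fun T => ∫ s in Set.Ioi (1 / 2), (Set.Ioi T).indicator h s) (𝓝[>] (1 / 2))
      (𝓝 (∫ s in Set.Ioi (1 / 2), h s)) := by
    refine tendsto_integral_filter_of_dominated_convergence h ?_ ?_ hI ?_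
    · exact Eventually.of_forall fun T => hI.aestronglyMeasurable.indicator measurableSet_Ioi
    · refine Eventually.of_forall fun T => ae_of_all _ fun s => ?_
      rw [Real.norm_of_nonneg (Set.indicator_nonneg (fun _ _ => Real.sqrt_nonneg _) s)]
      exact Set.indicator_le_self' (fun _ _ => Real.sqrt_nonneg _) s
    · refine (ae_restrict_iff' measurableSet_Ioi).2 (ae_of_all _ fun s hs => ?_)
      refine tendsto_const_nhds.congr' ?_
      filter_upwards [mem_nhdsWithin_of_mem_nhds (Iio_mem_nhds hs)] with T hT
      rw [Set.indicator_of_mem (Set.mem_Ioi.2 hT)]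
  refine hlim.congr' ?_
  filter_upwards [self_mem_nhdsWithin] with T hT
  rw [setIntegral_indicator measurableSet_Ioi, Set.Ioi_inter_Ioi, max_eq_right (le_of_lt hT)]

theorem integral_sqrt_curv_pos (hp_mono : StrictMono p) (hp_one : 1 ≤ p 0)
    (hp_top : Tendsto p atTop atTop) {α : ℝ} (hα : α < -1)
    (hπ : countingFunction p ~[atTop] fun x : ℝ => x * Real.log x ^ α) :
    0 < ∫ s in Set.Ioi (1 / 2), Real.sqrt (curv (negLog p) (2 * s)) := by
  have hI := fun u (hu : 1 < u) => integrable_exp_negLog hp_mono hp_one hp_top hπ hu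
  rw [setIntegral_pos_iff_support_of_nonneg_ae (ae_of_all _ fun s => Real.sqrt_nonneg _)
    (integrableOn_sqrt_curv_of_lt hp_mono hp_one hp_top hα hπ)]
  have hsub : Set.Ioi (1 / 2 : ℝ) ⊆
      Function.support (fun s => Real.sqrt (curv (negLog p) (2 * s))) ∩ Set.Ioi (1 / 2) := by
    intro s hs
    have h1 : (1 : ℝ) < 2 * s := by linarith [Set.mem_Ioi.1 hs]
    exact ⟨(Real.sqrt_pos.2 (curv_pos (strictAnti_negLog hp_mono hp_one) hI h1)).ne', hs⟩
  refine lt_of_lt_of_le ?_ (measure_mono hsub)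
  simp

end RandomDirichlet

/-! ### Zeros of a continuous function and its sign changes on grids. -/

namespace RandomDirichlet

/-- The number of sign changes of `F` between consecutive points of a grid. -/
noncomputable def signChanges (F : ℝ → ℝ) (T : ℝ) (m : ℕ) : ℝ≥0∞ :=
  ∑' i, {i | F (grid T m i) * F (grid T m (i + 1)) < 0}.indicator (fun _ => (1 : ℝ≥0∞)) i

theorem signChanges_eq_encard (F : ℝ → ℝ) (T : ℝ) (m : ℕ) :
    signChanges F T m = ({i | F (grid T m i) * F (grid T m (i + 1)) < 0}.encard : ℝ≥0∞) := by
  rw [signChanges, ← tsum_subtype, ENNReal.tsum_set_one]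

theorem exists_zero_of_mul_neg {F : ℝ → ℝ} {a b : ℝ} (hab : a < b)
    (hF : ContinuousOn F (Set.Icc a b)) (h : F a * F b < 0) : ∃ z ∈ Set.Ioo a b, F z = 0 := by
  rcases mul_neg_iff.1 h with ⟨h1, h2⟩ | ⟨h1, h2⟩
  · exact intermediate_value_Ioo' hab.le hF ⟨h2, h1⟩
  · exact intermediate_value_Ioo hab.le hF ⟨h1, h2⟩

/-- The intermediate value theorem puts a zero in each open cell with a sign change; the cells are
disjoint, so these zeros are distinct. -/
theorem signChanges_le_encard {F : ℝ → ℝ} {T : ℝ} (hF : ContinuousOn F (Set.Ici T)) (m : ℕ) :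
    signChanges F T m ≤ ({σ | T ≤ σ ∧ F σ = 0}.encard : ℝ≥0∞) := by
  rw [signChanges_eq_encard, ENat.toENNReal_le]
  have hz : ∀ i, ∃ z, F (grid T m i) * F (grid T m (i + 1)) < 0 →
      z ∈ Set.Ioo (grid T m i) (grid T m (i + 1)) ∧ F z = 0 := by
    intro i
    by_cases h : F (grid T m i) * F (grid T m (i + 1)) < 0
    · obtain ⟨z, hz, hz0⟩ := exists_zero_of_mul_neg (grid_strictMono T m (Nat.lt_succ_self i))
        (hF.mono fun x hx => (le_grid T m i).trans hx.1) h
      exact ⟨z, fun _ => ⟨hz, hz0⟩⟩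
    · exact ⟨0, fun h' => absurd h' h⟩
  choose z hz using hz
  refine Set.encard_le_encard_of_injOn (f := z) (fun i hi => ?_) (fun i hi j hj hij => ?_)
  · exact ⟨(le_grid T m i).trans (hz i hi).1.1.le, (hz i hi).2⟩
  · rw [← floor_eq_of_mem_Ico_grid (Set.Ioo_subset_Ico_self (hz i hi).1),
      ← floor_eq_of_mem_Ico_grid (Set.Ioo_subset_Ico_self (hz j hj).1), hij]

/-- If the last step keeps the sign, the opposite signs already occur over a shorter range.
Nonvanishing excludes a sign change passing through 0. -/
theorem exists_consecutive_mul_neg {f : ℕ → ℝ} (hf : ∀ i, f i ≠ 0) {a b : ℕ} (hab : a ≤ b)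
    (h : f a * f b < 0) : ∃ i, a ≤ i ∧ i < b ∧ f i * f (i + 1) < 0 := by
  induction b, hab using Nat.le_induction with
  | base => exact absurd h (not_lt.2 (mul_self_nonneg _))
  | succ b hab ih =>
    by_cases hb : f b * f (b + 1) < 0
    · exact ⟨b, hab, Nat.lt_succ_self b, hb⟩
    · have hb' : 0 < f b * f (b + 1) :=
        lt_of_le_of_ne (not_lt.1 hb) (mul_ne_zero (hf b) (hf (b + 1))).symm
      have hab' : f a * f b < 0 := by
        have h1 : (f a * f b) * (f (b + 1)) ^ 2 < 0 := by nlinarith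
        by_contra! h2
        have := mul_nonneg h2 (sq_nonneg (f (b + 1)))
        linarith
      obtain ⟨i, h1, h2, h3⟩ := ih hab'
      exact ⟨i, h1, h2.trans (Nat.lt_succ_self b), h3⟩

theorem tendsto_grid_floor {T x : ℝ} (hx : T ≤ x) :
    Tendsto (fun m : ℕ => grid T m ⌊(x - T) * (m + 1)⌋₊) atTop (𝓝 x) := by
  have hlow : Tendsto (fun m : ℕ => x - 1 / ((m : ℝ) + 1)) atTop (𝓝 x) := by
    simpa using (tendsto_one_div_add_atTop_nhds_zero_nat (𝕜 := ℝ)).const_sub x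
  refine tendsto_of_tendsto_of_tendsto_of_le_of_le hlow tendsto_const_nhds (fun m => ?_)
    (fun m => grid_floor_le m hx)
  have := lt_grid_floor_succ T x m
  rw [grid_succ] at this
  simp only
  linarith

theorem eventually_exists_sign_change {F : ℝ → ℝ} {T : ℝ} (hF : ContinuousOn F (Set.Ici T))
    (hgrid : ∀ m i, F (grid T m i) ≠ 0) {z r x y : ℝ} (hx : T < x) (hy : T < y)
    (hxz : |x - z| < r) (hyz : |y - z| < r) (hFx : F x < 0) (hFy : 0 < F y) :
    ∀ᶠ m in atTop, ∃ i, F (grid T m i) * F (grid T m (i + 1)) < 0 ∧ |grid T m i - z| < r := by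
  have hcont : ∀ x, T < x → ContinuousAt F x := fun x hx =>
    hF.continuousAt (Ici_mem_nhds hx)
  have hball : ∀ x, |x - z| < r → ∀ᶠ w in 𝓝 x, |w - z| < r := fun x h =>
    (Continuous.tendsto (by fun_prop) x).eventually_lt_const h
  have ex := (tendsto_grid_floor hx.le).eventually
    (((hcont x hx).eventually_lt_const hFx).and (hball x hxz))
  have ey := (tendsto_grid_floor hy.le).eventually
    (((hcont y hy).eventually_const_lt hFy).and (hball y hyz))
  filter_upwards [ex, ey] with m hmx hmy
  have hmono := (grid_strictMono T m).monotone
  rcases le_total ⌊(x - T) * (m + 1)⌋₊ ⌊(y - T) * (m + 1)⌋₊ with h | h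
  · obtain ⟨i, h1, h2, h3⟩ := exists_consecutive_mul_neg (hgrid m) h
      (mul_neg_of_neg_of_pos hmx.1 hmy.1)
    refine ⟨i, h3, abs_lt.2 ⟨?_, ?_⟩⟩
    · linarith [(abs_lt.1 hmx.2).1, hmono h1]
    · linarith [(abs_lt.1 hmy.2).2, hmono h2.le]
  · obtain ⟨i, h1, h2, h3⟩ := exists_consecutive_mul_neg (hgrid m) h
      (mul_neg_of_pos_of_neg hmy.1 hmx.1)
    refine ⟨i, h3, abs_lt.2 ⟨?_, ?_⟩⟩
    · linarith [(abs_lt.1 hmy.2).1, hmono h1]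
    · linarith [(abs_lt.1 hmx.2).2, hmono h2.le]

/-- Take finitely many zeros, pairwise more than 2r apart. On every fine grid each has a sign change
at a cell whose left endpoint is within r, and by separation these cells differ. Infinitely many
zeros are covered by taking the supremum over finite subsets. -/
theorem encard_le_liminf_signChanges {F : ℝ → ℝ} {T : ℝ} (hF : ContinuousOn F (Set.Ici T))
    (hgrid : ∀ m i, F (grid T m i) ≠ 0)
    (hz : ∀ z, T < z → F z = 0 → ∀ r, 0 < r →
      ∃ x y, T < x ∧ T < y ∧ |x - z| < r ∧ |y - z| < r ∧ F x < 0 ∧ 0 < F y) :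
    ({σ | T ≤ σ ∧ F σ = 0}.encard : ℝ≥0∞) ≤ liminf (signChanges F T) atTop := by
  rw [← ENNReal.tsum_set_one, ENNReal.tsum_eq_iSup_sum]
  refine iSup_le fun A => le_liminf_of_le (by isBoundedDefault) ?_
  obtain ⟨r, hr, hsep⟩ : ∃ r : ℝ, 0 < r ∧ ∀ z ∈ A, ∀ w ∈ A, z ≠ w → 2 * r < |(z : ℝ) - w| := by
    have : ∀ᶠ r : ℝ in 𝓝[>] 0, ∀ z ∈ A, ∀ w ∈ A, z ≠ w → 2 * r < |(z : ℝ) - w| := by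
      refine (A.eventually_all).2 fun z _ => (A.eventually_all).2 fun w _ => ?_
      by_cases hzw : z = w
      · exact Eventually.of_forall fun _ h => absurd hzw h
      · have h0 : 0 < |(z : ℝ) - w| := abs_pos.2 (sub_ne_zero.2 fun h => hzw (Subtype.ext h))
        have ht : Tendsto (fun r : ℝ => 2 * r) (𝓝[>] 0) (𝓝 0) :=
          (Continuous.tendsto' (by fun_prop) _ _ (by simp)).mono_left nhdsWithin_le_nhds
        exact (ht.eventually_lt_const h0).mono fun r hr _ => hr
    obtain ⟨r, h1, h2⟩ := (this.and self_mem_nhdsWithin).exists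
    exact ⟨r, h2, h1⟩
  have hev : ∀ᶠ m in atTop, ∀ z ∈ A, ∃ i,
      F (grid T m i) * F (grid T m (i + 1)) < 0 ∧ |grid T m i - (z : ℝ)| < r := by
    refine (A.eventually_all).2 fun z _ => ?_
    -- T itself is a grid point, hence not a zero.
    have hT : T < z := by
      refine lt_of_le_of_ne z.2.1 fun h => hgrid 0 0 ?_
      rw [grid_zero, h]
      exact z.2.2
    obtain ⟨x, y, hx, hy, hxz, hyz, hFx, hFy⟩ := hz z hT z.2.2 r hr
    exact eventually_exists_sign_change hF hgrid hx hy hxz hyz hFx hFy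
  filter_upwards [hev] with m hm
  choose! i hi using hm
  rw [signChanges_eq_encard, Finset.sum_const, nsmul_one]
  have h1 : (A : Set {σ | T ≤ σ ∧ F σ = 0}).encard ≤
      {i | F (grid T m i) * F (grid T m (i + 1)) < 0}.encard := by
    refine Set.encard_le_encard_of_injOn (f := i) (fun z hzA => (hi z hzA).1)
      (fun z hzA w hwA hzw => ?_)
    by_contra hne
    have h2 := hsep z hzA w hwA hne
    have h3 := (hi z hzA).2
    have h4 := (hi w hwA).2
    rw [hzw] at h3
    have h5 := abs_sub_le (z : ℝ) (grid T m (i w)) w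
    rw [abs_sub_comm (z : ℝ) (grid T m (i w))] at h5
    linarith
  rw [Set.encard_coe_eq_coe_finsetCard] at h1
  have := ENat.toENNReal_le.2 h1
  simpa using this

end RandomDirichlet

/-! ### Linear series in independent standard Gaussians. -/

namespace RandomDirichlet

/-- The law of a sequence of independent standard Gaussian random variables. -/
noncomputable abbrev gaussianSeq : Measure (ℕ → ℝ) :=
  Measure.infinitePi fun _ : ℕ => gaussianReal 0 1

theorem iIndepFun_eval : iIndepFun (fun (n : ℕ) (x : ℕ → ℝ) => x n) gaussianSeq :=
  iIndepFun_infinitePi (X := fun _ y => y) fun _ => measurable_id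

theorem map_eval_gaussianSeq (n : ℕ) : gaussianSeq.map (fun x => x n) = gaussianReal 0 1 :=
  Measure.infinitePi_map_eval (fun _ : ℕ => gaussianReal 0 1) n

theorem map_sum_mul_gaussianSeq (c : ℕ → ℝ) (n : ℕ) :
    gaussianSeq.map (fun x => ∑ k ∈ Finset.range n, c k * x k) =
      gaussianReal 0 (∑ k ∈ Finset.range n, c k ^ 2).toNNReal := by
  induction n with
  | zero => simp [Measure.map_const]
  | succ n ih =>
    have hterm : gaussianSeq.map (fun x => c n * x n) = gaussianReal 0 (c n ^ 2).toNNReal := by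
      have h := Measure.map_map (μ := gaussianSeq) (f := fun x : ℕ → ℝ => x n)
        (g := fun y => c n * y) (by fun_prop) (by fun_prop)
      rw [map_eval_gaussianSeq, gaussianReal_map_const_mul, mul_zero, mul_one] at h
      have hc : (NNReal.mk (c n ^ 2) (sq_nonneg _)) = (c n ^ 2).toNNReal :=
        (Real.toNNReal_of_nonneg (sq_nonneg _)).symm
      rw [hc] at h
      exact h.symm
    have hind : IndepFun (fun x : ℕ → ℝ => ∑ k ∈ Finset.range n, c k * x k)
        (fun x => c n * x n) gaussianSeq := by
      have h := (iIndepFun_eval.comp (fun k y => c k * y) fun k => by fun_prop)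
      have h2 := h.indepFun_finsetSum_of_notMem (fun k => by fun_prop) (Finset.notMem_range_self (n := n))
      convert h2 using 1
      · ext x
        simp [Finset.sum_apply]
      · rfl
    have h := gaussianReal_add_gaussianReal_of_indepFun hind ih hterm
    rw [add_zero, ← Real.toNNReal_add (Finset.sum_nonneg fun k _ => sq_nonneg _) (sq_nonneg _),
      ← Finset.sum_range_succ] at h
    rw [← h]
    congr 1
    ext x
    simp [Finset.sum_range_succ]

/-- The crude bound |y| ≤ 1 + y² suffices: only an L¹ bound uniform in n is needed, for martingale
convergence. -/
theorem lintegral_enorm_sum_mul_le (c : ℕ → ℝ) (n : ℕ) :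
    ∫⁻ x, ‖∑ k ∈ Finset.range n, c k * x k‖ₑ ∂gaussianSeq ≤
      ENNReal.ofReal (1 + ∑ k ∈ Finset.range n, c k ^ 2) := by
  set V := ∑ k ∈ Finset.range n, c k ^ 2 with hV
  have hV0 : 0 ≤ V := Finset.sum_nonneg fun k _ => sq_nonneg _
  have h1 : ∫⁻ x, ‖∑ k ∈ Finset.range n, c k * x k‖ₑ ∂gaussianSeq =
      ∫⁻ y, ‖y‖ₑ ∂gaussianReal 0 V.toNNReal := by
    rw [hV, ← map_sum_mul_gaussianSeq, lintegral_map (by fun_prop) (by fun_prop)]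
  have hint : Integrable (fun y : ℝ => y ^ 2) (gaussianReal 0 V.toNNReal) :=
    (memLp_id_gaussianReal 2).integrable_sq
  have h2 : ∫ y, (1 + y ^ 2) ∂gaussianReal 0 V.toNNReal = 1 + V := by
    rw [integral_add (integrable_const _) hint]
    have hv := variance_id_gaussianReal (μ := 0) (v := V.toNNReal)
    rw [variance_eq_integral aemeasurable_id] at hv
    simp only [id, integral_id_gaussianReal, sub_zero, Real.coe_toNNReal _ hV0] at hv
    rw [hv]
    simp
  have hint' : Integrable (fun y : ℝ => 1 + y ^ 2) (gaussianReal 0 V.toNNReal) :=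
    (integrable_const 1).add hint
  rw [h1, ← h2, ofReal_integral_eq_lintegral_ofReal hint'
    (ae_of_all _ fun y => by positivity)]
  refine lintegral_mono fun y => ?_
  rw [← ofReal_norm]
  refine ENNReal.ofReal_le_ofReal ?_
  rw [Real.norm_eq_abs]
  nlinarith [sq_abs y, sq_nonneg (|y| - 1)]

/-- The partial sums form a martingale for the natural filtration, bounded in L¹. -/
theorem ae_exists_tendsto_sum_mul {c : ℕ → ℝ} (hc : Summable fun k => c k ^ 2) :
    ∀ᵐ x ∂gaussianSeq, ∃ l, Tendsto (fun n => ∑ k ∈ Finset.range n, c k * x k) atTop (𝓝 l) := by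
  have hsm : ∀ k, StronglyMeasurable fun x : ℕ → ℝ => x k := fun k =>
    (measurable_pi_apply k).stronglyMeasurable
  set ℱ := Filtration.natural (fun (k : ℕ) (x : ℕ → ℝ) => x k) hsm
  -- The shift to n + 1 terms makes M n adapted to the σ-algebra of coordinates 0, …, n.
  set M : ℕ → (ℕ → ℝ) → ℝ := fun n x => ∑ k ∈ Finset.range (n + 1), c k * x k with hM
  have hadk : ∀ k n, k ≤ n → StronglyMeasurable[ℱ n] fun x : ℕ → ℝ => x k := fun k n hkn =>
    ((Filtration.stronglyAdapted_natural hsm) k).mono (ℱ.mono hkn)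
  have hint1 : ∀ k, Integrable (fun x : ℕ → ℝ => x k) gaussianSeq := fun k => by
    have h : Integrable id (gaussianSeq.map fun x : ℕ → ℝ => x k) := by
      rw [map_eval_gaussianSeq]
      exact (memLp_id_gaussianReal 1).integrable (by simp)
    exact h.comp_measurable (by fun_prop)
  have hmean : ∀ k, ∫ x : ℕ → ℝ, x k ∂gaussianSeq = 0 := fun k => by
    have h := integral_map (μ := gaussianSeq) (φ := fun x : ℕ → ℝ => x k) (f := fun y : ℝ => y)
      (measurable_pi_apply k).aemeasurable (by fun_prop)
    rw [map_eval_gaussianSeq, integral_id_gaussianReal] at h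
    exact h.symm
  have hMad : StronglyAdapted ℱ M := fun n => by
    refine Finset.stronglyMeasurable_fun_sum _ fun k hk => ?_
    exact (hadk k n (Nat.lt_succ_iff.1 (Finset.mem_range.1 hk))).const_mul (c k)
  have hMint : ∀ n, Integrable (M n) gaussianSeq := fun n =>
    integrable_finsetSum _ fun k _ => (hint1 k).const_mul (c k)
  have hmart : Martingale M ℱ gaussianSeq := by
    refine martingale_nat hMad hMint fun n => ?_
    have hsplit : M (n + 1) = M n + fun x => c (n + 1) * x (n + 1) := by
      ext x
      simp only [hM, Pi.add_apply]
      rw [Finset.sum_range_succ]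
    rw [hsplit]
    have h1 := condExp_add (hMint n) ((hint1 (n + 1)).const_mul (c (n + 1))) (ℱ n)
    have h2 : gaussianSeq[M n | ℱ n] = M n :=
      condExp_of_stronglyMeasurable (ℱ.le n) (hMad n) (hMint n)
    have h3 := condExp_smul (μ := gaussianSeq) (c (n + 1)) (fun x : ℕ → ℝ => x (n + 1)) (ℱ n)
    have h4 := iIndepFun_eval.condExp_natural_ae_eq_of_lt hsm (Nat.lt_succ_self n)
    filter_upwards [h1, h3, h4] with x hx1 hx3 hx4
    rw [hx1, Pi.add_apply, h2]
    have : (fun x : ℕ → ℝ => c (n + 1) * x (n + 1)) = c (n + 1) • fun x : ℕ → ℝ => x (n + 1) := by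
      ext x; simp
    rw [this, hx3, Pi.smul_apply]
    have hx4' : (gaussianSeq[fun x : ℕ → ℝ => x (n + 1) | ℱ n]) x = 0 := by
      rw [← hmean (n + 1)]; exact hx4
    rw [hx4']
    simp
  have hbdd : ∀ n, eLpNorm (M n) 1 gaussianSeq ≤ ((1 + ∑' k, c k ^ 2).toNNReal : ℝ≥0∞) := fun n => by
    rw [eLpNorm_one_eq_lintegral_enorm]
    refine (lintegral_enorm_sum_mul_le c (n + 1)).trans ?_
    refine ENNReal.ofReal_le_ofReal ?_
    gcongr
    exact hc.sum_le_tsum _ fun k _ => sq_nonneg _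
  filter_upwards [hmart.submartingale.ae_tendsto_limitProcess hbdd] with x hx
  exact ⟨_, (tendsto_add_atTop_iff_nat 1).1 hx⟩

/-- The characteristic functions of the partial sums are explicit; they converge to that of the
limit by dominated convergence, since |exp(iy)| = 1. -/
theorem map_eq_gaussianReal_of_tendsto {c : ℕ → ℝ} (hc : Summable fun k => c k ^ 2)
    {W : (ℕ → ℝ) → ℝ}
    (hW : ∀ᵐ x ∂gaussianSeq, Tendsto (fun n => ∑ k ∈ Finset.range n, c k * x k) atTop (𝓝 (W x))) :
    gaussianSeq.map W = gaussianReal 0 (∑' k, c k ^ 2).toNNReal := by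
  have hWm : AEMeasurable W gaussianSeq :=
    aemeasurable_of_tendsto_metrizable_ae atTop (fun n => Measurable.aemeasurable (by fun_prop)) hW
  have := Measure.isProbabilityMeasure_map hWm
  refine Measure.ext_of_charFun (funext fun t => ?_)
  have hS : ∀ n, ∫ x, Complex.exp (t * (∑ k ∈ Finset.range n, c k * x k : ℝ) * Complex.I) ∂gaussianSeq =
      Complex.exp (-((∑ k ∈ Finset.range n, c k ^ 2 : ℝ) * t ^ 2 / 2)) := fun n => by
    have h := charFun_gaussianReal (μ := 0) (v := (∑ k ∈ Finset.range n, c k ^ 2).toNNReal) t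
    rw [← map_sum_mul_gaussianSeq, charFun_apply_real, integral_map (Measurable.aemeasurable (by fun_prop)) (by fun_prop),
      Real.coe_toNNReal _ (Finset.sum_nonneg fun k _ => sq_nonneg _)] at h
    rw [h]
    congr 1
    simp
  rw [charFun_apply_real, integral_map hWm (by fun_prop), charFun_gaussianReal,
    Real.coe_toNNReal _ (tsum_nonneg fun k => sq_nonneg _)]
  refine tendsto_nhds_unique (f := fun n => ∫ x, Complex.exp
    (t * (∑ k ∈ Finset.range n, c k * x k : ℝ) * Complex.I) ∂gaussianSeq) (l := atTop) ?_ ?_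
  · refine tendsto_integral_of_dominated_convergence (fun _ => 1) (fun n => ?_)
      (integrable_const _) (fun n => ae_of_all _ fun x => ?_) ?_
    · exact Measurable.aestronglyMeasurable (by fun_prop)
    · rw [← Complex.ofReal_mul, Complex.norm_exp_ofReal_mul_I]
    · filter_upwards [hW] with x hx
      have hcont : Continuous fun y : ℝ => Complex.exp (t * (y : ℂ) * Complex.I) := by fun_prop
      exact (hcont.tendsto _).comp hx
  · simp_rw [hS]
    have hcont : Continuous fun y : ℝ => Complex.exp (-((y : ℂ) * t ^ 2 / 2)) := by fun_prop
    have := (hcont.tendsto _).comp hc.hasSum.tendsto_sum_nat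
    refine this.trans (le_of_eq ?_)
    congr 2
    simp

end RandomDirichlet

/-! ### Convergence, continuity and Gaussian law of the random Dirichlet series. -/

namespace RandomDirichlet

variable {p : ℕ → ℝ}

theorem partialSum_eq (hp_mono : StrictMono p) (hp_one : 1 ≤ p 0) (x : ℕ → ℝ) (σ : ℝ) (n : ℕ) :
    partialSum p x σ n = ∑ k ∈ Finset.range n, Real.exp (σ * negLog p k) * x k := by
  refine Finset.sum_congr rfl fun k _ => ?_
  have hk : 0 < p k := by linarith [one_le_of_strictMono hp_mono hp_one k]
  rw [Real.rpow_def_of_pos hk, div_eq_mul_inv, ← Real.exp_neg, mul_comm, negLog]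
  congr 2
  ring

/-- Abel summation: the nonnegative differences of b telescope. -/
theorem abs_sum_mul_le_of_antitone {a b : ℕ → ℝ} {ε : ℝ} (hb : Antitone b) (hb0 : ∀ k, 0 ≤ b k)
    (ha : ∀ n, |∑ k ∈ Finset.range n, a k| ≤ ε) (n : ℕ) :
    |∑ k ∈ Finset.range n, a k * b k| ≤ ε * b 0 := by
  have hε : 0 ≤ ε := (abs_nonneg _).trans (ha 0)
  have hsum : ∀ n, ∑ k ∈ Finset.range n, a k * b k = (∑ k ∈ Finset.range n, a k) * b n +
      ∑ k ∈ Finset.range n, (∑ j ∈ Finset.range (k + 1), a j) * (b k - b (k + 1)) := by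
    intro n
    induction n with
    | zero => simp
    | succ n ih =>
      rw [Finset.sum_range_succ, ih, Finset.sum_range_succ
        (fun k => (∑ j ∈ Finset.range (k + 1), a j) * (b k - b (k + 1))) n,
        Finset.sum_range_succ a n]
      ring
  rw [hsum]
  calc _ ≤ |(∑ k ∈ Finset.range n, a k) * b n| +
        ∑ k ∈ Finset.range n, |(∑ j ∈ Finset.range (k + 1), a j) * (b k - b (k + 1))| :=
      (abs_add_le _ _).trans (by gcongr; exact Finset.abs_sum_le_sum_abs _ _)
    _ ≤ ε * b n + ∑ k ∈ Finset.range n, ε * (b k - b (k + 1)) := by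
      refine add_le_add ?_ (Finset.sum_le_sum fun k _ => ?_)
      · rw [abs_mul, abs_of_nonneg (hb0 n)]
        exact mul_le_mul_of_nonneg_right (ha n) (hb0 n)
      · have h := sub_nonneg.2 (hb (Nat.le_succ k))
        rw [abs_mul, abs_of_nonneg h]
        exact mul_le_mul_of_nonneg_right (ha _) h
    _ = ε * b 0 := by
      rw [← Finset.mul_sum, Finset.sum_range_sub' b]
      ring

/-- The sum of the Dirichlet series `∑ₖ x k / p k ^ σ`, where it converges. -/
noncomputable def limSeries (p : ℕ → ℝ) (x : ℕ → ℝ) (σ : ℝ) : ℝ := limUnder atTop (partialSum p x σ)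

theorem tendsto_limSeries {x : ℕ → ℝ} {σ l : ℝ} (h : Tendsto (partialSum p x σ) atTop (𝓝 l)) :
    Tendsto (partialSum p x σ) atTop (𝓝 (limSeries p x σ)) := by
  rwa [limSeries, h.limUnder_eq]

/-- Moving from σ₀ to σ ≥ σ₀ multiplies the terms by weights decreasing in k and at most 1, so
Abel's inequality bounds each block of the series at σ by the blocks at σ₀, uniformly in σ. -/
theorem uniformCauchySeqOn_partialSum (hp_mono : StrictMono p) (hp_one : 1 ≤ p 0) {x : ℕ → ℝ}
    {σ₀ l : ℝ} (h : Tendsto (partialSum p x σ₀) atTop (𝓝 l)) :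
    UniformCauchySeqOn (fun n σ => partialSum p x σ n) atTop (Set.Ici σ₀) := by
  have hanti := (strictAnti_negLog hp_mono hp_one).antitone
  have hZ : ∀ k, negLog p k ≤ 0 := fun k =>
    neg_nonpos.2 (Real.log_nonneg (one_le_of_strictMono hp_mono hp_one k))
  rw [Metric.uniformCauchySeqOn_iff]
  intro ε hε
  obtain ⟨N, hN⟩ := Metric.cauchySeq_iff.1 h.cauchySeq (ε / 2) (by positivity)
  have key : ∀ m, N ≤ m → ∀ n σ, σ₀ ≤ σ →
      |partialSum p x σ (m + n) - partialSum p x σ m| ≤ ε / 2 := by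
    intro m hm n σ hσ
    have hab := abs_sum_mul_le_of_antitone
      (a := fun k => Real.exp (σ₀ * negLog p (m + k)) * x (m + k))
      (b := fun k => Real.exp ((σ - σ₀) * negLog p (m + k))) (ε := ε / 2) ?_
      (fun k => (Real.exp_pos _).le) ?_ n
    · have e : partialSum p x σ (m + n) - partialSum p x σ m = ∑ k ∈ Finset.range n,
          Real.exp (σ₀ * negLog p (m + k)) * x (m + k) * Real.exp ((σ - σ₀) * negLog p (m + k)) := by
        rw [partialSum_eq hp_mono hp_one, partialSum_eq hp_mono hp_one, Finset.sum_range_add,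
          add_sub_cancel_left]
        refine Finset.sum_congr rfl fun k _ => ?_
        rw [mul_right_comm, ← Real.exp_add]
        congr 2
        ring
      rw [e]
      refine hab.trans (mul_le_of_le_one_right (by positivity) (Real.exp_le_one_iff.2 ?_))
      nlinarith [hZ (m + 0)]
    · intro i j hij
      refine Real.exp_le_exp.2 (mul_le_mul_of_nonneg_left (hanti ?_) (by linarith))
      omega
    · intro j
      have h1 := hN (m + j) (by omega) m hm
      rw [Real.dist_eq, partialSum_eq hp_mono hp_one, partialSum_eq hp_mono hp_one,
        Finset.sum_range_add, add_sub_cancel_left] at h1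
      exact h1.le
  refine ⟨N, fun m hm n hn σ hσ => ?_⟩
  rw [Real.dist_eq]
  rcases le_total m n with hmn | hmn
  · have := key m hm (n - m) σ hσ
    rw [Nat.add_sub_cancel' hmn, abs_sub_comm] at this
    linarith
  · have := key n hn (m - n) σ hσ
    rw [Nat.add_sub_cancel' hmn] at this
    linarith

theorem continuous_partialSum (hp_mono : StrictMono p) (hp_one : 1 ≤ p 0) (x : ℕ → ℝ) (n : ℕ) :
    Continuous fun σ => partialSum p x σ n := by
  simp_rw [partialSum_eq hp_mono hp_one]
  fun_prop

theorem tendsto_limSeries_of_le (hp_mono : StrictMono p) (hp_one : 1 ≤ p 0) {x : ℕ → ℝ}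
    {σ₀ l : ℝ} (h : Tendsto (partialSum p x σ₀) atTop (𝓝 l)) {σ : ℝ} (hσ : σ₀ ≤ σ) :
    Tendsto (partialSum p x σ) atTop (𝓝 (limSeries p x σ)) := by
  have hC : CauchySeq (partialSum p x σ) := by
    have := (uniformCauchySeqOn_partialSum hp_mono hp_one h).cauchySeq (show σ ∈ Set.Ici σ₀ from hσ)
    exact this
  obtain ⟨l', hl'⟩ := cauchySeq_tendsto_of_complete hC
  exact tendsto_limSeries hl'

theorem continuousOn_limSeries (hp_mono : StrictMono p) (hp_one : 1 ≤ p 0) {x : ℕ → ℝ}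
    {σ₀ l : ℝ} (h : Tendsto (partialSum p x σ₀) atTop (𝓝 l)) :
    ContinuousOn (limSeries p x) (Set.Ici σ₀) :=
  ((uniformCauchySeqOn_partialSum hp_mono hp_one h).tendstoUniformlyOn_of_tendsto fun _ hσ =>
    tendsto_limSeries_of_le hp_mono hp_one h hσ).continuousOn
    (Frequently.of_forall fun n => (continuous_partialSum hp_mono hp_one x n).continuousOn)

/-- The Dirichlet series with coefficients `x` converges to a continuous function on `(1/2, ∞)`. -/
def IsRegular (p : ℕ → ℝ) (x : ℕ → ℝ) : Prop :=
  (∀ σ, 1 / 2 < σ → Tendsto (partialSum p x σ) atTop (𝓝 (limSeries p x σ))) ∧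
    ContinuousOn (limSeries p x) (Set.Ioi (1 / 2))

theorem summable_exp_negLog
    (hI : ∀ u, 1 < u → Integrable (fun n => Real.exp (u * negLog p n)) Measure.count)
    {u : ℝ} (hu : 1 < u) : Summable fun n => Real.exp (u * negLog p n) := by
  simpa using integrable_count_iff.1 (hI u hu)

theorem mgf_eq_tsum (hI : ∀ u, 1 < u → Integrable (fun n => Real.exp (u * negLog p n)) Measure.count)
    {u : ℝ} (hu : 1 < u) : mgf (negLog p) Measure.count u = ∑' n, Real.exp (u * negLog p n) := by
  rw [mgf, integral_countable (hI u hu)]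
  simp [Measure.real]

/-- Almost sure convergence is needed only at the countably many points 1/2 + 1/(m + 1), where the
squared coefficients sum to K(1 + 2/(m + 1)); it then propagates to the right. -/
theorem ae_isRegular (hp_mono : StrictMono p) (hp_one : 1 ≤ p 0)
    (hI : ∀ u, 1 < u → Integrable (fun n => Real.exp (u * negLog p n)) Measure.count) :
    ∀ᵐ x ∂gaussianSeq, IsRegular p x := by
  have hae : ∀ᵐ x ∂gaussianSeq, ∀ m : ℕ, ∃ l,
      Tendsto (partialSum p x (1 / 2 + 1 / ((m : ℝ) + 1))) atTop (𝓝 l) := by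
    refine ae_all_iff.2 fun m => ?_
    have hm : (0 : ℝ) < 1 / ((m : ℝ) + 1) := by positivity
    have hs : Summable fun k => Real.exp ((1 / 2 + 1 / ((m : ℝ) + 1)) * negLog p k) ^ 2 := by
      refine (summable_exp_negLog hI (u := 1 + 2 * (1 / ((m : ℝ) + 1))) (by linarith)).congr fun k => ?_
      rw [← Real.exp_nat_mul]
      congr 1
      push_cast
      ring
    filter_upwards [ae_exists_tendsto_sum_mul hs] with x hx
    obtain ⟨l, hl⟩ := hx
    exact ⟨l, hl.congr fun n => (partialSum_eq hp_mono hp_one x _ n).symm⟩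
  filter_upwards [hae] with x hx
  have hlow : ∀ σ : ℝ, 1 / 2 < σ → ∃ σ₀ l, σ₀ < σ ∧ Tendsto (partialSum p x σ₀) atTop (𝓝 l) := by
    intro σ hσ
    obtain ⟨m, hm⟩ := exists_nat_one_div_lt (sub_pos.2 hσ)
    obtain ⟨l, hl⟩ := hx m
    exact ⟨_, l, by linarith, hl⟩
  refine ⟨fun σ hσ => ?_, fun σ hσ => ?_⟩
  · obtain ⟨σ₀, l, h1, h2⟩ := hlow σ hσ
    exact tendsto_limSeries_of_le hp_mono hp_one h2 h1.le
  · obtain ⟨σ₀, l, h1, h2⟩ := hlow σ hσ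
    exact ((continuousOn_limSeries hp_mono hp_one h2).continuousAt
      (Ici_mem_nhds h1)).continuousWithinAt

theorem zeroSet_eq {x : ℕ → ℝ} (hx : IsRegular p x) {T : ℝ} (hT : 1 / 2 < T) :
    zeroSet p x T = {σ | T ≤ σ ∧ limSeries p x σ = 0} := by
  ext σ
  refine and_congr_right fun hσ => ⟨fun h => ?_, fun h => ?_⟩
  · exact tendsto_nhds_unique (hx.1 σ (hT.trans_le hσ)) h
  · have := hx.1 σ (hT.trans_le hσ)
    rwa [h] at this

theorem measurable_partialSum (σ : ℝ) (n : ℕ) :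
    Measurable fun x : ℕ → ℝ => partialSum p x σ n := by
  unfold partialSum
  fun_prop

theorem aemeasurable_limSeries (hreg : ∀ᵐ x ∂gaussianSeq, IsRegular p x) {σ : ℝ} (hσ : 1 / 2 < σ) :
    AEMeasurable (fun x => limSeries p x σ) gaussianSeq :=
  aemeasurable_of_tendsto_metrizable_ae atTop
    (fun n => (measurable_partialSum (p := p) σ n).aemeasurable) (hreg.mono fun _ hx => hx.1 σ hσ)

theorem map_linear_limSeries (hp_mono : StrictMono p) (hp_one : 1 ≤ p 0)
    (hI : ∀ u, 1 < u → Integrable (fun n => Real.exp (u * negLog p n)) Measure.count)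
    (hreg : ∀ᵐ x ∂gaussianSeq, IsRegular p x) {s t : ℝ} (hs : 1 / 2 < s) (ht : 1 / 2 < t) (a b : ℝ) :
    gaussianSeq.map (fun x => a * limSeries p x s + b * limSeries p x t) =
      gaussianReal 0 (a ^ 2 * mgf (negLog p) Measure.count (2 * s) +
        2 * a * b * mgf (negLog p) Measure.count (s + t) +
        b ^ 2 * mgf (negLog p) Measure.count (2 * t)).toNNReal := by
  set c : ℕ → ℝ := fun k => a * Real.exp (s * negLog p k) + b * Real.exp (t * negLog p k) with hc
  have e : ∀ k, c k ^ 2 = a ^ 2 * Real.exp (2 * s * negLog p k) +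
      2 * a * b * Real.exp ((s + t) * negLog p k) + b ^ 2 * Real.exp (2 * t * negLog p k) := by
    intro k
    rw [show 2 * s * negLog p k = s * negLog p k + s * negLog p k by ring,
      show 2 * t * negLog p k = t * negLog p k + t * negLog p k by ring, add_mul, Real.exp_add,
      Real.exp_add, Real.exp_add, hc]
    ring
  have h1 := (summable_exp_negLog hI (u := 2 * s) (by linarith)).mul_left (a ^ 2)
  have h2 := (summable_exp_negLog hI (u := s + t) (by linarith)).mul_left (2 * a * b)
  have h3 := (summable_exp_negLog hI (u := 2 * t) (by linarith)).mul_left (b ^ 2)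
  have hsum : Summable fun k => c k ^ 2 := ((h1.add h2).add h3).congr fun k => (e k).symm
  have htsum : ∑' k, c k ^ 2 = a ^ 2 * mgf (negLog p) Measure.count (2 * s) +
        2 * a * b * mgf (negLog p) Measure.count (s + t) +
        b ^ 2 * mgf (negLog p) Measure.count (2 * t) := by
    rw [mgf_eq_tsum hI (by linarith), mgf_eq_tsum hI (by linarith), mgf_eq_tsum hI (by linarith)]
    simp_rw [e]
    rw [(h1.add h2).tsum_add h3, h1.tsum_add h2, tsum_mul_left, tsum_mul_left, tsum_mul_left]
  rw [← htsum]
  refine map_eq_gaussianReal_of_tendsto hsum ?_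
  filter_upwards [hreg] with x hx
  refine (((hx.1 s hs).const_mul a).add ((hx.1 t ht).const_mul b)).congr fun n => ?_
  rw [partialSum_eq hp_mono hp_one, partialSum_eq hp_mono hp_one, Finset.mul_sum, Finset.mul_sum,
    ← Finset.sum_add_distrib]
  refine Finset.sum_congr rfl fun k _ => ?_
  simp only [hc]
  ring

end RandomDirichlet

/-! ### The probability that two values of F have opposite signs. -/

namespace RandomDirichlet

theorem cos_mul_cos_sub_neg_iff {θ φ : ℝ} (h0 : 0 ≤ θ) (h1 : θ ≤ Real.pi / 2)
    (hφ : φ ∈ Set.Ioo (-Real.pi) Real.pi) :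
    Real.cos φ * Real.cos (φ - θ) < 0 ↔
      φ ∈ Set.Ioo (Real.pi / 2) (Real.pi / 2 + θ) ∪ Set.Ioo (-(Real.pi / 2)) (-(Real.pi / 2) + θ) := by
  have hπ := Real.pi_pos
  have hpos : ∀ x, -(Real.pi / 2) ≤ x → x ≤ Real.pi / 2 → 0 ≤ Real.cos x := fun x =>
    Real.cos_nonneg_of_neg_pi_div_two_le_of_le
  have hneg : ∀ x, Real.pi / 2 ≤ x → x ≤ Real.pi + Real.pi / 2 → Real.cos x ≤ 0 := fun x =>
    Real.cos_nonpos_of_pi_div_two_le_of_le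
  have hneg' : ∀ x, -(Real.pi + Real.pi / 2) ≤ x → x ≤ -(Real.pi / 2) → Real.cos x ≤ 0 := by
    intro x hx1 hx2
    rw [← Real.cos_neg]
    exact hneg _ (by linarith) (by linarith)
  constructor
  · contrapose!
    intro h
    simp only [Set.mem_union, Set.mem_Ioo, not_or, not_and, not_lt] at h
    rcases le_or_gt φ (-(Real.pi / 2)) with h2 | h2
    · exact mul_nonneg_of_nonpos_of_nonpos (hneg' _ (by linarith [hφ.1]) h2)
        (hneg' _ (by linarith [hφ.1]) (by linarith))
    · have h3 := h.2 h2
      rcases le_or_gt φ (Real.pi / 2) with h4 | h4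
      · exact mul_nonneg (hpos _ (by linarith) h4) (hpos _ (by linarith) (by linarith))
      · have h5 := h.1 h4
        exact mul_nonneg_of_nonpos_of_nonpos (hneg _ (by linarith) (by linarith [hφ.2]))
          (hneg _ (by linarith) (by linarith [hφ.2]))
  · rintro (h | h)
    · refine mul_neg_of_neg_of_pos ?_ ?_
      · exact Real.cos_neg_of_pi_div_two_lt_of_lt h.1 (by linarith [h.2])
      · exact Real.cos_pos_of_mem_Ioo ⟨by linarith [h.1], by linarith [h.2]⟩
    · refine mul_neg_of_pos_of_neg ?_ ?_
      · exact Real.cos_pos_of_mem_Ioo ⟨by linarith [h.1], by linarith [h.2]⟩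
      · rw [← Real.cos_neg]
        exact Real.cos_neg_of_pi_div_two_lt_of_lt (by linarith [h.2]) (by linarith [h.1])

theorem volume_cos_mul_cos_sub_neg {θ : ℝ} (h0 : 0 ≤ θ) (h1 : θ ≤ Real.pi / 2) :
    volume ({φ | Real.cos φ * Real.cos (φ - θ) < 0} ∩ Set.Ioo (-Real.pi) Real.pi) =
      ENNReal.ofReal (2 * θ) := by
  have hπ := Real.pi_pos
  have hset : {φ | Real.cos φ * Real.cos (φ - θ) < 0} ∩ Set.Ioo (-Real.pi) Real.pi =
      Set.Ioo (Real.pi / 2) (Real.pi / 2 + θ) ∪ Set.Ioo (-(Real.pi / 2)) (-(Real.pi / 2) + θ) := by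
    ext φ
    constructor
    · rintro ⟨h, hφ⟩
      exact (cos_mul_cos_sub_neg_iff h0 h1 hφ).1 h
    · intro h
      have hφ : φ ∈ Set.Ioo (-Real.pi) Real.pi := by
        rcases h with h | h
        · exact ⟨by linarith [h.1], by linarith [h.2]⟩
        · exact ⟨by linarith [h.1], by linarith [h.2]⟩
      exact ⟨(cos_mul_cos_sub_neg_iff h0 h1 hφ).2 h, hφ⟩
  have hdisj : Disjoint (Set.Ioo (Real.pi / 2) (Real.pi / 2 + θ))
      (Set.Ioo (-(Real.pi / 2)) (-(Real.pi / 2) + θ)) :=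
    Set.disjoint_left.2 fun φ h h' => by linarith [h.1, h'.2]
  rw [hset, measure_union hdisj measurableSet_Ioo, Real.volume_Ioo, Real.volume_Ioo,
    ← ENNReal.ofReal_add (by linarith) (by linarith)]
  congr 1
  ring

/-- In polar coordinates the Gaussian density is independent of the angle, so the measure of a cone
is proportional to its angular size. The radial integral κ need not be evaluated: the whole plane
normalizes it. -/
theorem exists_gaussian_prod_apply :
    ∃ κ : ℝ≥0∞, ∀ D : Set ℝ, MeasurableSet D → ∀ S : Set (ℝ × ℝ), MeasurableSet S →
      (∀ r φ, 0 < r → ((r * Real.cos φ, r * Real.sin φ) ∈ S ↔ φ ∈ D)) →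
      ((gaussianReal 0 1).prod (gaussianReal 0 1)) S =
        κ * volume (D ∩ Set.Ioo (-Real.pi) Real.pi) := by
  refine ⟨∫⁻ r in Set.Ioi 0, ENNReal.ofReal r *
    ENNReal.ofReal ((Real.sqrt (2 * Real.pi))⁻¹ ^ 2 * Real.exp (-(r ^ 2 / 2))), fun D hD S hS h => ?_⟩
  have hdens : gaussianReal 0 1 = volume.withDensity (gaussianPDF 0 1) :=
    gaussianReal_of_var_ne_zero 0 one_ne_zero
  have hprod : (gaussianReal 0 1).prod (gaussianReal 0 1) =
      (volume : Measure (ℝ × ℝ)).withDensity fun q => gaussianPDF 0 1 q.1 * gaussianPDF 0 1 q.2 := by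
    rw [hdens, prod_withDensity (measurable_gaussianPDF 0 1) (measurable_gaussianPDF 0 1)]
    rfl
  rw [hprod, withDensity_apply _ hS, ← lintegral_indicator hS, ← lintegral_comp_polarCoord_symm,
    polarCoord_target]
  have hpt : ∀ q ∈ (Set.Ioi (0 : ℝ)) ×ˢ Set.Ioo (-Real.pi) Real.pi, ENNReal.ofReal q.1 •
      S.indicator (fun q => gaussianPDF 0 1 q.1 * gaussianPDF 0 1 q.2) (polarCoord.symm q) =
      (ENNReal.ofReal q.1 *
        ENNReal.ofReal ((Real.sqrt (2 * Real.pi))⁻¹ ^ 2 * Real.exp (-(q.1 ^ 2 / 2)))) *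
        D.indicator (fun _ => 1) q.2 := by
    rintro ⟨r, φ⟩ ⟨hr, -⟩
    have hr : 0 < r := hr
    rw [polarCoord_symm_apply, smul_eq_mul, mul_assoc]
    congr 1
    by_cases hφ : φ ∈ D
    · rw [Set.indicator_of_mem ((h r φ hr).2 hφ), Set.indicator_of_mem hφ, mul_one]
      simp only [gaussianPDF]
      rw [← ENNReal.ofReal_mul (gaussianPDFReal_nonneg _ _ _)]
      congr 1
      simp only [gaussianPDFReal, sub_zero, NNReal.coe_one, mul_one]
      rw [mul_mul_mul_comm, ← Real.exp_add, pow_two (Real.sqrt (2 * Real.pi))⁻¹]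
      congr 2
      linear_combination (-(r ^ 2) / 2) * Real.cos_sq_add_sin_sq φ
    · rw [Set.indicator_of_notMem fun h' => hφ ((h r φ hr).1 h'), Set.indicator_of_notMem hφ,
        mul_zero]
  rw [setLIntegral_congr_fun (measurableSet_Ioi.prod measurableSet_Ioo) hpt, Measure.volume_eq_prod,
    ← Measure.prod_restrict, lintegral_prod_mul (f := fun r => ENNReal.ofReal r *
      ENNReal.ofReal ((Real.sqrt (2 * Real.pi))⁻¹ ^ 2 * Real.exp (-(r ^ 2 / 2))))
      (g := D.indicator fun _ => 1) (by fun_prop)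
      (Measurable.aemeasurable (measurable_const.indicator hD)), lintegral_indicator hD,
    setLIntegral_one, Measure.restrict_apply hD]

/-- At polar angle φ the product has the sign of cos φ · cos(φ - θ), which is negative on angles of
total length 2θ out of 2π. -/
theorem gaussian_prod_sign_ne {θ : ℝ} (h0 : 0 ≤ θ) (h1 : θ ≤ Real.pi / 2) :
    ((gaussianReal 0 1).prod (gaussianReal 0 1))
      {q | q.1 * (Real.cos θ * q.1 + Real.sin θ * q.2) < 0} = ENNReal.ofReal (θ / Real.pi) := by
  have hπ := Real.pi_pos
  obtain ⟨κ, hκ⟩ := exists_gaussian_prod_apply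
  have huniv := hκ Set.univ MeasurableSet.univ Set.univ MeasurableSet.univ (by simp)
  rw [measure_univ, Set.univ_inter, Real.volume_Ioo] at huniv
  rw [hκ {φ | Real.cos φ * Real.cos (φ - θ) < 0} (measurableSet_lt (by fun_prop) (by fun_prop)) _
    (measurableSet_lt (by fun_prop) (by fun_prop)) ?_, volume_cos_mul_cos_sub_neg h0 h1]
  · have hsplit : ENNReal.ofReal (2 * θ) =
        ENNReal.ofReal (Real.pi - -Real.pi) * ENNReal.ofReal (θ / Real.pi) := by
      rw [← ENNReal.ofReal_mul (by linarith)]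
      congr 1
      field_simp
      ring
    rw [hsplit, ← mul_assoc, ← huniv, one_mul]
  · intro r φ hr
    simp only [Set.mem_ofPred_eq]
    have e : r * Real.cos φ * (Real.cos θ * (r * Real.cos φ) + Real.sin θ * (r * Real.sin φ)) =
        r ^ 2 * (Real.cos φ * Real.cos (φ - θ)) := by
      rw [Real.cos_sub]; ring
    rw [e]
    have hr2 : 0 < r ^ 2 := by positivity
    constructor
    · intro h
      by_contra! hcon
      linarith [mul_nonneg hr2.le hcon]
    · intro h
      exact mul_neg_of_pos_of_neg hr2 h

theorem map_linear_gaussian_prod (a b : ℝ) :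
    ((gaussianReal 0 1).prod (gaussianReal 0 1)).map (fun q => a * q.1 + b * q.2) =
      gaussianReal 0 (a ^ 2 + b ^ 2).toNNReal := by
  have h := Measure.infinitePi_map_eval_prod (P := fun _ : ℕ => gaussianReal 0 1)
    (i := 0) (j := 1) (by norm_num)
  have h2 := map_sum_mul_gaussianSeq (fun k => if k = 0 then a else b) 2
  simp only [Finset.sum_range_succ, Finset.sum_range_zero, zero_add, one_ne_zero, if_true,
    if_false] at h2
  rw [← h2, ← h, Measure.map_map (by fun_prop) (by fun_prop)]
  rfl

variable {p : ℕ → ℝ}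

/-- Cramér–Wold: every linear functional of either pair is centred Gaussian, and the variances agree
because K(s + t) is the product of the standard deviations and cos of the angle. -/
theorem map_prodMk_limSeries (hp_mono : StrictMono p) (hp_one : 1 ≤ p 0)
    (hI : ∀ u, 1 < u → Integrable (fun n => Real.exp (u * negLog p n)) Measure.count)
    (hreg : ∀ᵐ x ∂gaussianSeq, IsRegular p x) {s t : ℝ} (hs : 1 / 2 < s) (hst : s < t) :
    gaussianSeq.map (fun x => (limSeries p x s, limSeries p x t)) =
      ((gaussianReal 0 1).prod (gaussianReal 0 1)).map fun q =>
        (Real.sqrt (mgf (negLog p) Measure.count (2 * s)) * q.1,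
          Real.sqrt (mgf (negLog p) Measure.count (2 * t)) *
            (Real.cos (angle (negLog p) s t) * q.1 + Real.sin (angle (negLog p) s t) * q.2)) := by
  have ht : 1 / 2 < t := hs.trans hst
  have hm : AEMeasurable (fun x => (limSeries p x s, limSeries p x t)) gaussianSeq :=
    (aemeasurable_limSeries hreg hs).prodMk (aemeasurable_limSeries hreg ht)
  set A := mgf (negLog p) Measure.count (2 * s) with hA
  set B := mgf (negLog p) Measure.count (2 * t) with hB
  set θ := angle (negLog p) s t with hθ
  have hA0 : 0 < A := mgf_count_pos hI (by linarith)
  have hB0 : 0 < B := mgf_count_pos hI (by linarith)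
  have hC : mgf (negLog p) Measure.count (s + t) = Real.sqrt A * Real.sqrt B * Real.cos θ := by
    rw [hθ, cos_angle (strictAnti_negLog hp_mono hp_one) hI hs hst, ← hA, ← hB, Real.sqrt_mul hA0.le]
    have := Real.sqrt_pos.2 hA0
    have := Real.sqrt_pos.2 hB0
    field_simp
  have hm2 : Measurable fun q : ℝ × ℝ => (Real.sqrt A * q.1,
      Real.sqrt B * (Real.cos θ * q.1 + Real.sin θ * q.2)) := by fun_prop
  have := Measure.isProbabilityMeasure_map hm
  have := Measure.isProbabilityMeasure_map (μ := (gaussianReal 0 1).prod (gaussianReal 0 1))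
    hm2.aemeasurable
  refine Measure.ext_of_charFunDual (funext fun L => ?_)
  have hL : ∀ q : ℝ × ℝ, L q = L (1, 0) * q.1 + L (0, 1) * q.2 := by
    rintro ⟨x, y⟩
    have : ((x, y) : ℝ × ℝ) = x • (1, 0) + y • (0, 1) := by simp
    rw [this, map_add, map_smul, map_smul]
    simp [mul_comm]
  rw [charFunDual_eq_charFun_map_one, charFunDual_eq_charFun_map_one,
    AEMeasurable.map_map_of_aemeasurable (by fun_prop) hm, Measure.map_map (by fun_prop) hm2]
  congr 1
  have e1 : (L ∘ fun x => (limSeries p x s, limSeries p x t)) =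
      fun x => L (1, 0) * limSeries p x s + L (0, 1) * limSeries p x t := by
    ext x
    exact hL _
  have e2 : (L ∘ fun q : ℝ × ℝ => (Real.sqrt A * q.1,
      Real.sqrt B * (Real.cos θ * q.1 + Real.sin θ * q.2))) =
      fun q => (L (1, 0) * Real.sqrt A + L (0, 1) * (Real.sqrt B * Real.cos θ)) * q.1 +
        (L (0, 1) * (Real.sqrt B * Real.sin θ)) * q.2 := by
    ext q
    rw [Function.comp, hL]
    ring
  rw [e1, e2, map_linear_limSeries hp_mono hp_one hI hreg hs ht, map_linear_gaussian_prod, hC,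
    ← hA, ← hB]
  congr 2
  have h1 := Real.sq_sqrt hA0.le
  have h2 := Real.sq_sqrt hB0.le
  have h3 := Real.sin_sq_add_cos_sq θ
  linear_combination (-(L (1, 0)) ^ 2) * h1 - (L (0, 1)) ^ 2 * h2 -
    (L (0, 1)) ^ 2 * Real.sqrt B ^ 2 * h3

theorem measure_limSeries_mul_neg (hp_mono : StrictMono p) (hp_one : 1 ≤ p 0)
    (hI : ∀ u, 1 < u → Integrable (fun n => Real.exp (u * negLog p n)) Measure.count)
    (hreg : ∀ᵐ x ∂gaussianSeq, IsRegular p x) {s t : ℝ} (hs : 1 / 2 < s) (hst : s < t) :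
    gaussianSeq {x | limSeries p x s * limSeries p x t < 0} =
      ENNReal.ofReal (angle (negLog p) s t / Real.pi) := by
  have ht : 1 / 2 < t := hs.trans hst
  have hm : AEMeasurable (fun x => (limSeries p x s, limSeries p x t)) gaussianSeq :=
    (aemeasurable_limSeries hreg hs).prodMk (aemeasurable_limSeries hreg ht)
  have hS : MeasurableSet {q : ℝ × ℝ | q.1 * q.2 < 0} := measurableSet_lt (by fun_prop) (by fun_prop)
  have hA0 := Real.sqrt_pos.2 (mgf_count_pos hI (u := 2 * s) (by linarith))
  have hB0 := Real.sqrt_pos.2 (mgf_count_pos hI (u := 2 * t) (by linarith))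
  have h := congrArg (fun ν : Measure (ℝ × ℝ) => ν {q : ℝ × ℝ | q.1 * q.2 < 0})
    (map_prodMk_limSeries hp_mono hp_one hI hreg hs hst)
  rw [Measure.map_apply_of_aemeasurable hm hS, Measure.map_apply (by fun_prop) hS] at h
  refine h.trans ?_
  have hθ1 : angle (negLog p) s t ≤ Real.pi / 2 := by
    refine Real.arccos_le_pi_div_two.2 (div_nonneg ?_ (Real.sqrt_nonneg _))
    exact (mgf_count_pos hI (by linarith)).le
  have hθ0 : 0 ≤ angle (negLog p) s t := Real.arccos_nonneg _
  rw [← gaussian_prod_sign_ne hθ0 hθ1]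
  congr 1
  ext q
  simp only [Set.mem_preimage, Set.mem_ofPred_eq]
  rw [mul_mul_mul_comm]
  have hAB := mul_pos hA0 hB0
  constructor
  · intro h
    by_contra! hcon
    linarith [mul_nonneg hAB.le hcon]
  · intro h
    exact mul_neg_of_pos_of_neg hAB h

theorem ae_limSeries_ne_zero (hp_mono : StrictMono p) (hp_one : 1 ≤ p 0)
    (hI : ∀ u, 1 < u → Integrable (fun n => Real.exp (u * negLog p n)) Measure.count)
    (hreg : ∀ᵐ x ∂gaussianSeq, IsRegular p x) {s : ℝ} (hs : 1 / 2 < s) :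
    ∀ᵐ x ∂gaussianSeq, limSeries p x s ≠ 0 := by
  have h := map_linear_limSeries hp_mono hp_one hI hreg hs hs 1 0
  simp only [one_mul, zero_mul, add_zero, one_pow, mul_zero, ne_eq, OfNat.ofNat_ne_zero,
    not_false_eq_true, zero_pow] at h
  have hA := mgf_count_pos hI (u := 2 * s) (by linarith)
  have hna := nullSingletonClass_gaussianReal (μ := 0) (Real.toNNReal_pos.2 hA).ne'
  have h2 : gaussianSeq.map (fun x => limSeries p x s) {0} = 0 := by
    rw [h]
    exact measure_singleton 0
  rw [Measure.map_apply_of_aemeasurable (aemeasurable_limSeries hreg hs)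
    (measurableSet_singleton 0)] at h2
  rw [ae_iff]
  simpa [Set.preimage] using h2

end RandomDirichlet

/-! ### Almost surely F takes both signs near each of its zeros. -/

namespace RandomDirichlet

theorem indepFun_tail_zero :
    IndepFun (fun (x : ℕ → ℝ) (n : ℕ) => x (n + 1)) (fun x => x 0) gaussianSeq := by
  refine IndepFun.process_indepFun (fun n => by fun_prop) (by fun_prop) fun I => ?_
  have h := iIndepFun_eval.indepFun_finset (I.image Nat.succ) {0}
    (by simp) (fun n => by fun_prop)
  have hφ : Measurable fun (y : ↥(I.image Nat.succ) → ℝ) (i : I) =>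
      y ⟨i.1 + 1, Finset.mem_image_of_mem Nat.succ i.2⟩ :=
    measurable_pi_lambda _ fun i => measurable_pi_apply _
  have hψ : Measurable fun y : ↥({0} : Finset ℕ) → ℝ => y ⟨0, Finset.mem_singleton_self 0⟩ :=
    measurable_pi_apply _
  exact h.comp hφ hψ

/-- Given the tail, at most one value of `x 0` satisfies the equation; it is independent of the tail
and has no atoms. `EReal` values allow for suprema that are infinite for some sequences. -/
theorem measure_tail_eq_zero {M : (ℕ → ℝ) → EReal} (hM : Measurable M) {e : ℝ} (he : e ≠ 0) :
    gaussianSeq {x | M (fun n => x (n + 1)) = ((-(e * x 0) : ℝ) : EReal)} = 0 := by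
  have hmY : Measurable fun (x : ℕ → ℝ) (n : ℕ) => x (n + 1) := by fun_prop
  have hm0 : Measurable fun x : ℕ → ℝ => x 0 := by fun_prop
  have hS : MeasurableSet {q : (ℕ → ℝ) × ℝ | M q.1 = ((-(e * q.2) : ℝ) : EReal)} :=
    measurableSet_eq_fun (hM.comp measurable_fst) (by fun_prop)
  have h := (indepFun_iff_map_prod_eq_prod_map_map hmY.aemeasurable hm0.aemeasurable).1
    indepFun_tail_zero
  have hpre : {x : ℕ → ℝ | M (fun n => x (n + 1)) = ((-(e * x 0) : ℝ) : EReal)} =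
      (fun x : ℕ → ℝ => ((fun n => x (n + 1)), x 0)) ⁻¹'
        {q : (ℕ → ℝ) × ℝ | M q.1 = ((-(e * q.2) : ℝ) : EReal)} := rfl
  rw [hpre, ← Measure.map_apply (hmY.prodMk hm0) hS, h, map_eval_gaussianSeq]
  have : IsProbabilityMeasure (gaussianSeq.map fun (x : ℕ → ℝ) (n : ℕ) => x (n + 1)) :=
    Measure.isProbabilityMeasure_map hmY.aemeasurable
  have hna := nullSingletonClass_gaussianReal (μ := 0) (v := 1) one_ne_zero
  rw [Measure.measure_prod_null hS]
  refine ae_of_all _ fun y => Set.Subsingleton.measure_zero ?_ _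
  intro u hu v hv
  simp only [Set.mem_preimage, Set.mem_ofPred_eq] at hu hv
  rw [hu, EReal.coe_eq_coe_iff, neg_inj] at hv
  exact mul_left_cancel₀ he hv

variable {p : ℕ → ℝ}

/-- The supremum over the rational points of `(a, b)` of `e` times the renormalized Dirichlet series
without its first term. -/
noncomputable def tailSup (p : ℕ → ℝ) (e a b : ℝ) (y : ℕ → ℝ) : EReal :=
  ⨆ q : {q : ℚ // a < q ∧ (q : ℝ) < b}, limsup (fun n => ((e * ∑ k ∈ Finset.range n,
    Real.exp ((q.1 : ℝ) * (negLog p (k + 1) - negLog p 0)) * y k : ℝ) : EReal)) atTop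

/-- Rational points and `limsup` make this measurable on all sequences, with no appeal to
convergence. -/
theorem measurable_tailSup (e a b : ℝ) : Measurable (tailSup p e a b) := by
  refine Measurable.iSup fun q => Measurable.limsup fun n => ?_
  fun_prop

/-- Multiplying the series by p_0^σ makes the coefficient of `x 0` equal to 1 for every σ, so the
rest no longer involves `x 0`. -/
theorem tendsto_tail (hp_mono : StrictMono p) (hp_one : 1 ≤ p 0) {x : ℕ → ℝ}
    (hx : IsRegular p x) {σ : ℝ} (hσ : 1 / 2 < σ) :
    Tendsto (fun n => ∑ k ∈ Finset.range n,
      Real.exp (σ * (negLog p (k + 1) - negLog p 0)) * x (k + 1)) atTop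
      (𝓝 (Real.exp (-(σ * negLog p 0)) * limSeries p x σ - x 0)) := by
  have h := ((((tendsto_add_atTop_iff_nat 1).2 (hx.1 σ hσ)).const_mul
    (Real.exp (-(σ * negLog p 0)))).sub_const (x 0))
  refine h.congr fun n => ?_
  rw [partialSum_eq hp_mono hp_one, Finset.sum_range_succ', mul_add, ← mul_assoc, ← Real.exp_add,
    neg_add_cancel, Real.exp_zero, one_mul, add_sub_cancel_right, Finset.mul_sum]
  refine Finset.sum_congr rfl fun k _ => ?_
  rw [← mul_assoc, ← Real.exp_add]
  congr 2
  ring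

/-- Otherwise eF ≤ 0 near z, so e times the renormalized tail is at most -e · `x 0` there, with
equality at z. By continuity its supremum over nearby rationals is exactly that value, which `htail`
forbids. -/
theorem exists_pos_near_zero (hp_mono : StrictMono p) (hp_one : 1 ≤ p 0) {x : ℕ → ℝ}
    (hx : IsRegular p x) {e : ℝ}
    (htail : ∀ a b : ℚ, tailSup p e a b (fun n => x (n + 1)) ≠ ((-(e * x 0) : ℝ) : EReal))
    {z : ℝ} (hz : 1 / 2 < z) (hz0 : limSeries p x z = 0) {T r : ℝ} (hT : T < z) (hr : 0 < r) :
    ∃ w, T < w ∧ |w - z| < r ∧ 0 < e * limSeries p x w := by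
  by_contra! hcon
  obtain ⟨a, ha1, ha2⟩ := exists_rat_btwn (show max (max T (1 / 2)) (z - r) < z from
    max_lt (max_lt hT hz) (by linarith))
  obtain ⟨b, hb1, hb2⟩ := exists_rat_btwn (show z < z + r by linarith)
  have haT : T < a := ((le_max_left _ _).trans (le_max_left _ _)).trans_lt ha1
  have hah : (1 : ℝ) / 2 < a := ((le_max_right _ _).trans (le_max_left _ _)).trans_lt ha1
  have har : z - r < a := (le_max_right _ _).trans_lt ha1
  set H : ℝ → ℝ := fun σ => e * (Real.exp (-(σ * negLog p 0)) * limSeries p x σ - x 0) with hH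
  have hlim : ∀ q : {q : ℚ // (a : ℝ) < q ∧ (q : ℝ) < b},
      limsup (fun n => ((e * ∑ k ∈ Finset.range n,
        Real.exp ((q.1 : ℝ) * (negLog p (k + 1) - negLog p 0)) * x (k + 1) : ℝ) : EReal)) atTop =
        ((H q.1 : ℝ) : EReal) := fun q =>
    ((continuous_coe_real_ereal.tendsto _).comp
      ((tendsto_tail hp_mono hp_one hx (hah.trans q.2.1)).const_mul e)).limsup_eq
  refine htail a b ?_
  rw [tailSup]
  simp_rw [hlim]
  apply le_antisymm
  · refine iSup_le fun q => EReal.coe_le_coe_iff.2 ?_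
    have h1 := hcon q.1 (haT.trans q.2.1)
      (abs_lt.2 ⟨by linarith [q.2.1], by linarith [q.2.2]⟩)
    have h2 := mul_nonpos_of_nonneg_of_nonpos (Real.exp_pos (-((q.1 : ℝ) * negLog p 0))).le h1
    simp only [hH]
    nlinarith
  · refine le_of_forall_lt fun c hc => ?_
    have hHz : H z = -(e * x 0) := by simp [hH, hz0]
    have hHc : ContinuousAt H z := by
      have := hx.2.continuousAt (Ioi_mem_nhds hz)
      exact continuousAt_const.mul (((by fun_prop : Continuous fun σ : ℝ =>
        Real.exp (-(σ * negLog p 0))).continuousAt.mul this).sub continuousAt_const)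
    have hev : ∀ᶠ w in 𝓝 z, c < ((H w : ℝ) : EReal) := by
      refine (continuous_coe_real_ereal.continuousAt.comp hHc).eventually_const_lt ?_
      rw [Function.comp, hHz]
      exact hc
    obtain ⟨ε, hε, hball⟩ := Metric.eventually_nhds_iff.1 hev
    obtain ⟨q, hq1, hq2⟩ := exists_rat_btwn (show z < min (z + ε) b from
      lt_min (by linarith) hb1)
    have hq3 := hq2.trans_le (min_le_left _ _)
    have hq4 := hq2.trans_le (min_le_right _ _)
    have h1 : c < ((H q : ℝ) : EReal) := by
      refine hball ?_
      rw [Real.dist_eq, abs_lt]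
      exact ⟨by linarith, by linarith⟩
    exact h1.trans_le (le_iSup (fun q : {q : ℚ // (a : ℝ) < q ∧ (q : ℝ) < b} =>
      ((H q.1 : ℝ) : EReal)) ⟨q, ha2.trans hq1, hq4⟩)

theorem ae_sign_change_near_zero (hp_mono : StrictMono p) (hp_one : 1 ≤ p 0)
    (hreg : ∀ᵐ x ∂gaussianSeq, IsRegular p x) {T : ℝ} (hT : 1 / 2 < T) :
    ∀ᵐ x ∂gaussianSeq, ∀ z, T < z → limSeries p x z = 0 → ∀ r, 0 < r →
      ∃ v w, T < v ∧ T < w ∧ |v - z| < r ∧ |w - z| < r ∧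
        limSeries p x v < 0 ∧ 0 < limSeries p x w := by
  have hnull : ∀ e : ℝ, e ≠ 0 → ∀ᵐ x ∂gaussianSeq, ∀ a b : ℚ,
      tailSup p e a b (fun n => x (n + 1)) ≠ ((-(e * x 0) : ℝ) : EReal) := fun e he => by
    refine ae_all_iff.2 fun a => ae_all_iff.2 fun b => ?_
    rw [ae_iff]
    simpa using measure_tail_eq_zero (measurable_tailSup (p := p) e a b) he
  filter_upwards [hreg, hnull 1 one_ne_zero, hnull (-1) (by norm_num)] with x hx h1 h2
  intro z hz hz0 r hr
  obtain ⟨w, hw1, hw2, hw3⟩ := exists_pos_near_zero hp_mono hp_one hx h1 (hT.trans hz) hz0 hz hr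
  obtain ⟨v, hv1, hv2, hv3⟩ := exists_pos_near_zero hp_mono hp_one hx h2 (hT.trans hz) hz0 hz hr
  exact ⟨v, w, hv1, hw1, hv2, hw2, by linarith, by linarith⟩

end RandomDirichlet

/-! ### The formula for the expected number of zeros. -/

namespace RandomDirichlet

variable {p : ℕ → ℝ}

theorem aemeasurable_signChanges (hreg : ∀ᵐ x ∂gaussianSeq, IsRegular p x) {T : ℝ}
    (hT : 1 / 2 < T) (m : ℕ) :
    AEMeasurable (fun x => signChanges (limSeries p x) T m) gaussianSeq := by
  unfold signChanges
  refine AEMeasurable.tsum fun i => ?_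
  have h := (aemeasurable_limSeries hreg (hT.trans_le (le_grid T m i))).mul
    (aemeasurable_limSeries hreg (hT.trans_le (le_grid T m (i + 1))))
  have hf : Measurable ((Set.Iio (0 : ℝ)).indicator fun _ => (1 : ℝ≥0∞)) :=
    measurable_const.indicator measurableSet_Iio
  exact hf.comp_aemeasurable h

theorem lintegral_signChanges (hp_mono : StrictMono p) (hp_one : 1 ≤ p 0)
    (hI : ∀ u, 1 < u → Integrable (fun n => Real.exp (u * negLog p n)) Measure.count)
    (hreg : ∀ᵐ x ∂gaussianSeq, IsRegular p x) {T : ℝ} (hT : 1 / 2 < T) (m : ℕ) :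
    ∫⁻ x, signChanges (limSeries p x) T m ∂gaussianSeq =
      (∑' i, ENNReal.ofReal (angle (negLog p) (grid T m i) (grid T m (i + 1)))) *
        ENNReal.ofReal (1 / Real.pi) := by
  have hgr : ∀ i, 1 / 2 < grid T m i := fun i => hT.trans_le (le_grid T m i)
  have hmeas : ∀ i, AEMeasurable (fun x => limSeries p x (grid T m i) *
      limSeries p x (grid T m (i + 1))) gaussianSeq := fun i =>
    (aemeasurable_limSeries hreg (hgr i)).mul (aemeasurable_limSeries hreg (hgr (i + 1)))
  have hf : Measurable ((Set.Iio (0 : ℝ)).indicator fun _ => (1 : ℝ≥0∞)) :=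
    measurable_const.indicator measurableSet_Iio
  have hsum := lintegral_tsum fun i => hf.comp_aemeasurable (hmeas i)
  refine hsum.trans ?_
  rw [← ENNReal.tsum_mul_right]
  congr 1
  ext i
  have hnull : NullMeasurableSet
      {x | limSeries p x (grid T m i) * limSeries p x (grid T m (i + 1)) < 0} gaussianSeq :=
    (hmeas i).nullMeasurableSet_preimage measurableSet_Iio
  have h1 : ∫⁻ x, ((Set.Iio (0 : ℝ)).indicator fun _ => (1 : ℝ≥0∞))
      (limSeries p x (grid T m i) * limSeries p x (grid T m (i + 1))) ∂gaussianSeq =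
      ∫⁻ x, {x | limSeries p x (grid T m i) * limSeries p x (grid T m (i + 1)) < 0}.indicator
        1 x ∂gaussianSeq := rfl
  refine h1.trans ?_
  rw [lintegral_indicator_one₀ hnull,
    measure_limSeries_mul_neg hp_mono hp_one hI hreg (hgr i)
      (grid_strictMono T m (Nat.lt_succ_self i)), div_eq_mul_one_div,
    ENNReal.ofReal_mul (show 0 ≤ angle (negLog p) _ _ from Real.arccos_nonneg _)]

theorem ae_signChanges_le_and_le_liminf (hp_mono : StrictMono p) (hp_one : 1 ≤ p 0)
    (hI : ∀ u, 1 < u → Integrable (fun n => Real.exp (u * negLog p n)) Measure.count)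
    (hreg : ∀ᵐ x ∂gaussianSeq, IsRegular p x) {T : ℝ} (hT : 1 / 2 < T) :
    ∀ᵐ x ∂gaussianSeq, (∀ m, signChanges (limSeries p x) T m ≤ numZeros p x T) ∧
      numZeros p x T ≤ liminf (signChanges (limSeries p x) T) atTop := by
  have hgrid : ∀ᵐ x ∂gaussianSeq, ∀ m i, limSeries p x (grid T m i) ≠ 0 :=
    ae_all_iff.2 fun m => ae_all_iff.2 fun i =>
      ae_limSeries_ne_zero hp_mono hp_one hI hreg (hT.trans_le (le_grid T m i))
  filter_upwards [hreg, hgrid, ae_sign_change_near_zero hp_mono hp_one hreg hT] with x hx hg hz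
  have hF : ContinuousOn (limSeries p x) (Set.Ici T) := hx.2.mono fun σ hσ => hT.trans_le hσ
  rw [numZeros, zeroSet_eq hx hT]
  exact ⟨signChanges_le_encard hF, encard_le_liminf_signChanges hF hg hz⟩

/-- The number of zeros equals almost surely the liminf of the sign-change counts, each of which is
a.e. measurable. -/
theorem aemeasurable_numZeros (hp_mono : StrictMono p) (hp_one : 1 ≤ p 0)
    (hI : ∀ u, 1 < u → Integrable (fun n => Real.exp (u * negLog p n)) Measure.count)
    {T : ℝ} (hT : 1 / 2 < T) : AEMeasurable (fun x => numZeros p x T) gaussianSeq := by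
  have hreg := ae_isRegular hp_mono hp_one hI
  have hmeas : AEMeasurable (fun x => liminf (signChanges (limSeries p x) T) atTop)
      gaussianSeq := by
    simp_rw [liminf_eq_iSup_iInf_of_nat]
    exact .iSup fun n => .biInf _ (Set.to_countable _) fun m _ => aemeasurable_signChanges hreg hT m
  refine hmeas.congr ?_
  filter_upwards [ae_signChanges_le_and_le_liminf hp_mono hp_one hI hreg hT] with x hx
  refine le_antisymm ?_ hx.2
  exact (liminf_le_liminf (Eventually.of_forall hx.1)).trans_eq (by simp)

/-- Fatou's lemma gives the upper bound; the lower bound holds already for each grid before passing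
to the limit. -/
theorem lintegral_numZeros (hp_mono : StrictMono p) (hp_one : 1 ≤ p 0)
    (hI : ∀ u, 1 < u → Integrable (fun n => Real.exp (u * negLog p n)) Measure.count)
    {T : ℝ} (hT : 1 / 2 < T) :
    ∫⁻ x, numZeros p x T ∂gaussianSeq =
      ENNReal.ofReal (1 / Real.pi * ∫ s in Set.Ioi T, Real.sqrt (curv (negLog p) (2 * s))) := by
  have hreg := ae_isRegular hp_mono hp_one hI
  have hZ := strictAnti_negLog hp_mono hp_one
  have hae := ae_signChanges_le_and_le_liminf hp_mono hp_one hI hreg hT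
  have hlim : Tendsto (fun m => ∫⁻ x, signChanges (limSeries p x) T m ∂gaussianSeq) atTop
      (𝓝 (ENNReal.ofReal (1 / Real.pi * ∫ s in Set.Ioi T, Real.sqrt (curv (negLog p) (2 * s))))) := by
    simp_rw [lintegral_signChanges hp_mono hp_one hI hreg hT]
    rw [mul_comm, ENNReal.ofReal_mul (integral_nonneg fun s => Real.sqrt_nonneg _),
      ofReal_integral_eq_lintegral_ofReal (integrableOn_sqrt_curv hZ hI hT)
        (ae_of_all _ fun s => Real.sqrt_nonneg _)]
    exact ENNReal.Tendsto.mul_const (tendsto_tsum_angle hZ hI hT) (Or.inr ENNReal.ofReal_ne_top)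
  refine le_antisymm ?_ ?_
  · calc ∫⁻ x, numZeros p x T ∂gaussianSeq
        ≤ ∫⁻ x, liminf (fun m => signChanges (limSeries p x) T m) atTop ∂gaussianSeq :=
          lintegral_mono_ae (hae.mono fun x hx => hx.2)
      _ ≤ liminf (fun m => ∫⁻ x, signChanges (limSeries p x) T m ∂gaussianSeq) atTop :=
          lintegral_liminf_le' (aemeasurable_signChanges hreg hT)
      _ = _ := hlim.liminf_eq
  · exact le_of_tendsto' hlim fun m => lintegral_mono_ae (hae.mono fun x hx => hx.1 m)

theorem map_eq_gaussianSeq {Ω : Type*} [MeasurableSpace Ω] {μ : Measure Ω} {X : ℕ → Ω → ℝ}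
    (hX : ∀ n, HasLaw (X n) (gaussianReal 0 1) μ) (hind : iIndepFun X μ) :
    μ.map (fun ω n => X n ω) = gaussianSeq := by
  rw [hind.map_fun_eq_infinitePi_map₀' fun n => (hX n).aemeasurable]
  congr 1
  ext1 n
  exact (hX n).map_eq

theorem aemeasurable_numZeros_comp (hp_mono : StrictMono p) (hp_one : 1 ≤ p 0)
    (hI : ∀ u, 1 < u → Integrable (fun n => Real.exp (u * negLog p n)) Measure.count)
    {Ω : Type*} [MeasurableSpace Ω] {μ : Measure Ω} {X : ℕ → Ω → ℝ}
    (hX : ∀ n, HasLaw (X n) (gaussianReal 0 1) μ) (hind : iIndepFun X μ) {T : ℝ} (hT : 1 / 2 < T) :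
    AEMeasurable (fun ω => numZeros p (fun n => X n ω) T) μ := by
  have h := aemeasurable_numZeros hp_mono hp_one hI hT
  rw [← map_eq_gaussianSeq hX hind] at h
  exact h.comp_aemeasurable (aemeasurable_pi_iff.2 fun n => (hX n).aemeasurable)

/-- The expected number of zeros in `[T, ∞)` is `1 / π` times the length of the curve
`s ↦ (p n ^ (-s))ₙ`, `s ≥ T`, projected to the unit sphere of `ℓ²`. -/
theorem expectedNumZeros_eq (hp_mono : StrictMono p) (hp_one : 1 ≤ p 0)
    (hI : ∀ u, 1 < u → Integrable (fun n => Real.exp (u * negLog p n)) Measure.count)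
    {Ω : Type*} [MeasurableSpace Ω] {μ : Measure Ω} {X : ℕ → Ω → ℝ}
    (hX : ∀ n, HasLaw (X n) (gaussianReal 0 1) μ) (hind : iIndepFun X μ) {T : ℝ} (hT : 1 / 2 < T) :
    expectedNumZeros μ p X T =
      ENNReal.ofReal (1 / Real.pi * ∫ s in Set.Ioi T, Real.sqrt (curv (negLog p) (2 * s))) := by
  have h := aemeasurable_numZeros hp_mono hp_one hI hT
  rw [← lintegral_numZeros hp_mono hp_one hI hT, ← map_eq_gaussianSeq hX hind] at *
  rw [lintegral_map' h (aemeasurable_pi_iff.2 fun n => (hX n).aemeasurable)]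
  rfl

end RandomDirichlet

/-! ### Conclusion. -/

theorem theorem4
    -- the set `P = {p 0 < p 1 < ...}` with `p 0 ≥ 1` and `p n → ∞`
    (p : ℕ → ℝ) (hp_mono : StrictMono p) (hp_one : 1 ≤ p 0) (hp_top : Tendsto p atTop atTop)
    -- `π(x) = (1 + o(1)) x (log x) ^ α` as `x → ∞`
    (α : ℝ)
    (hπ : RandomDirichlet.countingFunction p ~[atTop] fun x : ℝ => x * Real.log x ^ α) :
    -- the constant depends only on `P`
    ∃ c : ℝ, 0 < c ∧
      ∀ (Ω : Type*) [MeasurableSpace Ω] (μ : Measure Ω) [IsProbabilityMeasure μ]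
        (X : ℕ → Ω → ℝ), (∀ n, HasLaw (X n) (gaussianReal 0 1) μ) → iIndepFun X μ →
        -- `N(T, ∞)` is a random variable with finite expectation
        (∀ T : ℝ, 1 / 2 < T →
          AEMeasurable (fun ω => RandomDirichlet.numZeros p (fun n => X n ω) T) μ ∧
          RandomDirichlet.expectedNumZeros μ p X T ≠ ∞) ∧
        (-1 < α →
          (fun T => (RandomDirichlet.expectedNumZeros μ p X T).toReal) ~[𝓝[>] (1 / 2 : ℝ)]
            fun T => Real.sqrt (1 + α) / (2 * Real.pi) * Real.log (1 / (T - 1 / 2))) ∧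
        (α = -1 →
          (fun T => (RandomDirichlet.expectedNumZeros μ p X T).toReal) ~[𝓝[>] (1 / 2 : ℝ)]
            fun T => 1 / Real.pi * Real.sqrt (Real.log (1 / (T - 1 / 2)))) ∧
        (α < -1 →
          Tendsto (fun T => (RandomDirichlet.expectedNumZeros μ p X T).toReal)
            (𝓝[>] (1 / 2 : ℝ)) (𝓝 c)) := by
  have hI := fun u (hu : 1 < u) =>
    RandomDirichlet.integrable_exp_negLog hp_mono hp_one hp_top hπ hu
  set I : ℝ → ℝ := fun T =>
    ∫ s in Set.Ioi T, Real.sqrt (RandomDirichlet.curv (RandomDirichlet.negLog p) (2 * s)) with hIdef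
  have hI0 : ∀ T, 0 ≤ I T := fun T => integral_nonneg fun s => Real.sqrt_nonneg _
  have hπ0 := Real.pi_pos
  -- The constant is fixed before the probability space is introduced. For α ≥ -1 any positive
  -- number will do, since only the last case refers to c.
  obtain ⟨c, hc, hcI⟩ : ∃ c : ℝ, 0 < c ∧ (α < -1 → c = 1 / Real.pi * I (1 / 2)) := by
    by_cases hα : α < -1
    · have := RandomDirichlet.integral_sqrt_curv_pos hp_mono hp_one hp_top hα hπ
      exact ⟨1 / Real.pi * I (1 / 2), by positivity, fun _ => rfl⟩
    · exact ⟨1, one_pos, fun h => absurd h hα⟩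
  refine ⟨c, hc, fun Ω _ μ _ X hX hind => ?_⟩
  have hE : ∀ T, 1 / 2 < T → RandomDirichlet.expectedNumZeros μ p X T =
      ENNReal.ofReal (1 / Real.pi * I T) := fun T hT =>
    RandomDirichlet.expectedNumZeros_eq hp_mono hp_one hI hX hind hT
  have hEr : (fun T => 1 / Real.pi * I T) =ᶠ[𝓝[>] (1 / 2 : ℝ)]
      fun T => (RandomDirichlet.expectedNumZeros μ p X T).toReal := by
    filter_upwards [self_mem_nhdsWithin] with T hT
    rw [hE T hT, ENNReal.toReal_ofReal (mul_nonneg (by positivity) (hI0 T))]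
  refine ⟨fun T hT => ⟨?_, ?_⟩, fun hα => ?_, fun hα => ?_, fun hα => ?_⟩
  · exact RandomDirichlet.aemeasurable_numZeros_comp hp_mono hp_one hI hX hind hT
  · rw [hE T hT]
    exact ENNReal.ofReal_ne_top
  · have h := (IsEquivalent.refl (u := fun _ : ℝ => 1 / Real.pi)).mul
      (RandomDirichlet.integral_sqrt_curv_isEquivalent_log hp_mono hp_one hp_top hα hπ)
    refine (h.congr_left hEr).congr_right (Eventually.of_forall fun T => ?_)
    simp only [Pi.mul_apply]
    field_simp
  · subst hα
    have h := (IsEquivalent.refl (u := fun _ : ℝ => 1 / Real.pi)).mul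
      (RandomDirichlet.integral_sqrt_curv_isEquivalent_sqrt_log hp_mono hp_one hp_top hπ)
    exact h.congr_left hEr
  · rw [hcI hα]
    exact ((RandomDirichlet.tendsto_integral_sqrt_curv_of_lt hp_mono hp_one hp_top hα hπ).const_mul
      _).congr' hEr
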